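/- **Setting.** Let $N$ be a finite ground set with $|N|=n$, let $f:2^N\to\mathbb R_{\ge 0}$ be a nonnegative (not necessarily monotone) submodular function, i.e. $f(S\cup\{x\})-f(S)\ge f(T\cup\{x\})-f(T)$ for all $S\subseteq T\subseteq N$, $x\in N\setminus T$, let $1\le k\le n$, $\varepsilon,\delta\in(0,1)$, and let $\mathrm{OPT}=\max\{f(S):S\subseteq N,\ |S|\le k\}$. Algorithms access $f$ through an evaluation oracle. In an adaptive round an algorithm asks a finite family of queries simultaneously; the queries may depend on answers from earlier rounds and on the algorithm's random bits, but not on answers from the same round. Write $\mathcal U(A,t)$ for the uniform distribution on the $t$-element subsets of $A$. **Threshold-Sampling, modified** (input $k,\tau,\varepsilon,\delta$; output a pair $(S,A)$). Put $\hat\varepsilon=\varepsilon/3$, $r=\lceil\log_{(1-\hat\varepsilon)^{-1}}(2n/\delta)\rceil$, $m=\lceil\log_2(k)/\hat\varepsilon\rceil$, $\hat\delta=\delta/(2r(m+1))$, $\ell=16\lceil\log_2(2/\hat\delta)/\hat\varepsilon^2\rceil$. Start with $S=\emptyset$, $A=N$ and repeat at most $r$ times: replace $A$ by $\{x\in A: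 f(S\cup\{x\})-f(S)\ge\tau\}$; if $|A|<3k$, stop. For each $i=0,\dots,m$ let $t_i=\min\{\lfloor(1+\hat\varepsilon)^i\rfloor,|A|\}$ and let $\bar\mu_i$ be the average of $\ell$ independent samples of the indicator of $f(S\cup T\cup\{x\})-f(S\cup T)\ge\tau$, where $T\sim\mathcal U(A,t_i-1)$ and then $x$ is uniform in $A\setminus T$ (all these samples, for all $i$, are queried in one round). Let $t=t_i$ for the first $i$ with $\bar\mu_i\le 1-1.5\hat\varepsilon$, or $t=t_m$ if there is none. Sample $T\sim\mathcal U(A,\min\{t,k-|S|\})$ and replace $S$ by $S\cup T$; if $|S|=k$, stop. **Unconstrained-Max** (input $A,\varepsilon,\delta$). Output the best of $\lceil\log(1/\delta)/\log(1+\tfrac43\varepsilon)\rceil$ independent uniformly random subsets of $A$, all evaluated in one round. **Adaptive-Nonmonotone-Max** (input $k,\varepsilon,\delta$). Put $\hat\varepsilon=\varepsilon/6$, $r=\lceil 2\log_2(k)/\hat\varepsilon\rceil$, $\hat\delta=\delta/(2(r+1))$, $\Delta^*=\max_{x\in N}f(\{x\})$. For $i=0,\dots,r$ in parallel (with independent randomness):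 let $\tau=\frac17(1+\hat\varepsilon)^i\Delta^*/k$; let $(S,A)$ be the output of the modified Threshold-Sampling on $(k,\tau,\hat\varepsilon,\hat\delta)$; if $|A|<3k$, let $U$ be the output of Unconstrained-Max on $(A,\hat\varepsilon,\hat\delta)$, otherwise $U=\emptyset$; let $U'\sim\mathcal U(U,k)$ if $|U|>k$, and $U'=U$ otherwise; order $U'$ uniformly at random and let $U''$ be the prefix of this ordering (of any length $0,\dots,|U'|$) with the largest value of $f$. Output the set $R$ of largest value among $\emptyset$ and all the sets $S$, $U''$ obtained for $i=0,\dots,r$. **Theorem.** There is an absolute constant $C\in\mathbb N$ such that for all $N,f,k,\varepsilon,\delta$ as above, Adaptive-Nonmonotone-Max has the following properties. 1. In every execution the output satisfies $|R|\le k$, there are at most $C\log((n+1)/\delta)/\varepsilon$ adaptive rounds, and each round contains at most $\bigl(C\,n\,(1+\log(1/\delta))/\varepsilon\bigr)^{C}$ queries. 2. If $n\ge \bigl(C(1+\log(1/\delta))/\varepsilon\bigr)^{C}$, the expected number of oracle queries is at most $C\,n\log(k+1)/\varepsilon^2$. 3. $\mathbb E[f(R)]\ge(0.026-\varepsilon)\,\mathrm{OPT}$.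 The expectations in 2 and 3 are over all the randomness of the algorithm, with no conditioning on a success event. -/

import Mathlib

open scoped ENNReal

namespace LowAdaptivity

/-! ### Set functions -/

/-- Diminishing returns: `f (S ∪ {x}) - f S ≥ f (T ∪ {x}) - f T` for `S ⊆ T` and `x ∉ T`. -/
def IsSubmodular {N : Type} [DecidableEq N] (f : Finset N → ℝ) : Prop :=
  ∀ S T : Finset N, S ⊆ T → ∀ x, x ∉ T → f (insert x T) - f T ≤ f (insert x S) - f S

/-- `OPT`, the maximum of `f S` over all `S` with `|S| ≤ k`. -/
noncomputable def opt {N : Type} [Fintype N] [DecidableEq N] (f : Finset N → ℝ) (k : ℕ) : ℝ :=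
  ((Finset.univ : Finset (Finset N)).filter fun S => S.card ≤ k).sup' ⟨∅, by simp⟩ f

/-! ### Randomized algorithms with parallel access to an evaluation oracle -/

/-- Randomized algorithms over the ground set `N` with output in `α`, which access the objective
function only through rounds of simultaneous queries. An algorithm either stops with an output, or
draws a sample, or asks a finite family of queries at once (one adaptive round) and continues with
the family of answers. -/
inductive Alg (N α : Type) : Type 1
  | ret (a : α) : Alg N α
  | sample {Ω : Type} (p : PMF Ω) (next : Ω → Alg N α) : Alg N α
  | query {ι : Type} (inst : Fintype ι) (q : ι → Finset N) (next : (ι → ℝ) → Alg N α) : Alg N α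

namespace Alg

variable {N α β : Type}

/-- Run the first algorithm, then continue with its output. -/
def bind : Alg N α → (α → Alg N β) → Alg N β
  | ret a, g => g a
  | sample p next, g => sample p fun ω => (next ω).bind g
  | query inst q next, g => query inst q fun ans => (next ans).bind g

/-- Auxiliary to `par`: the left algorithm is about to ask the batch `q`, and `cont` runs
its continuation in parallel with a given algorithm. Pending samples of the right algorithm are
drawn first; then its next batch, if any, is asked in the same round as `q`. -/
def parQuery {ι : Type} (inst : Fintype ι) (q : ι → Finset N)
    (cont : (ι → ℝ) → Alg N β → Alg N (α × β)) : Alg N β → Alg N (α × β)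
  | ret b => query inst q fun ans => cont ans (ret b)
  | sample p next => sample p fun ω => parQuery inst q cont (next ω)
  | query inst' q' next =>
      query (@instFintypeSum _ _ inst inst') (Sum.elim q q') fun ans =>
        cont (fun i => ans (Sum.inl i)) (next fun j => ans (Sum.inr j))

/-- Run two algorithms in parallel with independent randomness: the `j`-th rounds of the two are
merged into one round, whose batch is the disjoint union of the two batches. -/
def par : Alg N α → Alg N β → Alg N (α × β)
  | ret a, B => B.bind fun b => ret (a, b)
  | sample p next, B => sample p fun ω => par (next ω) B
  | query inst q next, B => parQuery inst q (fun ans B' => par (next ans) B') B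

/-- Run a list of algorithms in parallel. -/
def parAll : List (Alg N α) → Alg N (List α)
  | [] => ret []
  | A :: l => (par A (parAll l)).bind fun z => ret (z.1 :: z.2)

/-- Execution with oracle `f`: the joint law of the output and of the list of batch sizes, one
entry per adaptive round. The length of the list is the number of adaptive rounds and its sum is
the number of oracle queries (counted with repetitions). -/
noncomputable def run (f : Finset N → ℝ) : Alg N α → PMF (α × List ℕ)
  | ret a => PMF.pure (a, [])
  | sample p next => p.bind fun ω => run f (next ω)
  | query inst q next =>
      (run f (next fun i => f (q i))).map fun z => (z.1, @Fintype.card _ inst :: z.2)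

end Alg

/-- The expectation of a nonnegative quantity. -/
noncomputable def expect {Ω : Type} (P : PMF Ω) (X : Ω → ℝ≥0∞) : ℝ≥0∞ :=
  ∑' ω, P ω * X ω

/-! ### Sampling -/

/-- The law of a vector of independent samples. -/
noncomputable def indep {α : Type} : {n : ℕ} → (Fin n → PMF α) → PMF (Fin n → α)
  | 0, _ => PMF.pure Fin.elim0
  | _ + 1, p => (p 0).bind fun x => (indep fun i => p i.succ).map fun v => Fin.cons x v

/-- The uniform law on the subsets of `A` of size `t` (used only for `t ≤ |A|`; otherwise `t` is
replaced by `|A|`). -/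
noncomputable def unifSize {N : Type} (A : Finset N) (t : ℕ) : PMF (Finset N) :=
  PMF.uniformOfFinset (A.powersetCard (min t A.card))
    (Finset.powersetCard_nonempty.2 (min_le_right _ _))

/-- The uniform law on all subsets of `A`. -/
noncomputable def unifSubset {N : Type} (A : Finset N) : PMF (Finset N) :=
  PMF.uniformOfFinset A.powerset ⟨∅, Finset.empty_mem_powerset A⟩

/-- The two oracle queries `(S ∪ T, S ∪ T ∪ {x})` that simulate one draw of the indicator of
`f (S ∪ T ∪ {x}) - f (S ∪ T) ≥ τ`, where `T` is a uniform subset of `A` of size `t - 1` and `x` is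
then uniform in `A \ T` (which is nonempty for `1 ≤ t ≤ |A|`). -/
noncomputable def indicatorQueries {N : Type} [DecidableEq N] (S A : Finset N) (t : ℕ) :
    PMF (Finset N × Finset N) :=
  (unifSize A (t - 1)).bind fun T =>
    if h : (A \ T).Nonempty then
      (PMF.uniformOfFinset (A \ T) h).map fun x => (S ∪ T, insert x (S ∪ T))
    else PMF.pure (S ∪ T, S ∪ T)

/-- The pair with the largest value in a list of pairs (set, value); the first one in a tie. -/
noncomputable def argmax {N : Type} : List (Finset N × ℝ) → Finset N × ℝ
  | [] => (∅, 0)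
  | p :: l => l.foldl (fun best z => if best.2 < z.2 then z else best) p

/-! ### The subroutines and the algorithm -/

section

variable {N : Type} [Fintype N] [DecidableEq N]

/-- The main loop of Threshold-Sampling, modified to stop when fewer than `3 k` candidates are
left, with `r` iterations to go, current solution `S` and current candidates `A`. Here `ε` is the
already reduced error, and `m`, `l` are the parameters computed in `thresholdSampling`. One
iteration takes two adaptive rounds: one for the filter, and one for the indicators of all the
sizes `i = 0, …, m`, which are drawn in parallel before the first bad size is looked up. -/
noncomputable def thresholdLoop (k : ℕ) (τ ε : ℝ) (m l : ℕ) :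
    ℕ → Finset N → Finset N → Alg N (Finset N × Finset N)
  | 0, S, A => .ret (S, A)
  | r + 1, S, A =>
      .query (ι := Option {x // x ∈ A}) inferInstance
        (fun o => o.elim S fun x => insert x.1 S) fun val =>
      let A' : Finset N :=
        (A.attach.filter fun x => τ ≤ val (some x) - val none).image Subtype.val
      if A'.card < 3 * k then .ret (S, A')
      else
        let size : ℕ → ℕ := fun i => min ⌊(1 + ε) ^ i⌋₊ A'.card
        .sample (indep fun i : Fin (m + 1) =>
          indep fun _ : Fin l => indicatorQueries S A' (size i)) fun X =>
        .query (ι := (Fin (m + 1) × Fin l) × Bool) inferInstance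
          (fun c => if c.2 then (X c.1.1 c.1.2).2 else (X c.1.1 c.1.2).1) fun ans =>
        let mean : Fin (m + 1) → ℝ := fun i =>
          (∑ j : Fin l, if τ ≤ ans ((i, j), true) - ans ((i, j), false) then (1 : ℝ) else 0) / l
        let i : Fin (m + 1) :=
          ((List.finRange (m + 1)).find? fun i => decide (mean i ≤ 1 - 1.5 * ε)).getD (Fin.last m)
        .sample (unifSize A' (min (size i) (k - S.card))) fun T =>
        if (S ∪ T).card = k then .ret (S ∪ T, A')
        else thresholdLoop k τ ε m l r (S ∪ T) A'

/-- Threshold-Sampling with constraint `k`, threshold `τ`, error `ε` and failure probability `δ`,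
modified to stop when fewer than `3 k` candidates are left. It outputs the solution `S` and the
remaining candidates `A`. -/
noncomputable def thresholdSampling (k : ℕ) (τ ε δ : ℝ) : Alg N (Finset N × Finset N) :=
  let ε' : ℝ := ε / 3
  let r : ℕ := ⌈Real.logb (1 - ε')⁻¹ (2 * Fintype.card N / δ)⌉₊
  let m : ℕ := ⌈Real.logb 2 k / ε'⌉₊
  let δ' : ℝ := δ / (2 * r * (m + 1))
  let l : ℕ := 16 * ⌈Real.logb 2 (2 / δ') / ε' ^ 2⌉₊
  thresholdLoop k τ ε' m l r ∅ Finset.univ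

/-- Unconstrained-Max on the ground subset `A`: the best of several independent uniformly random
subsets of `A`, evaluated in a single round. -/
noncomputable def unconstrainedMax (A : Finset N) (ε δ : ℝ) : Alg N (Finset N) :=
  let t : ℕ := ⌈Real.log (1 / δ) / Real.log (1 + 4 / 3 * ε)⌉₊
  .sample (indep fun _ : Fin t => unifSubset A) fun R =>
  .query (ι := Fin t) inferInstance R fun val =>
  .ret (argmax ((List.finRange t).map fun i => (R i, val i))).1

/-- The first `j` elements of an ordering of `U`. -/
def orderPrefix {U : Finset N} (σ : Fin U.card ≃ {x // x ∈ U}) (j : ℕ) : Finset N :=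
  (Finset.univ.filter fun i : Fin U.card => i.1 < j).image fun i => (σ i).1

/-- The uniform law on the orderings of `U`. -/
noncomputable def unifOrder (U : Finset N) : PMF (Fin U.card ≃ {x // x ∈ U}) :=
  PMF.uniformOfFinset Finset.univ ⟨U.equivFin.symm, Finset.mem_univ _⟩

/-- The work of Adaptive-Nonmonotone-Max for one threshold `τ`, with reduced parameters `ε`, `δ`.
It outputs the two candidate sets `S` and `U''` together with their values. -/
noncomputable def thresholdBranch (k : ℕ) (ε δ τ : ℝ) : Alg N (List (Finset N × ℝ)) :=
  (thresholdSampling k τ ε δ).bind fun SA =>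
  (if SA.2.card < 3 * k then unconstrainedMax SA.2 ε δ else Alg.ret ∅).bind fun U =>
  (if k < U.card then Alg.sample (unifSize U k) Alg.ret else Alg.ret U).bind fun U' =>
  .sample (unifOrder U') fun σ =>
  .query (ι := Option (Fin (U'.card + 1))) inferInstance
    (fun o => o.elim SA.1 fun j => orderPrefix σ j.1) fun val =>
  .ret [(SA.1, val none),
    argmax ((List.finRange (U'.card + 1)).map fun j => (orderPrefix σ j.1, val (some j)))]

/-- Adaptive-Nonmonotone-Max with constraint `k`, error `ε` and failure probability `δ`, with
`c₁ = 1 / 7` and `c₃ = 3`. The first round evaluates the empty set and all singletons. -/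
noncomputable def adaptiveNonmonotoneMax (k : ℕ) (ε δ : ℝ) : Alg N (Finset N) :=
  let ε' : ℝ := ε / 6
  let r : ℕ := ⌈2 * Real.logb 2 k / ε'⌉₊
  let δ' : ℝ := δ / (2 * (r + 1))
  .query (ι := Option N) inferInstance (fun o => o.elim ∅ fun x => {x}) fun val =>
  let maxSingleton : ℝ := ⨆ x : N, val (some x)
  (Alg.parAll ((List.range (r + 1)).map fun i =>
    thresholdBranch k ε' δ' (1 / 7 * (1 + ε') ^ i * maxSingleton / k))).bind fun cands =>
  .ret (argmax ((∅, val none) :: cands.flatten)).1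

end

end LowAdaptivity

/-!
Adaptive-Nonmonotone-Max works because one of its thresholds `τ` satisfies `k τ ≈ 2 / 7 OPT`
(`exists_threshold`), and the branch with this threshold alone has expected value at least
`0.026 OPT` (`expect_thresholdBranch_ge`). The output of the parallel run is at least as good as
that of each branch.

**Threshold-Sampling.** Let `S`, `A` be the output of the loop. The analysis is in expectation and
inductive over the iterations.

* By a Chernoff bound, the chosen batch size is *good* except with small probability
  (`ev_not_goodIndex_le`): one size below, at least the fraction `1 - 2 ε` of the elements of a
  random batch has marginal value at least `τ`, while at the chosen size the fraction is at most
  `1 - ε` or the solution is completed.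
* The elements of a batch that gain `τ` with respect to all the rest of the batch may be added
  last. The others form a random set that contains each of the at least `3 k` candidates with
  small probability, so they lose only a small fraction of the value, by the sampling lemma
  `IsSubmodular.ev_ge`. The losses over the iterations are absorbed by the potential
  `weight k |S| * f S`, whose weight grows from `2 / 3` to `1`. Hence `E[f S] ≥ c τ E|S|` up to a
  small error, with `c` slightly below `4 / 15` (`ev_loop_value_ge`).
* Each element belongs to `S` with probability at most `E|S| / (3 k)` (`ev_loop_mem_le`), so
  `E[f (S ∪ O)] ≥ (1 - E|S| / (3 k)) OPT` for an optimal set `O`.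
* The number of candidates shrinks by the factor `1 - ε` in expectation, so the loop rarely ends
  with many candidates and `|S| < k` (`ev_loop_fail_le`). Therefore many candidates remain with
  probability at most `E|S| / k` up to a small error.

**The value of a branch.** Elements outside of `A` have marginal value below `τ`, so that
`f (S ∪ O) ≤ k τ + f S + f (O ∩ A)` (`union_opt_le`). If fewer than `3 k` candidates remain, a
random subset of `A` has at least a quarter of `f (O ∩ A)` in expectation, and its reduction to
`k` elements keeps a third of it. The branch thus finds an expected value of at least both `f S`
and `(f S + f (O ∩ A)) / 13`. A convex combination of the two bounds is linear in the quantities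
estimated above (`expect_afterSampling_ge_linear`), and with `x = E|S| / k` the result is a linear
function of `x` with nonnegative slope, whose value at `x = 0` is just above `0.026 OPT`
(`branch_arith`). For `k = 1` the failure probability `δ` is not reduced enough for this estimate,
but the loop makes only one iteration, and the bound is immediate
(`expect_thresholdBranch_one_ge`).

**Rounds and queries.** Rounds of parallel branches are merged, so that the number of rounds is
that of the longest branch and the numbers of queries add up (`Alg.run_par`). The number of
iterations is at most `k`, since each iteration adds an element, and at most the parameter
`r = O(log (n k / (ε δ)) / ε)`. The second bound suffices if `1 / ε ≤ n` and the first one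
otherwise (`rounds_le`). The filtering steps cost `O(n / ε)` queries per branch in expectation
because the number of candidates decreases geometrically (`expect_loop_queries_le`). All other
costs are polynomial in `log n`, `1 / ε` and `log (1 / δ)`, hence at most `n` for large `n`
(`scale_pow_le`).
-/

namespace LowAdaptivity

/-! ### Expectations -/

section Expect

variable {Ω Ω' : Type}

lemma expect_pure (a : Ω) (X : Ω → ℝ≥0∞) : expect (PMF.pure a) X = X a := by
  classical
  unfold expect
  rw [tsum_eq_single a]
  · simp
  · intro b hb; simp [PMF.pure_apply, hb]

lemma expect_bind (P : PMF Ω) (g : Ω → PMF Ω') (X : Ω' → ℝ≥0∞) :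
    expect (P.bind g) X = expect P fun ω => expect (g ω) X := by
  unfold expect
  simp only [PMF.bind_apply, ← ENNReal.tsum_mul_right, ← ENNReal.tsum_mul_left]
  rw [ENNReal.tsum_comm]
  simp only [mul_assoc]

lemma expect_map (P : PMF Ω) (g : Ω → Ω') (X : Ω' → ℝ≥0∞) :
    expect (P.map g) X = expect P fun ω => X (g ω) := by
  rw [← PMF.bind_pure_comp, expect_bind]
  simp [expect_pure]

lemma expect_mono_support {P : PMF Ω} {X Y : Ω → ℝ≥0∞} (h : ∀ ω ∈ P.support, X ω ≤ Y ω) :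
    expect P X ≤ expect P Y := by
  refine ENNReal.tsum_le_tsum fun ω => ?_
  by_cases hω : P ω = 0
  · simp [hω]
  · gcongr; exact h ω ((P.mem_support_iff ω).2 hω)

lemma expect_const (P : PMF Ω) (c : ℝ≥0∞) : expect P (fun _ => c) = c := by
  unfold expect; rw [ENNReal.tsum_mul_right, P.tsum_coe, one_mul]

lemma expect_add (P : PMF Ω) (X Y : Ω → ℝ≥0∞) :
    expect P (fun ω => X ω + Y ω) = expect P X + expect P Y := by
  unfold expect; rw [← ENNReal.tsum_add]; simp [mul_add]

lemma expect_const_mul (P : PMF Ω) (c : ℝ≥0∞) (X : Ω → ℝ≥0∞) :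
    expect P (fun ω => c * X ω) = c * expect P X := by
  unfold expect; rw [← ENNReal.tsum_mul_left]; congr 1; ext; ring

/-- The expectation of a real random variable. It is used on finite types only, so that no
integrability is at stake. -/
noncomputable def ev (P : PMF Ω) (X : Ω → ℝ) : ℝ := ∑' ω, (P ω).toReal * X ω

lemma ev_pure (a : Ω) (X : Ω → ℝ) : ev (PMF.pure a) X = X a := by
  classical
  unfold ev
  rw [tsum_eq_single a]
  · simp
  · intro b hb; simp [PMF.pure_apply, hb]

lemma ev_const_mul (P : PMF Ω) (c : ℝ) (X : Ω → ℝ) : ev P (fun ω => c * X ω) = c * ev P X := by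
  unfold ev; rw [← tsum_mul_left]; congr 1; ext; ring

lemma ev_mul_const (P : PMF Ω) (c : ℝ) (X : Ω → ℝ) : ev P (fun ω => X ω * c) = ev P X * c := by
  unfold ev; rw [← tsum_mul_right]; congr 1; ext; ring

lemma ev_const (P : PMF Ω) (c : ℝ) : ev P (fun _ => c) = c := by
  unfold ev
  rw [tsum_mul_right, ← ENNReal.tsum_toReal_eq (fun a => P.apply_ne_top a), P.tsum_coe]
  simp

variable [Finite Ω] [Finite Ω']

lemma ev_eq_sum {Ω : Type} [Fintype Ω] (P : PMF Ω) (X : Ω → ℝ) :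
    ev P X = ∑ ω, (P ω).toReal * X ω := tsum_fintype _

lemma ev_bind (P : PMF Ω) (g : Ω → PMF Ω') (X : Ω' → ℝ) :
    ev (P.bind g) X = ev P fun ω => ev (g ω) X := by
  have := Fintype.ofFinite Ω
  have := Fintype.ofFinite Ω'
  simp only [ev_eq_sum, PMF.bind_apply, tsum_fintype, Finset.mul_sum]
  rw [Finset.sum_comm]
  refine Finset.sum_congr rfl fun b _ => ?_
  rw [ENNReal.toReal_sum (fun a _ => ENNReal.mul_ne_top (P.apply_ne_top a) ((g a).apply_ne_top b)),
    Finset.sum_mul]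
  simp only [ENNReal.toReal_mul, mul_assoc]

lemma ev_map (P : PMF Ω) (g : Ω → Ω') (X : Ω' → ℝ) :
    ev (P.map g) X = ev P fun ω => X (g ω) := by
  rw [← PMF.bind_pure_comp, ev_bind]
  simp [ev_pure]

lemma ev_mono_support {P : PMF Ω} {X Y : Ω → ℝ} (h : ∀ ω ∈ P.support, X ω ≤ Y ω) :
    ev P X ≤ ev P Y := by
  have := Fintype.ofFinite Ω
  simp only [ev_eq_sum]
  refine Finset.sum_le_sum fun ω _ => ?_
  by_cases hω : P ω = 0
  · simp [hω]
  · gcongr; exact h ω ((P.mem_support_iff ω).2 hω)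

lemma ev_mono {P : PMF Ω} {X Y : Ω → ℝ} (h : ∀ ω, X ω ≤ Y ω) : ev P X ≤ ev P Y :=
  ev_mono_support fun ω _ => h ω

lemma ev_congr_support {P : PMF Ω} {X Y : Ω → ℝ} (h : ∀ ω ∈ P.support, X ω = Y ω) :
    ev P X = ev P Y :=
  le_antisymm (ev_mono_support fun ω hω => (h ω hω).le) (ev_mono_support fun ω hω => (h ω hω).ge)

lemma ev_add (P : PMF Ω) (X Y : Ω → ℝ) : ev P (fun ω => X ω + Y ω) = ev P X + ev P Y := by
  have := Fintype.ofFinite Ω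
  simp [ev_eq_sum, mul_add, Finset.sum_add_distrib]

lemma ev_sub (P : PMF Ω) (X Y : Ω → ℝ) : ev P (fun ω => X ω - Y ω) = ev P X - ev P Y := by
  have := Fintype.ofFinite Ω
  simp [ev_eq_sum, mul_sub, Finset.sum_sub_distrib]

lemma ev_sum {ι : Type} (s : Finset ι) (P : PMF Ω) (X : ι → Ω → ℝ) :
    ev P (fun ω => ∑ i ∈ s, X i ω) = ∑ i ∈ s, ev P (X i) := by
  have := Fintype.ofFinite Ω
  simp only [ev_eq_sum, Finset.mul_sum]
  rw [Finset.sum_comm]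

lemma ev_nonneg {P : PMF Ω} {X : Ω → ℝ} (h : ∀ ω, 0 ≤ X ω) : 0 ≤ ev P X := by
  have := ev_mono (P := P) h
  rwa [ev_const] at this

lemma expect_ofReal (P : PMF Ω) {X : Ω → ℝ} (h : ∀ ω, 0 ≤ X ω) :
    expect P (fun ω => ENNReal.ofReal (X ω)) = ENNReal.ofReal (ev P X) := by
  have := Fintype.ofFinite Ω
  rw [ev_eq_sum, ENNReal.ofReal_sum_of_nonneg fun ω _ => mul_nonneg ENNReal.toReal_nonneg (h ω)]
  simp only [expect, tsum_fintype]
  refine Finset.sum_congr rfl fun ω _ => ?_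
  rw [ENNReal.ofReal_mul ENNReal.toReal_nonneg, ENNReal.ofReal_toReal (P.apply_ne_top ω)]

/-- The uniform law: expectations are averages. -/
lemma ev_uniformOfFinset (s : Finset Ω) (hs : s.Nonempty) (X : Ω → ℝ) :
    ev (PMF.uniformOfFinset s hs) X = (∑ ω ∈ s, X ω) / s.card := by
  classical
  have := Fintype.ofFinite Ω
  rw [ev_eq_sum, div_eq_inv_mul, Finset.mul_sum, ← Finset.sum_filter_add_sum_filter_not _ (· ∈ s)]
  rw [Finset.sum_eq_zero (s := Finset.univ.filter (· ∉ s)), add_zero]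
  · simp only [Finset.filter_mem_eq_inter, Finset.univ_inter]
    refine Finset.sum_congr rfl fun a ha => ?_
    rw [PMF.uniformOfFinset_apply_of_mem hs ha]; simp
  · intro a ha
    rw [PMF.uniformOfFinset_apply_of_notMem hs (by simpa using ha)]; simp

end Expect

/-! ### Independent samples -/

lemma expect_indep_apply {α : Type} : ∀ {n : ℕ} (p : Fin n → PMF α) (i : Fin n) (g : α → ℝ≥0∞),
    expect (indep p) (fun v => g (v i)) = expect (p i) g
  | 0, _, i, _ => i.elim0
  | n + 1, p, i, g => by
    rw [indep, expect_bind]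
    simp only [expect_map]
    refine Fin.cases ?_ (fun j => ?_) i
    · simp [expect_const]
    · simp [expect_indep_apply (fun i => p i.succ) j g, expect_const]

lemma ev_indep_apply {α : Type} [Finite α] :
    ∀ {n : ℕ} (p : Fin n → PMF α) (i : Fin n) (g : α → ℝ),
    ev (indep p) (fun v => g (v i)) = ev (p i) g
  | 0, _, i, _ => i.elim0
  | n + 1, p, i, g => by
    rw [indep, ev_bind]
    simp only [ev_map]
    refine Fin.cases ?_ (fun j => ?_) i
    · simp [ev_const]
    · simp [ev_indep_apply (fun i => p i.succ) j g, ev_const]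

lemma ev_indep_prod {α : Type} [Finite α] (p : PMF α) (g : α → ℝ) :
    ∀ n : ℕ, ev (indep fun _ : Fin n => p) (fun v => ∏ j, g (v j)) = ev p g ^ n
  | 0 => by simp [indep, ev_pure]
  | n + 1 => by
    rw [indep, ev_bind]
    simp only [ev_map, Fin.prod_univ_succ, Fin.cons_zero, Fin.cons_succ]
    simp only [ev_const_mul, ev_mul_const]
    rw [ev_indep_prod p g n, pow_succ']

lemma mem_support_indep {α : Type} : ∀ {n : ℕ} (p : Fin n → PMF α) (v : Fin n → α),
    v ∈ (indep p).support → ∀ i, v i ∈ (p i).support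
  | 0, _, _, _, i => i.elim0
  | n + 1, p, v, hv, i => by
    rw [indep, PMF.mem_support_bind_iff] at hv
    obtain ⟨x, hx, hv⟩ := hv
    rw [PMF.mem_support_map_iff] at hv
    obtain ⟨w, hw, rfl⟩ := hv
    refine Fin.cases ?_ (fun j => ?_) i
    · simpa using hx
    · simpa using mem_support_indep _ w hw j

/-! ### Execution of composed algorithms -/

namespace Alg

variable {N α β : Type} (f : Finset N → ℝ)

lemma run_bind (A : Alg N α) (g : α → Alg N β) :
    (A.bind g).run f = (A.run f).bind fun z => ((g z.1).run f).map fun w => (w.1, z.2 ++ w.2) := by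
  induction A with
  | ret a =>
    simp only [Alg.bind, run, PMF.pure_bind, List.nil_append]
    exact (PMF.map_id _).symm
  | sample p next ih => simp [Alg.bind, run, ih, PMF.bind_bind]
  | query inst q next ih =>
    simp only [Alg.bind, run, ih]
    rw [PMF.map_bind, PMF.bind_map]
    congr 1; ext1 z
    simp [PMF.map_comp, Function.comp_def]

/-- The batch sizes of two algorithms that run in parallel. -/
def mergeRounds : List ℕ → List ℕ → List ℕ
  | [], l => l
  | a :: l, [] => a :: l
  | a :: l, b :: l' => (a + b) :: mergeRounds l l'

@[simp] lemma mergeRounds_nil_right (l : List ℕ) : mergeRounds l [] = l := by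
  cases l <;> rfl

lemma sum_mergeRounds : ∀ l l' : List ℕ, (mergeRounds l l').sum = l.sum + l'.sum
  | [], l => by simp [mergeRounds]
  | a :: l, [] => by simp
  | a :: l, b :: l' => by simp [mergeRounds, sum_mergeRounds l l']; ring

lemma length_mergeRounds : ∀ l l' : List ℕ, (mergeRounds l l').length = max l.length l'.length
  | [], l => by simp [mergeRounds]
  | a :: l, [] => by simp
  | a :: l, b :: l' => by simp [mergeRounds, length_mergeRounds l l']

lemma mergeRounds_le {B B' : ℕ} : ∀ l l' : List ℕ, (∀ b ∈ l, b ≤ B) → (∀ b ∈ l', b ≤ B') →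
    ∀ b ∈ mergeRounds l l', b ≤ B + B'
  | [], l, _, h' => by intro b hb; have := h' b hb; omega
  | a :: l, [], h, _ => by intro b hb; have := h b hb; omega
  | a :: l, b :: l', h, h' => by
    intro c hc
    rw [mergeRounds, List.mem_cons] at hc
    obtain rfl | hc := hc
    · have := h a (by simp); have := h' b (by simp); omega
    · exact mergeRounds_le l l' (fun x hx => h x (by simp [hx]))
        (fun x hx => h' x (by simp [hx])) c hc

/-- The joint law of two independent executions in parallel. -/
noncomputable def merged (P : PMF (α × List ℕ)) (Q : PMF (β × List ℕ)) :
    PMF ((α × β) × List ℕ) :=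
  P.bind fun z => Q.map fun w => ((z.1, w.1), mergeRounds z.2 w.2)

lemma run_parQuery {ι : Type} (inst : Fintype ι) (q : ι → Finset N) (next : (ι → ℝ) → Alg N α)
    (h : ∀ ans (B : Alg N β), ((next ans).par B).run f = merged ((next ans).run f) (B.run f))
    (B : Alg N β) :
    (parQuery inst q (fun ans B' => (next ans).par B') B).run f =
      merged ((query inst q next).run f) (B.run f) := by
  induction B with
  | ret b =>
    simp only [parQuery, run, h, merged]
    simp [PMF.map_bind, PMF.bind_map, PMF.pure_map, Function.comp_def]
  | sample p next' ih =>
    simp only [parQuery, run, ih, merged, PMF.map_bind]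
    rw [PMF.bind_comm]
  | query inst' q' next' ih =>
    simp only [parQuery, run, h, merged, Sum.elim_inl, Sum.elim_inr]
    simp only [PMF.map_bind, PMF.bind_map, PMF.map_comp, Function.comp_def]
    have hc : @Fintype.card _ (@instFintypeSum _ _ inst inst') =
      @Fintype.card _ inst + @Fintype.card _ inst' := Fintype.card_sum
    simp only [mergeRounds, hc]

lemma run_par (A : Alg N α) (B : Alg N β) :
    (A.par B).run f = merged (A.run f) (B.run f) := by
  induction A generalizing B with
  | ret a =>
    simp only [par, run_bind, run, merged, PMF.pure_bind, PMF.pure_map]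
    simp only [mergeRounds, List.append_nil]
    rw [← PMF.bind_pure_comp]; rfl
  | sample p next ih => simp [par, run, ih, merged]
  | query inst q next ih => exact run_parQuery f inst q next (fun ans B => ih ans B) B

/-- The law of the output. -/
noncomputable def law (A : Alg N α) : PMF α := (A.run f).map Prod.fst

@[simp] lemma law_ret (a : α) : law f (ret a : Alg N α) = PMF.pure a := by
  simp [law, run, PMF.pure_map]

@[simp] lemma law_sample {Ω : Type} (p : PMF Ω) (next : Ω → Alg N α) :
    law f (sample p next) = p.bind fun ω => law f (next ω) := by
  simp [law, run, PMF.map_bind]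

@[simp] lemma law_query {ι : Type} (inst : Fintype ι) (q : ι → Finset N)
    (next : (ι → ℝ) → Alg N α) :
    law f (query inst q next) = law f (next fun i => f (q i)) := by
  simp [law, run, PMF.map_comp, Function.comp_def]

@[simp] lemma law_bind (A : Alg N α) (g : α → Alg N β) :
    law f (A.bind g) = (law f A).bind fun a => law f (g a) := by
  simp [law, run_bind, PMF.map_bind, PMF.bind_map, PMF.map_comp, Function.comp_def]

lemma law_par (A : Alg N α) (B : Alg N β) :
    law f (A.par B) = (law f A).bind fun a => (law f B).map fun b => (a, b) := by
  simp [law, run_par, merged, PMF.map_bind, PMF.bind_map, PMF.map_comp, Function.comp_def]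

lemma mem_support_law {A : Alg N α} {a : α} :
    a ∈ (law f A).support ↔ ∃ l, (a, l) ∈ (A.run f).support := by
  rw [law, PMF.mem_support_map_iff]; simp

lemma law_parAll_cons (A : Alg N α) (As : List (Alg N α)) :
    law f (parAll (A :: As)) =
      (law f A).bind fun a => (law f (parAll As)).map fun L => a :: L := by
  rw [parAll, law_bind, law_par]
  simp [PMF.bind_bind, PMF.bind_map, Function.comp_def]
  congr 1

lemma run_parAll_cons (A : Alg N α) (As : List (Alg N α)) :
    (parAll (A :: As)).run f = (A.run f).bind fun z => ((parAll As).run f).map fun w =>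
      (z.1 :: w.1, mergeRounds z.2 w.2) := by
  rw [parAll, run_bind, run_par, merged]
  simp only [run, PMF.pure_map, List.append_nil, PMF.bind_bind, PMF.bind_map, Function.comp_def]
  rfl

/-- In every execution, the parallel run has as many rounds as its longest branch, and no batch is
larger than the sum of the bounds on the branches. -/
lemma parAll_support {R B : ℕ} : ∀ As : List (Alg N α),
    (∀ A ∈ As, ∀ z ∈ (A.run f).support, z.2.length ≤ R ∧ ∀ b ∈ z.2, b ≤ B) →
    ∀ z ∈ ((parAll As).run f).support, z.2.length ≤ R ∧ ∀ b ∈ z.2, b ≤ As.length * B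
  | [], _ => by intro z hz; simp [parAll, run] at hz; simp [hz]
  | A :: As, h => by
    intro z hz
    rw [run_parAll_cons, PMF.mem_support_bind_iff] at hz
    obtain ⟨x, hx, hz⟩ := hz
    rw [PMF.mem_support_map_iff] at hz
    obtain ⟨w, hw, rfl⟩ := hz
    obtain ⟨h1, h2⟩ := h A (by simp) x hx
    obtain ⟨h3, h4⟩ := parAll_support As (fun A' hA' => h A' (by simp [hA'])) w hw
    refine ⟨by rw [length_mergeRounds]; exact max_le h1 h3, fun b hb => ?_⟩
    have := mergeRounds_le _ _ h2 h4 b hb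
    rw [List.length_cons]; linarith

/-- The outputs of the branches of a parallel run. -/
lemma parAll_outputs {p : α → Prop} : ∀ As : List (Alg N α),
    (∀ A ∈ As, ∀ a ∈ (law f A).support, p a) →
    ∀ L ∈ (law f (parAll As)).support, ∀ a ∈ L, p a
  | [], _ => by intro L hL; simp [parAll] at hL; simp [hL]
  | A :: As, h => by
    intro L hL
    rw [law_parAll_cons, PMF.mem_support_bind_iff] at hL
    obtain ⟨x, hx, hL⟩ := hL
    rw [PMF.mem_support_map_iff] at hL
    obtain ⟨w, hw, rfl⟩ := hL
    intro a ha
    obtain rfl | ha := List.mem_cons.1 ha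
    · exact h _ (by simp) _ hx
    · exact parAll_outputs As (fun A' hA' => h A' (by simp [hA'])) w hw a ha

lemma expect_parAll_sum_le {Q : ℝ≥0∞} : ∀ As : List (Alg N α),
    (∀ A ∈ As, expect (A.run f) (fun z => (z.2.sum : ℝ≥0∞)) ≤ Q) →
    expect ((parAll As).run f) (fun z => (z.2.sum : ℝ≥0∞)) ≤ As.length * Q
  | [], _ => by simp [parAll, run, expect_pure]
  | A :: As, h => by
    have h1 := h A (by simp)
    have h2 := expect_parAll_sum_le As fun A' hA' => h A' (by simp [hA'])
    rw [run_parAll_cons, expect_bind]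
    simp only [expect_map, sum_mergeRounds, Nat.cast_add, expect_add, expect_const,
      List.length_cons, Nat.cast_one, add_mul, one_mul]
    rw [add_comm]
    gcongr

/-- A quantity that is at least `g a` for the output `a` of one branch has at least the expectation
of `g a`. -/
lemma expect_parAll_ge {A : Alg N α} {g : α → ℝ≥0∞} : ∀ (As : List (Alg N α)) (X : List α → ℝ≥0∞),
    A ∈ As → (∀ L ∈ (law f (parAll As)).support, ∀ a ∈ L, g a ≤ X L) →
    expect (law f A) g ≤ expect (law f (parAll As)) X
  | [], _, hA, _ => by simp at hA
  | A' :: As, X, hA, h => by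
    have hmem : ∀ a ∈ (law f A').support, ∀ L ∈ (law f (parAll As)).support,
        a :: L ∈ (law f (parAll (A' :: As))).support := by
      intro a ha L hL
      rw [law_parAll_cons, PMF.mem_support_bind_iff]
      exact ⟨a, ha, (PMF.mem_support_map_iff _ _ _).2 ⟨L, hL, rfl⟩⟩
    rw [law_parAll_cons, expect_bind]
    simp only [expect_map]
    obtain rfl | hA := List.mem_cons.1 hA
    · refine expect_mono_support fun a ha => ?_
      rw [← expect_const (law f (parAll As)) (g a)]
      exact expect_mono_support fun L hL => h _ (hmem a ha L hL) a (by simp)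
    · rw [← expect_const (law f A') (expect (law f A) g)]
      refine expect_mono_support fun a ha => ?_
      exact expect_parAll_ge As (fun L => X (a :: L)) hA
        fun L hL b hb => h _ (hmem a ha L hL) b (by simp [hb])

end Alg

/-! ### Submodular functions -/

section Submodular

variable {N : Type} [DecidableEq N] {f : Finset N → ℝ}

lemma IsSubmodular.sub_le_sub (hf : IsSubmodular f) {W X Z : Finset N} (hWX : W ⊆ X)
    (hZ : Disjoint Z X) : f (X ∪ Z) - f X ≤ f (W ∪ Z) - f W := by
  induction Z using Finset.induction_on with
  | empty => simp
  | insert a Z ha ih =>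
    rw [Finset.disjoint_insert_left] at hZ
    have h1 := ih hZ.2
    have h2 := hf (W ∪ Z) (X ∪ Z) (Finset.union_subset_union_left hWX) a (by simp [ha, hZ.1])
    rw [Finset.union_insert, Finset.union_insert]
    linarith

lemma IsSubmodular.union_add_inter_le (hf : IsSubmodular f) (X Y : Finset N) :
    f (X ∪ Y) + f (X ∩ Y) ≤ f X + f Y := by
  have h := hf.sub_le_sub (W := X ∩ Y) (X := X) (Z := Y \ X) Finset.inter_subset_left
    Finset.sdiff_disjoint
  have h1 : X ∩ Y ∪ Y \ X = Y := by ext; simp; tauto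
  rw [Finset.union_sdiff_self_eq_union, h1] at h
  linarith

lemma IsSubmodular.union_sub_le_sum (hf : IsSubmodular f) (S Y : Finset N) :
    f (S ∪ Y) - f S ≤ ∑ x ∈ Y, (f (insert x S) - f S) := by
  induction Y using Finset.induction_on with
  | empty => simp
  | insert a Z ha ih =>
    rw [Finset.sum_insert ha, Finset.union_insert]
    by_cases haS : a ∈ S
    · rw [Finset.insert_eq_of_mem (by simp [haS]), Finset.insert_eq_of_mem haS]; linarith
    · have := hf S (S ∪ Z) Finset.subset_union_left a (by simp [ha, haS])
      linarith

lemma IsSubmodular.comp_union (hf : IsSubmodular f) (S : Finset N) :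
    IsSubmodular fun Z => f (S ∪ Z) := by
  intro T T' h x hx
  simp only [Finset.union_insert]
  by_cases hxS : x ∈ S
  · rw [Finset.insert_eq_of_mem (by simp [hxS]), Finset.insert_eq_of_mem (by simp [hxS])]; simp
  · exact hf _ _ (Finset.union_subset_union_right h) x (by simp [hxS, hx])

lemma IsSubmodular.comp_sdiff (hf : IsSubmodular f) (U : Finset N) :
    IsSubmodular fun Z => f (U \ Z) := by
  intro T T' h x hx
  have hxT : x ∉ T := fun h' => hx (h h')
  by_cases hxU : x ∈ U
  · have h1 : ∀ Z, x ∉ Z → insert x (U \ insert x Z) = U \ Z := by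
      intro Z hZ; ext y; by_cases hy : y = x <;> simp [hy, hxU, hZ]
    have h2 := hf (U \ insert x T') (U \ insert x T)
      (Finset.sdiff_subset_sdiff le_rfl (Finset.insert_subset_insert x h)) x (by simp)
    rw [h1 _ hx, h1 _ hxT] at h2
    simp only; linarith
  · have h1 : ∀ Z, U \ insert x Z = U \ Z := by
      intro Z; ext y; by_cases hy : y = x <;> simp [hy, hxU]
    simp [h1]

/-- If every element of `A` belongs to the random set `X` with a probability between `q` and `p`,
then `f (X ∩ A)` is in expectation at least `(1 - p) f ∅ + q f A`. The induction removes an element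
of minimal probability from `A`. -/
lemma IsSubmodular.ev_inter_ge {Ω : Type} [Finite Ω] (P : PMF Ω) (X : Ω → Finset N) {p : ℝ}
    (A : Finset N) : ∀ {f : Finset N → ℝ}, IsSubmodular f → (∀ S, 0 ≤ f S) →
    ∀ {q : ℝ}, q ≤ p →
    (∀ x ∈ A, q ≤ ev P (fun ω => if x ∈ X ω then 1 else 0) ∧
      ev P (fun ω => if x ∈ X ω then 1 else 0) ≤ p) →
    (1 - p) * f ∅ + q * f A ≤ ev P fun ω => f (X ω ∩ A) := by
  induction A using Finset.strongInduction with
  | H A ih =>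
    intro f hf h0 q hq hA
    obtain rfl | hne := A.eq_empty_or_nonempty
    · simp only [Finset.inter_empty, ev_const]
      nlinarith [h0 ∅]
    · obtain ⟨x, hx, hmin⟩ := A.exists_min_image
        (fun x => ev P (fun ω => if x ∈ X ω then 1 else 0)) hne
      set px := ev P (fun ω => if x ∈ X ω then (1 : ℝ) else 0) with hpx
      have h1 := ih (A.erase x) (Finset.erase_ssubset hx) hf h0 (q := px) (hA x hx).2
        fun y hy => ⟨hmin y (Finset.mem_of_mem_erase hy), (hA y (Finset.mem_of_mem_erase hy)).2⟩
      have h2 : ∀ ω, f (X ω ∩ A.erase x) + (if x ∈ X ω then 1 else 0) * (f A - f (A.erase x)) ≤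
          f (X ω ∩ A) := by
        intro ω
        by_cases hxω : x ∈ X ω
        · have h3 := hf (X ω ∩ A.erase x) (A.erase x) Finset.inter_subset_right x (by simp)
          rw [Finset.insert_erase hx] at h3
          have h4 : insert x (X ω ∩ A.erase x) = X ω ∩ A := by
            ext y; by_cases hy : y = x <;> simp [hy, hxω, hx]
          rw [h4] at h3
          simp only [hxω, if_true]; linarith
        · have h4 : X ω ∩ A.erase x = X ω ∩ A := by
            ext y; by_cases hy : y = x <;> simp [hy, hxω]
          simp [hxω, h4]
      have h5 := ev_mono (P := P) h2
      rw [ev_add, ev_mul_const] at h5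
      nlinarith [h0 A, (hA x hx).1]

/-- A random set that contains every element with probability at most `p` keeps, in expectation,
the fraction `1 - p` of the value at the empty set. -/
lemma IsSubmodular.ev_ge {Ω : Type} [Finite Ω] [Fintype N] (hf : IsSubmodular f)
    (h0 : ∀ S, 0 ≤ f S) (P : PMF Ω) (X : Ω → Finset N) {p : ℝ} (hp0 : 0 ≤ p)
    (hX : ∀ x, ev P (fun ω => if x ∈ X ω then 1 else 0) ≤ p) :
    (1 - p) * f ∅ ≤ ev P fun ω => f (X ω) := by
  have := hf.ev_inter_ge P X Finset.univ h0 hp0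
    fun x _ => ⟨ev_nonneg fun ω => by split <;> norm_num, hX x⟩
  simpa using this

end Submodular

/-! ### Averages over the subsets of a given size -/

section Averages

variable {N : Type}

/-- The average of `h T` over the subsets `T` of `A` of size `t`. -/
noncomputable def avg (A : Finset N) (t : ℕ) (h : Finset N → ℝ) : ℝ :=
  (∑ T ∈ A.powersetCard t, h T) / (A.card.choose t)

lemma ev_unifSize [Finite N] {A : Finset N} {t : ℕ} (ht : t ≤ A.card) (h : Finset N → ℝ) :
    ev (unifSize A t) h = avg A t h := by
  unfold unifSize
  rw [ev_uniformOfFinset]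
  simp [avg, min_eq_left ht]

lemma mem_support_unifSize {A : Finset N} {t : ℕ} (ht : t ≤ A.card) {T : Finset N} :
    T ∈ (unifSize A t).support ↔ T ⊆ A ∧ T.card = t := by
  unfold unifSize
  rw [PMF.mem_support_uniformOfFinset_iff, Finset.mem_powersetCard, min_eq_left ht]

lemma avg_mono {A : Finset N} {t : ℕ} {h h' : Finset N → ℝ}
    (hh : ∀ T ⊆ A, T.card = t → h T ≤ h' T) : avg A t h ≤ avg A t h' := by
  unfold avg
  gcongr with T hT
  rw [Finset.mem_powersetCard] at hT
  exact hh T hT.1 hT.2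

lemma avg_congr {A : Finset N} {t : ℕ} {h h' : Finset N → ℝ}
    (hh : ∀ T ⊆ A, T.card = t → h T = h' T) : avg A t h = avg A t h' :=
  le_antisymm (avg_mono fun T h1 h2 => (hh T h1 h2).le) (avg_mono fun T h1 h2 => (hh T h1 h2).ge)

lemma avg_add (A : Finset N) (t : ℕ) (h h' : Finset N → ℝ) :
    avg A t (fun T => h T + h' T) = avg A t h + avg A t h' := by
  simp [avg, Finset.sum_add_distrib, add_div]

lemma avg_sub (A : Finset N) (t : ℕ) (h h' : Finset N → ℝ) :
    avg A t (fun T => h T - h' T) = avg A t h - avg A t h' := by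
  simp [avg, Finset.sum_sub_distrib, sub_div]

lemma avg_const_mul (A : Finset N) (t : ℕ) (c : ℝ) (h : Finset N → ℝ) :
    avg A t (fun T => c * h T) = c * avg A t h := by
  simp [avg, ← Finset.mul_sum, mul_div_assoc]

lemma avg_const {A : Finset N} {t : ℕ} (ht : t ≤ A.card) (c : ℝ) : avg A t (fun _ => c) = c := by
  have : (A.card.choose t : ℝ) ≠ 0 := by exact_mod_cast (Nat.choose_pos ht).ne'
  simp [avg]; field_simp

lemma avg_zero (A : Finset N) (h : Finset N → ℝ) : avg A 0 h = h ∅ := by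
  simp [avg]

variable [DecidableEq N]

/-- Removing an element of a set of size `t + 1` and adding an element to a set of size `t` give
the same pairs. -/
lemma sum_erase_eq_sum_sdiff (A : Finset N) (t : ℕ) (ψ : Finset N → N → ℝ) :
    ∑ T ∈ A.powersetCard (t + 1), ∑ x ∈ T, ψ (T.erase x) x =
      ∑ T ∈ A.powersetCard t, ∑ x ∈ A \ T, ψ T x := by
  rw [Finset.sum_sigma', Finset.sum_sigma']
  refine Finset.sum_bij' (fun z _ => ⟨z.1.erase z.2, z.2⟩) (fun z _ => ⟨insert z.2 z.1, z.2⟩)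
    ?_ ?_ ?_ ?_ ?_
  · rintro ⟨T, x⟩ h
    simp only [Finset.mem_sigma, Finset.mem_powersetCard, Finset.mem_sdiff] at h ⊢
    refine ⟨⟨(Finset.erase_subset _ _).trans h.1.1, ?_⟩, h.1.1 h.2, by simp⟩
    rw [Finset.card_erase_of_mem h.2]; omega
  · rintro ⟨T, x⟩ h
    simp only [Finset.mem_sigma, Finset.mem_powersetCard, Finset.mem_sdiff] at h ⊢
    refine ⟨⟨Finset.insert_subset h.2.1 h.1.1, ?_⟩, by simp⟩
    rw [Finset.card_insert_of_notMem h.2.2]; omega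
  · rintro ⟨T, x⟩ h
    simp only [Finset.mem_sigma] at h
    simp [Finset.insert_erase h.2]
  · rintro ⟨T, x⟩ h
    simp only [Finset.mem_sigma, Finset.mem_sdiff] at h
    simp [Finset.erase_insert h.2.2]
  · rintro ⟨T, x⟩ h; rfl

lemma avg_succ_sum_erase {A : Finset N} {t : ℕ} (ht : t < A.card) (ψ : Finset N → N → ℝ) :
    avg A (t + 1) (fun T => ∑ x ∈ T, ψ (T.erase x) x) =
      (t + 1) / (A.card - t) * avg A t (fun T => ∑ x ∈ A \ T, ψ T x) := by
  unfold avg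
  rw [sum_erase_eq_sum_sdiff]
  have h1 : (A.card.choose t : ℝ) ≠ 0 := by exact_mod_cast (Nat.choose_pos ht.le).ne'
  have h2 : (A.card.choose (t + 1) : ℝ) ≠ 0 := by exact_mod_cast (Nat.choose_pos ht).ne'
  have h3 : (A.card.choose (t + 1) : ℝ) * (t + 1) = A.card.choose t * (A.card - t) := by
    have := Nat.choose_succ_right_eq A.card t
    rw [← Nat.cast_sub ht.le]; exact_mod_cast this
  have h4 : (A.card - t : ℝ) ≠ 0 := by
    have : (t : ℝ) < A.card := by exact_mod_cast ht
    linarith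
  field_simp
  linear_combination (-∑ T ∈ A.powersetCard t, ∑ x ∈ A \ T, ψ T x) * h3

lemma avg_mem {A : Finset N} {x : N} (hx : x ∈ A) : ∀ {t : ℕ}, t ≤ A.card →
    avg A t (fun T => if x ∈ T then 1 else 0) = t / A.card
  | 0, _ => by simp [avg_zero]
  | t + 1, ht => by
    have h := avg_succ_sum_erase (Nat.lt_of_succ_le ht) (fun _ y => if y = x then (1 : ℝ) else 0)
    have ih := avg_mem hx (t := t) (by omega)
    have h1 : ∀ T : Finset N, (∑ y ∈ T, if y = x then (1 : ℝ) else 0) = if x ∈ T then 1 else 0 := by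
      intro T; simp
    have h2 : ∀ T : Finset N, (∑ y ∈ A \ T, if y = x then (1 : ℝ) else 0) =
        1 - if x ∈ T then 1 else 0 := by
      intro T; by_cases hT : x ∈ T <;> simp [hT, hx]
    rw [funext h2, funext h1] at h
    rw [h, avg_sub, avg_const (by omega), ih]
    have h4 : (A.card - t : ℝ) ≠ 0 := by
      have : (t : ℝ) < A.card := by exact_mod_cast (Nat.lt_of_succ_le ht)
      linarith
    have h5 : (A.card : ℝ) ≠ 0 := by
      have : A.card ≠ 0 := by omega
      exact_mod_cast this
    push_cast; field_simp

lemma avg_mem_le {A : Finset N} (x : N) {t : ℕ} (ht : t ≤ A.card) :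
    avg A t (fun T => if x ∈ T then 1 else 0) ≤ t / A.card := by
  by_cases hx : x ∈ A
  · exact (avg_mem hx ht).le
  · rw [avg_congr (h' := fun _ => 0) (fun T hT _ => by rw [if_neg fun h => hx (hT h)]),
      avg_const ht]
    positivity

variable {f : Finset N → ℝ}

/-- Adding a random element to a random set of size `t` loses at most the fraction
`1 / (|A| - t)` of the value. -/
lemma IsSubmodular.avg_succ_ge (hf : IsSubmodular f) (h0 : ∀ S, 0 ≤ f S) {A : Finset N} {t : ℕ}
    (ht : t < A.card) :
    (A.card - (t + 1 : ℕ)) / (A.card - t) * avg A t f ≤ avg A (t + 1) f := by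
  have h4 : (0 : ℝ) < A.card - t := by
    have : (t : ℝ) < A.card := by exact_mod_cast ht
    linarith
  have h := avg_succ_sum_erase ht (fun T x => f (insert x T))
  rw [avg_congr (h' := fun T => (t + 1) * f T)] at h
  · rw [avg_const_mul] at h
    have h5 : avg A t (fun T => (A.card - (t + 1 : ℕ)) * f T) ≤
        avg A t (fun T => ∑ x ∈ A \ T, f (insert x T)) := by
      refine avg_mono fun T hT hc => ?_
      have h6 := hf.union_sub_le_sum T (A \ T)
      rw [Finset.sum_sub_distrib, Finset.sum_const, Finset.card_sdiff_of_subset hT, hc,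
        nsmul_eq_mul, Nat.cast_sub ht.le] at h6
      push_cast
      have := h0 (T ∪ A \ T)
      linarith
    rw [avg_const_mul] at h5
    have h7 : avg A (t + 1) f = 1 / (A.card - t) *
        avg A t (fun T => ∑ x ∈ A \ T, f (insert x T)) := by
      have : (t + 1 : ℝ) ≠ 0 := by positivity
      field_simp at h ⊢
      linarith
    rw [h7, div_mul_eq_mul_div, one_div_mul_eq_div]
    gcongr
  · intro T hT hc
    rw [Finset.sum_congr rfl fun x hx => by rw [Finset.insert_erase hx], Finset.sum_const, hc]
    simp

lemma IsSubmodular.avg_ge_of_le (hf : IsSubmodular f) (h0 : ∀ S, 0 ≤ f S) {A : Finset N} {s t : ℕ}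
    (hst : s ≤ t) (ht : t ≤ A.card) (hs : s < A.card) :
    (A.card - t) / (A.card - s) * avg A s f ≤ avg A t f := by
  induction t, hst using Nat.le_induction with
  | base =>
    have : (A.card - s : ℝ) ≠ 0 := by
      have : (s : ℝ) < A.card := by exact_mod_cast hs
      linarith
    rw [div_self this, one_mul]
  | succ t hst ih =>
    refine le_trans ?_ (hf.avg_succ_ge h0 (Nat.lt_of_succ_le ht))
    have h1 := ih (by omega)
    have h2 : (0 : ℝ) < A.card - t := by
      have : (t : ℝ) < A.card := by exact_mod_cast (Nat.lt_of_succ_le ht)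
      linarith
    have h3 : (0 : ℝ) < A.card - s := by
      have : (s : ℝ) < A.card := by exact_mod_cast hs
      linarith
    have h4 : (0 : ℝ) ≤ A.card - (t + 1 : ℕ) := by
      have : ((t + 1 : ℕ) : ℝ) ≤ A.card := by exact_mod_cast ht
      linarith
    calc _ = (A.card - (t + 1 : ℕ)) / (A.card - t) * ((A.card - t) / (A.card - s) * avg A s f) := by
          field_simp
      _ ≤ _ := by gcongr

end Averages

/-! ### One batch of the threshold loop -/

section Batch

variable {N : Type} [DecidableEq N] {f : Finset N → ℝ} {S A : Finset N} {τ : ℝ}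

/-- If removing any single element of `Z` from `W ∪ Z` loses at least `τ`, then adding `Z` to `W`
gains at least `τ` per element. -/
lemma IsSubmodular.add_card_mul_le (hf : IsSubmodular f) {W Z : Finset N} (hWZ : Disjoint W Z)
    (h : ∀ a ∈ Z, τ ≤ f (W ∪ Z) - f ((W ∪ Z).erase a)) :
    f W + τ * Z.card ≤ f (W ∪ Z) := by
  have key : ∀ Y ⊆ Z, f W + τ * Y.card ≤ f (W ∪ Y) := by
    intro Y hY
    induction Y using Finset.induction_on with
    | empty => simp
    | insert a Y ha ih =>
      have haZ : a ∈ Z := hY (Finset.mem_insert_self _ _)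
      have h1 := ih ((Finset.subset_insert _ _).trans hY)
      have h2 := hf (W ∪ Y) ((W ∪ Z).erase a) (fun x hx => by
        rw [Finset.mem_union] at hx
        rw [Finset.mem_erase]
        constructor
        · rintro rfl
          rcases hx with hx | hx
          · exact Finset.disjoint_left.1 hWZ hx haZ
          · exact ha hx
        · rcases hx with hx | hx
          · simp [hx]
          · simp [hY (Finset.mem_insert_of_mem hx)]) a (by simp)
      rw [Finset.insert_erase (by simp [haZ])] at h2
      have h3 := h a haZ
      rw [Finset.card_insert_of_notMem ha, Finset.union_insert]
      push_cast; linarith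
  exact key Z le_rfl

variable [Finite N]

/-- The expectation of the indicator that the loop estimates for batch size `t`. -/
noncomputable def goodProb (f : Finset N → ℝ) (τ : ℝ) (S A : Finset N) (t : ℕ) : ℝ :=
  ev (indicatorQueries S A t) fun q => if τ ≤ f q.2 - f q.1 then 1 else 0

lemma goodProb_nonneg (t : ℕ) : 0 ≤ goodProb f τ S A t :=
  ev_nonneg fun _ => by split <;> norm_num

lemma goodProb_succ {t : ℕ} (ht : t < A.card) : goodProb f τ S A (t + 1) =
    avg A t (fun T => ∑ x ∈ A \ T, if τ ≤ f (insert x (S ∪ T)) - f (S ∪ T) then 1 else 0) /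
      (A.card - t) := by
  unfold goodProb indicatorQueries
  rw [ev_bind, Nat.add_sub_cancel, ev_unifSize ht.le, div_eq_inv_mul, ← avg_const_mul]
  refine avg_congr fun T hT hc => ?_
  have hcard : (A \ T).card = A.card - t := by rw [Finset.card_sdiff_of_subset hT, hc]
  have hne : (A \ T).Nonempty := by rw [← Finset.card_pos, hcard]; omega
  rw [dif_pos hne, ev_map, ev_uniformOfFinset, hcard, Nat.cast_sub ht.le, div_eq_inv_mul]

/-- If all elements of `A` have marginal value at least `τ`, then so has the first element of a
batch. -/
lemma goodProb_one (hA : A.Nonempty) (h : ∀ x ∈ A, τ ≤ f (insert x S) - f S) :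
    goodProb f τ S A 1 = 1 := by
  have hc : 0 < A.card := hA.card_pos
  have := goodProb_succ (f := f) (τ := τ) (S := S) hc
  rw [zero_add] at this
  rw [this, avg_zero]
  simp only [Finset.sdiff_empty, Finset.union_empty]
  rw [Finset.sum_congr rfl fun x hx => if_pos (h x hx)]
  simp [hc.ne']

/-- The later an element is added, the smaller is its marginal value. -/
lemma goodProb_succ_le (hf : IsSubmodular f) (hSA : Disjoint S A) {t : ℕ} (ht : t + 1 < A.card) :
    goodProb f τ S A (t + 1 + 1) ≤ goodProb f τ S A (t + 1) := by
  rw [goodProb_succ ht, goodProb_succ (Nat.lt_of_succ_lt ht)]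
  set ψ : Finset N → N → ℝ := fun T x =>
    if τ ≤ f (insert x (S ∪ T)) - f (S ∪ T) then 1 else 0 with hψ
  have hanti : ∀ T, ∀ y, ∀ x ∈ A, x ∉ T → ψ T x ≤ ψ (T.erase y) x := by
    intro T y x hx hxT
    have h1 := hf (S ∪ T.erase y) (S ∪ T)
      (Finset.union_subset_union_right (Finset.erase_subset _ _)) x
      (by simp [hxT, Finset.disjoint_right.1 hSA hx])
    simp only [hψ]
    split_ifs <;> linarith
  have h1 : avg A (t + 1) (fun T => (t + 1 : ℝ) * ∑ x ∈ A \ T, ψ T x) ≤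
      avg A (t + 1) (fun T => ∑ y ∈ T, ∑ x ∈ A \ insert y (T.erase y), ψ (T.erase y) x) := by
    refine avg_mono fun T hT hc => ?_
    have : (t + 1 : ℝ) * ∑ x ∈ A \ T, ψ T x = ∑ y ∈ T, ∑ x ∈ A \ T, ψ T x := by
      rw [Finset.sum_const, hc]; simp
    rw [this]
    refine Finset.sum_le_sum fun y hy => ?_
    rw [Finset.insert_erase hy]
    refine Finset.sum_le_sum fun x hx => ?_
    rw [Finset.mem_sdiff] at hx
    exact hanti T y x hx.1 hx.2
  rw [avg_succ_sum_erase (Nat.lt_of_succ_lt ht) (fun T y => ∑ x ∈ A \ insert y T, ψ T x),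
    avg_const_mul] at h1
  have h2 : avg A t (fun T => ∑ y ∈ A \ T, ∑ x ∈ A \ insert y T, ψ T x) =
      avg A t (fun T => (A.card - (t + 1 : ℕ)) * ∑ x ∈ A \ T, ψ T x) := by
    refine avg_congr fun T hT hc => ?_
    have h3 : ∀ y ∈ A \ T, ∑ x ∈ A \ insert y T, ψ T x = ∑ x ∈ A \ T, ψ T x - ψ T y := by
      intro y hy
      rw [eq_sub_iff_add_eq, ← Finset.sum_erase_add _ _ hy]
      congr 2
      ext x; simp; tauto
    rw [Finset.sum_congr rfl h3, Finset.sum_sub_distrib, Finset.sum_const,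
      Finset.card_sdiff_of_subset hT, hc, nsmul_eq_mul, Nat.cast_sub (by omega)]
    push_cast; ring
  rw [h2, avg_const_mul] at h1
  have h4 : (0 : ℝ) < A.card - (t + 1 : ℕ) := by
    have : ((t + 1 : ℕ) : ℝ) < A.card := by exact_mod_cast ht
    linarith
  have h5 : (0 : ℝ) < A.card - t := by push_cast at h4; linarith
  rw [div_le_div_iff₀ h4 h5]
  have h6 : (0 : ℝ) < t + 1 := by positivity
  rw [div_mul_eq_mul_div, le_div_iff₀ h5] at h1
  exact le_of_mul_le_mul_left (by linarith) h6

lemma goodProb_anti (hf : IsSubmodular f) (hSA : Disjoint S A) {s t : ℕ} (hs : 1 ≤ s) (hst : s ≤ t)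
    (ht : t ≤ A.card) : goodProb f τ S A t ≤ goodProb f τ S A s := by
  induction t, hst using Nat.le_induction with
  | base => rfl
  | succ t hst ih =>
    obtain ⟨u, rfl⟩ : ∃ u, t = u + 1 := ⟨t - 1, by omega⟩
    exact (goodProb_succ_le hf hSA (by omega)).trans (ih (by omega))

/-- The gain of a batch of size `t`. The elements of the batch `T` whose marginal value with respect
to all the rest of `T` is at least `τ` contribute `τ` each even if they are added after all the
others, and the others are a random set that contains each element of `A` with probability at most
`t / |A|`. -/
lemma IsSubmodular.avg_union_ge (hf : IsSubmodular f) (h0 : ∀ S, 0 ≤ f S) (hSA : Disjoint S A)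
    {t : ℕ} (ht1 : 1 ≤ t) (ht : t ≤ A.card) :
    (1 - t / A.card) * f S + τ * t * goodProb f τ S A t ≤ avg A t fun T => f (S ∪ T) := by
  obtain ⟨s, rfl⟩ : ∃ s, t = s + 1 := ⟨t - 1, by omega⟩
  have := Fintype.ofFinite N
  set ψ : Finset N → N → ℝ := fun T x =>
    if τ ≤ f (insert x (S ∪ T)) - f (S ∪ T) then 1 else 0 with hψ
  -- the elements of the batch that gain at least `τ` when added last
  let good : Finset N → Finset N := fun T => T.filter fun x =>
    τ ≤ f (insert x (S ∪ T.erase x)) - f (S ∪ T.erase x)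
  have h1 : avg A (s + 1) (fun T => f (S ∪ (T \ good T)) + τ * ∑ x ∈ T, ψ (T.erase x) x) ≤
      avg A (s + 1) fun T => f (S ∪ T) := by
    refine avg_mono fun T hT hc => ?_
    have hST : Disjoint S T := Finset.disjoint_of_subset_right hT hSA
    have hgT : good T ⊆ T := Finset.filter_subset _ _
    have hun : S ∪ (T \ good T) ∪ good T = S ∪ T := by
      rw [Finset.union_assoc, Finset.sdiff_union_of_subset hgT]
    have h2 := hf.add_card_mul_le (τ := τ) (W := S ∪ (T \ good T)) (Z := good T)
      (by
        rw [Finset.disjoint_union_left]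
        exact ⟨Finset.disjoint_of_subset_right hgT hST, Finset.sdiff_disjoint⟩)
      (fun a ha => by
        have ha' := (Finset.mem_filter.1 ha)
        have haS : a ∉ S := Finset.disjoint_right.1 hST ha'.1
        rw [hun]
        have h3 : (S ∪ T).erase a = S ∪ T.erase a := by
          rw [Finset.erase_union_distrib, Finset.erase_eq_of_notMem haS]
        have h4 : insert a (S ∪ T.erase a) = S ∪ T := by
          rw [← Finset.union_insert, Finset.insert_erase ha'.1]
        rw [h3, ← h4]
        exact ha'.2)
    rw [hun] at h2
    have h3 : ((good T).card : ℝ) = ∑ x ∈ T, ψ (T.erase x) x := by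
      simp only [good, hψ, Finset.card_filter]; push_cast; rfl
    rw [← h3]; exact h2
  rw [avg_add, avg_const_mul, avg_succ_sum_erase (by omega)] at h1
  rw [goodProb_succ (by omega)]
  have h5 : (1 - (s + 1 : ℕ) / A.card) * f S ≤ avg A (s + 1) fun T => f (S ∪ (T \ good T)) := by
    have := (hf.comp_union S).ev_ge (fun _ => h0 _) (unifSize A (s + 1)) (fun T => T \ good T)
      (p := (s + 1 : ℕ) / A.card) (by positivity) (fun x => by
        rw [ev_unifSize ht]
        refine le_trans (avg_mono fun T _ _ => ?_) (avg_mem_le x ht)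
        by_cases hx : x ∈ T
        · rw [if_pos hx]; split <;> norm_num
        · simp [hx])
    rwa [Finset.union_empty, ev_unifSize ht] at this
  have h6 : (A.card - s : ℝ) ≠ 0 := by
    have : ((s + 1 : ℕ) : ℝ) ≤ A.card := by exact_mod_cast ht
    push_cast at this; linarith
  refine le_trans (add_le_add h5 (le_of_eq ?_)) h1
  push_cast; field_simp; rfl

/-- The gain of a batch of size `t` in terms of the indicators for a smaller size `s ≥ t / 2`. -/
lemma IsSubmodular.avg_union_ge_of_le (hf : IsSubmodular f) (h0 : ∀ S, 0 ≤ f S)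
    (hSA : Disjoint S A) (hτ : 0 ≤ τ) {s t k : ℕ} (hs : 1 ≤ s) (hst : s ≤ t) (hts : t ≤ 2 * s)
    (htk : t ≤ k) (hA : 3 * k ≤ A.card) :
    (1 - t / A.card) * f S + 4 / 5 * τ * s * goodProb f τ S A s ≤ avg A t fun T => f (S ∪ T) := by
  have h1 := hf.avg_union_ge (τ := τ) h0 hSA hs (by omega)
  have h2 := (hf.comp_union S).avg_ge_of_le (fun _ => h0 _) hst (A := A) (by omega) (by omega)
  refine le_trans ?_ h2
  have ha : (0 : ℝ) < A.card := by exact_mod_cast (by omega : 0 < A.card)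
  have hst' : (s : ℝ) ≤ t := by exact_mod_cast hst
  have hts' : (t : ℝ) ≤ 2 * s := by exact_mod_cast hts
  have h3t : (3 : ℝ) * t ≤ A.card := by exact_mod_cast (by omega : 3 * t ≤ A.card)
  have ht0 : (0 : ℝ) ≤ t := by positivity
  have h3 : (0 : ℝ) < A.card - s := by
    have : (s : ℝ) < A.card := by exact_mod_cast (by omega : s < A.card)
    linarith
  -- the ratio is smallest for `|A| = 3 t` and `s = t / 2`
  have h4 : (4 / 5 : ℝ) ≤ (A.card - t) / (A.card - s) := by
    rw [le_div_iff₀ h3]; linarith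
  have h5 : 0 ≤ τ * s * goodProb f τ S A s :=
    mul_nonneg (by positivity) (goodProb_nonneg s)
  calc _ ≤ (A.card - t) / (A.card - s) * ((1 - s / A.card) * f S) +
        (A.card - t) / (A.card - s) * (τ * s * goodProb f τ S A s) := by
        refine add_le_add (le_of_eq ?_) ?_
        · field_simp
        · calc _ = 4 / 5 * (τ * s * goodProb f τ S A s) := by ring
            _ ≤ _ := by gcongr
    _ ≤ _ := by
        rw [← mul_add]
        refine mul_le_mul_of_nonneg_left h1 (by linarith)

/-- The expected number of candidates that survive a batch of size `t`. -/
lemma avg_card_filter_le (hf : IsSubmodular f) (hSA : Disjoint S A) (hτ : 0 < τ) {t : ℕ}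
    (ht1 : 1 ≤ t) (ht : t < A.card) :
    avg A t (fun T => ((A.filter fun x => τ ≤ f (insert x (S ∪ T)) - f (S ∪ T)).card : ℝ)) ≤
      goodProb f τ S A t * A.card := by
  have h5 : (0 : ℝ) < A.card - t := by
    have : (t : ℝ) < A.card := by exact_mod_cast ht
    linarith
  have h1 : avg A t (fun T => ((A.filter fun x => τ ≤ f (insert x (S ∪ T)) - f (S ∪ T)).card : ℝ)) =
      (A.card - t) * goodProb f τ S A (t + 1) := by
    rw [goodProb_succ ht, mul_div_cancel₀ _ h5.ne']
    refine avg_congr fun T hT _ => ?_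
    rw [Finset.card_filter]; push_cast
    refine (Finset.sum_subset Finset.sdiff_subset fun x hx hx' => if_neg ?_).symm
    have : x ∈ T := by simpa [hx] using hx'
    rw [Finset.insert_eq_of_mem (by simp [this])]; linarith
  rw [h1]
  have h2 := goodProb_anti (τ := τ) hf hSA ht1 (Nat.le_succ t) ht
  have h3 := goodProb_nonneg (f := f) (τ := τ) (S := S) (A := A) t
  have h4 : (0 : ℝ) ≤ t := by positivity
  calc _ ≤ (A.card - t) * goodProb f τ S A t := by gcongr
    _ ≤ _ := by nlinarith

end Batch

/-! ### Unconstrained maximization and subsampling -/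

section Unconstrained

variable {N : Type} [DecidableEq N] [Finite N] {f : Finset N → ℝ}

/-- A uniformly random subset `R` of `A` has at least a quarter of the value of any `W ⊆ A`.
Pairing `R` with its symmetric differences with `A \ W` and with `W` reduces this to
submodularity. -/
lemma IsSubmodular.ev_unifSubset_ge (hf : IsSubmodular f) (h0 : ∀ S, 0 ≤ f S) {W A : Finset N}
    (hW : W ⊆ A) : 1 / 4 * f W ≤ ev (unifSubset A) f := by
  change _ ≤ ev (PMF.uniformOfFinset A.powerset (Finset.powerset_nonempty A)) f
  rw [ev_uniformOfFinset]
  have hinv : ∀ B ⊆ A, ∀ g : Finset N → ℝ,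
      ∑ R ∈ A.powerset, g (symmDiff R B) = ∑ R ∈ A.powerset, g R := by
    intro B hB g
    refine Finset.sum_nbij' (fun R => symmDiff R B) (fun R => symmDiff R B) ?_ ?_ ?_ ?_ ?_
    · intro R hR
      rw [Finset.mem_powerset] at hR ⊢
      intro x hx; rw [Finset.mem_symmDiff] at hx
      rcases hx with hx | hx
      · exact hR hx.1
      · exact hB hx.1
    · intro R hR
      rw [Finset.mem_powerset] at hR ⊢
      intro x hx; rw [Finset.mem_symmDiff] at hx
      rcases hx with hx | hx
      · exact hR hx.1
      · exact hB hx.1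
    · intro R _; simp
    · intro R _; simp
    · intro R _; rfl
  have h1 : ∑ R ∈ A.powerset, f (R ∩ W) ≤ 2 * ∑ R ∈ A.powerset, f R := by
    rw [two_mul]
    nth_rewrite 2 [← hinv (A \ W) Finset.sdiff_subset f]
    rw [← Finset.sum_add_distrib]
    refine Finset.sum_le_sum fun R hR => ?_
    rw [Finset.mem_powerset] at hR
    have h2 := hf.union_add_inter_le R (symmDiff R (A \ W))
    have h3 : R ∩ symmDiff R (A \ W) = R ∩ W := by
      ext x
      have := @hR x
      simp only [Finset.mem_inter, Finset.mem_symmDiff, Finset.mem_sdiff]; tauto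
    rw [h3] at h2
    linarith [h0 (R ∪ symmDiff R (A \ W))]
  have h2 : ∑ R ∈ A.powerset, f W ≤ 2 * ∑ R ∈ A.powerset, f (R ∩ W) := by
    rw [two_mul]
    nth_rewrite 2 [← hinv W hW fun R => f (R ∩ W)]
    rw [← Finset.sum_add_distrib]
    refine Finset.sum_le_sum fun R hR => ?_
    have h2 := hf.union_add_inter_le (R ∩ W) (symmDiff R W ∩ W)
    have h3 : R ∩ W ∪ symmDiff R W ∩ W = W := by
      ext x
      simp only [Finset.mem_inter, Finset.mem_symmDiff, Finset.mem_union]; tauto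
    rw [h3] at h2
    linarith [h0 (R ∩ W ∩ (symmDiff R W ∩ W))]
  rw [Finset.sum_const, nsmul_eq_mul] at h2
  have hc : (0 : ℝ) < A.powerset.card := by
    exact_mod_cast Finset.card_pos.2 ⟨∅, Finset.empty_mem_powerset A⟩
  rw [le_div_iff₀ hc]
  linarith

/-- A uniformly random subset of `U` of size `k` keeps the fraction `k / |U|` of the value. -/
lemma IsSubmodular.ev_unifSize_ge (hf : IsSubmodular f) (h0 : ∀ S, 0 ≤ f S) {U : Finset N} {k : ℕ}
    (hk : k ≤ U.card) (hU : 0 < U.card) : k / U.card * f U ≤ ev (unifSize U k) f := by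
  have := Fintype.ofFinite N
  have hc : (0 : ℝ) < U.card := by exact_mod_cast hU
  have hk' : (k : ℝ) ≤ U.card := by exact_mod_cast hk
  have h1 := (hf.comp_sdiff U).ev_ge (fun _ => h0 _) (unifSize U k) (fun T => U \ T)
    (p := 1 - k / U.card) (by rw [sub_nonneg, div_le_one hc]; exact hk') (fun x => by
      rw [ev_unifSize hk]
      by_cases hx : x ∈ U
      · have h2 : avg U k (fun T => 1 - if x ∈ T then (1 : ℝ) else 0) = 1 - k / U.card := by
          rw [avg_sub, avg_const hk, avg_mem hx hk]
        rw [← h2]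
        refine avg_mono fun T _ _ => ?_
        by_cases hT : x ∈ T <;> simp [hT, hx]
      · rw [avg_congr (h' := fun _ => 0) (fun T _ _ => by simp [hx]), avg_const hk, sub_nonneg,
          div_le_one hc]; exact hk')
  rw [sub_sub_cancel, Finset.sdiff_empty] at h1
  refine h1.trans (ev_mono_support fun T hT => ?_)
  rw [mem_support_unifSize hk] at hT
  rw [Finset.sdiff_sdiff_eq_self hT.1]

end Unconstrained

/-! ### Concentration of the estimates -/

section Chernoff

variable {α : Type} [Finite α]

/-- The moment generating function of the number of failures among `l` independent samples, where
`X` is the indicator of success. -/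
lemma ev_indep_exp_le (P : PMF α) {X : α → ℝ} (hX : ∀ a, X a = 0 ∨ X a = 1) (s : ℝ) (l : ℕ) :
    ev (indep fun _ : Fin l => P) (fun v => Real.exp (s * ∑ j, (1 - X (v j)))) ≤
      Real.exp ((Real.exp s - 1) * (1 - ev P X) * l) := by
  have h1 : ∀ v : Fin l → α, Real.exp (s * ∑ j, (1 - X (v j))) =
      ∏ j, Real.exp (s * (1 - X (v j))) := by
    intro v; rw [Finset.mul_sum, Real.exp_sum]
  simp only [h1]
  rw [ev_indep_prod P fun a => Real.exp (s * (1 - X a))]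
  have h2 : ∀ a, Real.exp (s * (1 - X a)) = Real.exp s + (1 - Real.exp s) * X a := by
    intro a; rcases hX a with h | h <;> simp [h]
  simp only [h2]
  rw [ev_add, ev_const, ev_const_mul, mul_comm _ (l : ℝ), Real.exp_nat_mul]
  have h3 : 0 ≤ ev P X := ev_nonneg fun a => by rcases hX a with h | h <;> simp [h]
  have h4 : ev P X ≤ 1 := by
    rw [← ev_const P 1]
    exact ev_mono fun a => by rcases hX a with h | h <;> simp [h]
  refine pow_le_pow_left₀ ?_ ?_ l
  · nlinarith [Real.exp_pos s]
  · have := Real.add_one_le_exp ((Real.exp s - 1) * (1 - ev P X))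
    linarith

/-- If the success probability is at most `1 - 2 ε`, then the success rate of `l` samples rarely
exceeds `1 - 1.5 ε`. -/
lemma ev_rate_gt_le (P : PMF α) {X : α → ℝ} (hX : ∀ a, X a = 0 ∨ X a = 1) {ε : ℝ} (hε : 0 < ε)
    {l : ℕ} (hl : 0 < l) (hP : ev P X ≤ 1 - 2 * ε) :
    ev (indep fun _ : Fin l => P) (fun v => if 1 - 1.5 * ε < (∑ j, X (v j)) / l then 1 else 0) ≤
      Real.exp (-(ε * l / 25)) := by
  have hl' : (0 : ℝ) < l := by exact_mod_cast hl
  have h1 : ∀ v : Fin l → α, (if 1 - 1.5 * ε < (∑ j, X (v j)) / l then (1 : ℝ) else 0) ≤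
      Real.exp (1.5 * ε * l / 4) * Real.exp (-(1 / 4) * ∑ j, (1 - X (v j))) := by
    -- Markov's inequality for the exponential with parameter `-1 / 4`
    intro v
    split_ifs with h
    · rw [← Real.exp_add]
      refine Real.one_le_exp ?_
      rw [lt_div_iff₀ hl'] at h
      rw [Finset.sum_sub_distrib]
      simp only [Finset.sum_const, Finset.card_univ, Fintype.card_fin, nsmul_eq_mul, mul_one]
      linarith
    · positivity
  refine (ev_mono h1).trans ?_
  rw [ev_const_mul]
  refine (mul_le_mul_of_nonneg_left (ev_indep_exp_le P hX _ l) (Real.exp_pos _).le).trans ?_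
  rw [← Real.exp_add, Real.exp_le_exp]
  have h2 : Real.exp (-(1 / 4)) ≤ 32 / 41 := by
    have := Real.quadratic_le_exp_of_nonneg (x := 1 / 4) (by norm_num)
    rw [Real.exp_neg, inv_le_comm₀ (Real.exp_pos _) (by norm_num)]
    refine le_trans ?_ this; norm_num
  have h3 : (Real.exp (-(1 / 4)) - 1) * (1 - ev P X) ≤ (32 / 41 - 1) * (2 * ε) := by nlinarith
  have h4 : (Real.exp (-(1 / 4)) - 1) * (1 - ev P X) * l ≤ (32 / 41 - 1) * (2 * ε) * l := by gcongr
  have h5 : 0 < ε * l := by positivity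
  nlinarith

/-- If the success probability is at least `1 - ε`, then the success rate of `l` samples is rarely
as low as `1 - 1.5 ε`. -/
lemma ev_rate_le_le (P : PMF α) {X : α → ℝ} (hX : ∀ a, X a = 0 ∨ X a = 1) {ε : ℝ} (hε : 0 < ε)
    {l : ℕ} (hl : 0 < l) (hP : 1 - ε ≤ ev P X) :
    ev (indep fun _ : Fin l => P) (fun v => if (∑ j, X (v j)) / l ≤ 1 - 1.5 * ε then 1 else 0) ≤
      Real.exp (-(ε * l / 25)) := by
  have hl' : (0 : ℝ) < l := by exact_mod_cast hl
  have h1 : ∀ v : Fin l → α, (if (∑ j, X (v j)) / l ≤ 1 - 1.5 * ε then (1 : ℝ) else 0) ≤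
      Real.exp (-(1.5 * ε * l / 4)) * Real.exp (1 / 4 * ∑ j, (1 - X (v j))) := by
    -- Markov's inequality for the exponential with parameter `1 / 4`
    intro v
    split_ifs with h
    · rw [← Real.exp_add]
      refine Real.one_le_exp ?_
      rw [div_le_iff₀ hl'] at h
      rw [Finset.sum_sub_distrib]
      simp only [Finset.sum_const, Finset.card_univ, Fintype.card_fin, nsmul_eq_mul, mul_one]
      linarith
    · positivity
  refine (ev_mono h1).trans ?_
  rw [ev_const_mul]
  refine (mul_le_mul_of_nonneg_left (ev_indep_exp_le P hX _ l) (Real.exp_pos _).le).trans ?_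
  rw [← Real.exp_add, Real.exp_le_exp]
  have h2 : Real.exp (1 / 4) ≤ 4 / 3 := by
    have := Real.add_one_le_exp (-(1 / 4 : ℝ))
    rw [Real.exp_neg, le_inv_comm₀ (by norm_num) (Real.exp_pos _)] at this
    refine this.trans ?_; norm_num
  have h2' : 1 ≤ Real.exp (1 / 4) := Real.one_le_exp (by norm_num)
  have h3 : (Real.exp (1 / 4) - 1) * (1 - ev P X) ≤ (4 / 3 - 1) * ε := by nlinarith
  have h4 : (Real.exp (1 / 4) - 1) * (1 - ev P X) * l ≤ (4 / 3 - 1) * ε * l := by gcongr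
  have h5 : 0 < ε * l := by positivity
  nlinarith

end Chernoff

/-! ### One iteration of the threshold loop -/

section Loop

variable {N : Type}

/-- The indicator of a marginal value of at least `τ`. -/
noncomputable def isGood (f : Finset N → ℝ) (τ : ℝ) (q : Finset N × Finset N) : ℝ :=
  if τ ≤ f q.2 - f q.1 then 1 else 0

/-- The index of the batch size that the loop chooses when it sees the samples `X`. -/
noncomputable def pickIndex (f : Finset N → ℝ) (τ ε : ℝ) {m l : ℕ}
    (X : Fin (m + 1) → Fin l → Finset N × Finset N) : Fin (m + 1) :=
  ((List.finRange (m + 1)).find? fun i =>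
    decide ((∑ j : Fin l, isGood f τ (X i j)) / l ≤ 1 - 1.5 * ε)).getD (Fin.last m)

lemma pickIndex_spec (f : Finset N → ℝ) (τ ε : ℝ) {m l : ℕ}
    (X : Fin (m + 1) → Fin l → Finset N × Finset N) :
    (∀ j < pickIndex f τ ε X, 1 - 1.5 * ε < (∑ i, isGood f τ (X j i)) / l) ∧
    ((∑ i, isGood f τ (X (pickIndex f τ ε X) i)) / l ≤ 1 - 1.5 * ε ∨
      pickIndex f τ ε X = Fin.last m) := by
  unfold pickIndex
  rcases h : (List.finRange (m + 1)).find? fun i =>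
    decide ((∑ j : Fin l, isGood f τ (X i j)) / l ≤ 1 - 1.5 * ε) with _ | i
  · rw [List.find?_eq_none] at h
    refine ⟨fun j _ => ?_, Or.inr rfl⟩
    simpa using h j (List.mem_finRange j)
  · rw [List.find?_eq_some_iff_append] at h
    obtain ⟨h1, as, bs, h2, h3⟩ := h
    refine ⟨fun j hj => ?_, Or.inl (by simpa using h1)⟩
    have hs := List.pairwise_lt_finRange (m + 1)
    have hj' := List.mem_finRange j
    rw [h2] at hs hj'
    rw [List.pairwise_append, List.pairwise_cons] at hs
    simp only [Option.getD_some] at hj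
    rw [List.mem_append, List.mem_cons] at hj'
    rcases hj' with hj' | rfl | hj'
    · simpa using h3 j hj'
    · exact absurd hj (lt_irrefl _)
    · exact absurd hj (hs.2.1.1 j hj').not_gt

variable [DecidableEq N]

/-- The elements of `A` with marginal value at least `τ` with respect to `S`. -/
noncomputable def candidates (f : Finset N → ℝ) (τ : ℝ) (S A : Finset N) : Finset N :=
  A.filter fun x => τ ≤ f (insert x S) - f S

/-- The `i`-th batch size that the loop tries. -/
noncomputable def batchSize (ε : ℝ) (A : Finset N) (i : ℕ) : ℕ := min ⌊(1 + ε) ^ i⌋₊ A.card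

/-- The samples of one iteration. -/
noncomputable def samples (ε : ℝ) (m l : ℕ) (S A : Finset N) :
    PMF (Fin (m + 1) → Fin l → Finset N × Finset N) :=
  indep fun i => indep fun _ => indicatorQueries S A (batchSize ε A i)

/-- The law of the batch of one iteration. -/
noncomputable def batchLaw (f : Finset N → ℝ) (k : ℕ) (τ ε : ℝ) (m l : ℕ) (S A : Finset N) :
    PMF (Finset N) :=
  ((samples ε m l S A).map (pickIndex f τ ε)).bind fun i =>
    unifSize A (min (batchSize ε A i) (k - S.card))

/-- One iteration takes one round if it stops at the filter, and two rounds otherwise. -/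
lemma run_thresholdLoop_succ (f : Finset N → ℝ) (k : ℕ) (τ ε : ℝ) (m l r : ℕ) (S A : Finset N) :
    (thresholdLoop k τ ε m l (r + 1) S A).run f =
      if (candidates f τ S A).card < 3 * k then
        PMF.pure ((S, candidates f τ S A), [A.card + 1])
      else (batchLaw f k τ ε m l S (candidates f τ S A)).bind fun T =>
        (if (S ∪ T).card = k then PMF.pure ((S ∪ T, candidates f τ S A), [])
        else (thresholdLoop k τ ε m l r (S ∪ T) (candidates f τ S A)).run f).map fun z =>
          (z.1, (A.card + 1) :: ((m + 1) * l * 2) :: z.2) := by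
  have hc : ∀ val : Option {x // x ∈ A} → ℝ, (∀ x, val (some x) = f (insert x.1 S)) →
      val none = f S → (A.attach.filter fun x => τ ≤ val (some x) - val none).image Subtype.val =
      candidates f τ S A := by
    intro val h1 h2
    ext x
    simp only [candidates, Finset.mem_image, Finset.mem_filter, Finset.mem_attach, true_and, h1, h2,
      Subtype.exists, exists_and_left, exists_prop, exists_eq_right_right]
    tauto
  rw [thresholdLoop, Alg.run]
  rw [hc (fun o => f (o.elim S fun x => insert x.1 S)) (fun _ => rfl) rfl]
  by_cases h : (candidates f τ S A).card < 3 * k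
  · rw [if_pos h, if_pos h]
    simp [Alg.run, PMF.pure_map]
  · rw [if_neg h, if_neg h]
    have h2 : ∀ T : Finset N, (if (S ∪ T).card = k then .ret (S ∪ T, candidates f τ S A)
        else thresholdLoop k τ ε m l r (S ∪ T) (candidates f τ S A) :
          Alg N (Finset N × Finset N)).run f =
        if (S ∪ T).card = k then PMF.pure ((S ∪ T, candidates f τ S A), [])
        else (thresholdLoop k τ ε m l r (S ∪ T) (candidates f τ S A)).run f := by
      intro T; split_ifs <;> rfl
    simp only [Alg.run, batchLaw, PMF.bind_bind, PMF.bind_map, PMF.map_bind, Function.comp_def, h2]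
    simp only [Fintype.card_option, Fintype.card_coe, Fintype.card_prod, Fintype.card_fin,
      Fintype.card_bool, PMF.map_comp, Function.comp_def]
    rfl

lemma law_thresholdLoop_succ (f : Finset N → ℝ) (k : ℕ) (τ ε : ℝ) (m l r : ℕ) (S A : Finset N) :
    (thresholdLoop k τ ε m l (r + 1) S A).law f =
      if (candidates f τ S A).card < 3 * k then PMF.pure (S, candidates f τ S A)
      else (batchLaw f k τ ε m l S (candidates f τ S A)).bind fun T =>
        if (S ∪ T).card = k then PMF.pure (S ∪ T, candidates f τ S A)
        else (thresholdLoop k τ ε m l r (S ∪ T) (candidates f τ S A)).law f := by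
  rw [Alg.law, run_thresholdLoop_succ]
  split_ifs with h
  · simp [PMF.pure_map]
  · simp only [PMF.map_bind, PMF.map_comp, Function.comp_def]
    congr 1; ext1 T
    split_ifs with h1
    · simp [PMF.pure_map]
    · rfl

end Loop

/-! ### Estimates for one iteration -/

/-- The conditions on the parameters of the threshold loop: the largest batch size is at least `k`
if there are enough candidates, and `ρ` bounds the probability that some estimate of an iteration
is off. -/
structure LoopParams (k : ℕ) (ε ρ : ℝ) (m l : ℕ) : Prop where
  k_pos : 1 ≤ k
  eps_pos : 0 < ε
  eps_le : ε ≤ 1 / 2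
  l_pos : 0 < l
  le_size : k ≤ ⌊(1 + ε) ^ m⌋₊
  fail_le : (m + 1) * Real.exp (-(ε * l / 25)) ≤ ρ

section Iteration

variable {N : Type} {f : Finset N → ℝ} {k m l : ℕ} {τ ε ρ : ℝ} {S A : Finset N}

lemma LoopParams.rho_nonneg (hp : LoopParams k ε ρ m l) : 0 ≤ ρ :=
  le_trans (by positivity) hp.fail_le

lemma batchSize_zero (hA : 1 ≤ A.card) : batchSize ε A 0 = 1 := by
  simp [batchSize, hA]

lemma one_le_batchSize (hε : 0 ≤ ε) (hA : 1 ≤ A.card) (i : ℕ) : 1 ≤ batchSize ε A i := by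
  refine le_min (Nat.le_floor ?_) hA
  have : (1 : ℝ) ≤ (1 + ε) ^ i := one_le_pow₀ (by linarith)
  simpa using this

lemma batchSize_mono (hε : 0 ≤ ε) {i j : ℕ} (hij : i ≤ j) : batchSize ε A i ≤ batchSize ε A j :=
  min_le_min_right _ (Nat.floor_mono (pow_le_pow_right₀ (by linarith) hij))

lemma batchSize_succ_le (hε : 0 ≤ ε) (hε' : ε ≤ 1 / 2) (i : ℕ) :
    batchSize ε A (i + 1) ≤ 2 * batchSize ε A i := by
  unfold batchSize
  have h1 : (1 : ℝ) ≤ (1 + ε) ^ i := one_le_pow₀ (by linarith)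
  have h2 : ⌊(1 + ε) ^ (i + 1)⌋₊ ≤ 2 * ⌊(1 + ε) ^ i⌋₊ := by
    rw [← Nat.lt_succ_iff, Nat.floor_lt (by positivity)]
    have h3 := Nat.lt_floor_add_one ((1 + ε) ^ i)
    have h4 : (1 : ℝ) ≤ ⌊(1 + ε) ^ i⌋₊ := by exact_mod_cast Nat.le_floor (by simpa using h1)
    rw [pow_succ]; push_cast
    nlinarith
  omega

lemma batchSize_le_two_mul (hε : 0 ≤ ε) (hε' : ε ≤ 1 / 2) (i : ℕ) :
    batchSize ε A i ≤ 2 * batchSize ε A (i - 1) := by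
  rcases i with _ | i
  · simp; omega
  · exact batchSize_succ_le hε hε' i

lemma isGood_eq (q : Finset N × Finset N) : isGood f τ q = 0 ∨ isGood f τ q = 1 := by
  unfold isGood; split <;> simp

variable [DecidableEq N]

lemma candidates_subset : candidates f τ S A ⊆ A := Finset.filter_subset _ _

lemma disjoint_candidates (hτ : 0 < τ) : Disjoint S (candidates f τ S A) := by
  rw [Finset.disjoint_right]
  intro x hx hxS
  have := (Finset.mem_filter.1 hx).2
  rw [Finset.insert_eq_of_mem hxS] at this
  linarith

lemma le_of_mem_candidates {x : N} (hx : x ∈ candidates f τ S A) : τ ≤ f (insert x S) - f S :=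
  (Finset.mem_filter.1 hx).2

lemma mem_support_batchLaw (hA : k ≤ A.card) {T : Finset N}
    (hT : T ∈ (batchLaw f k τ ε m l S A).support) :
    T ⊆ A ∧ T.card ≤ k - S.card ∧ (0 ≤ ε → 1 ≤ k → S.card < k → 1 ≤ T.card) := by
  rw [batchLaw, PMF.mem_support_bind_iff] at hT
  obtain ⟨i, _, hT⟩ := hT
  rw [mem_support_unifSize ((min_le_right _ _).trans ((Nat.sub_le _ _).trans hA))] at hT
  refine ⟨hT.1, by omega, fun hε hk hS => ?_⟩
  rw [hT.2]
  exact le_min (one_le_batchSize hε (by omega) _) (by omega)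

variable [Fintype N]

/-- The index `i` is good if the batches one size below have mostly good elements, and either
batches of the `i`-th size have a noticeable proportion of bad elements, or the `i`-th size is at
least `k`. -/
def GoodIndex (f : Finset N → ℝ) (k : ℕ) (τ ε : ℝ) (S A : Finset N) (i : ℕ) : Prop :=
  1 - 2 * ε ≤ goodProb f τ S A (batchSize ε A (i - 1)) ∧
    (goodProb f τ S A (batchSize ε A i) ≤ 1 - ε ∨ k ≤ batchSize ε A i)

open Classical in
/-- The chosen index is good unless one of the estimates is off. -/
lemma ev_not_goodIndex_le (hp : LoopParams k ε ρ m l) (hA : k ≤ A.card)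
    (hgood : ∀ x ∈ A, τ ≤ f (insert x S) - f S) :
    ev (samples ε m l S A)
      (fun X => if GoodIndex f k τ ε S A (pickIndex f τ ε X) then 0 else 1) ≤ ρ := by
  have hε := hp.eps_pos
  have hk := hp.k_pos
  -- `off i` indicates that the estimate for the `i`-th size misses the true value by `ε / 2`
  let off : Fin (m + 1) → (Fin l → Finset N × Finset N) → ℝ := fun i v =>
    if (goodProb f τ S A (batchSize ε A i) ≤ 1 - 2 * ε ∧
        1 - 1.5 * ε < (∑ j, isGood f τ (v j)) / l) ∨
      (1 - ε ≤ goodProb f τ S A (batchSize ε A i) ∧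
        (∑ j, isGood f τ (v j)) / l ≤ 1 - 1.5 * ε) then 1 else 0
  have hoff0 : ∀ i v, 0 ≤ off i v := by intro i v; simp only [off]; split <;> norm_num
  have h1 : ∀ X : Fin (m + 1) → Fin l → Finset N × Finset N,
      (if GoodIndex f k τ ε S A (pickIndex f τ ε X) then (0 : ℝ) else 1) ≤ ∑ i, off i (X i) := by
    intro X
    split_ifs with hg
    · exact Finset.sum_nonneg fun i _ => hoff0 i _
    · obtain ⟨hlt, hlast⟩ := pickIndex_spec f τ ε X
      suffices h : ∃ i, off i (X i) = 1 by
        obtain ⟨i, hi⟩ := h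
        rw [← hi]
        exact Finset.single_le_sum (f := fun i => off i (X i)) (fun j _ => hoff0 j _)
          (Finset.mem_univ i)
      set i := pickIndex f τ ε X with hi
      rw [GoodIndex, not_and_or, not_or, not_le, not_le, not_le] at hg
      rcases hg with hg | hg
      · -- the first size is `1`, for which all batches are good
        have hi0 : (i : ℕ) ≠ 0 := by
          intro h0
          rw [h0, Nat.zero_sub, batchSize_zero (by omega),
            goodProb_one (Finset.card_pos.1 (by omega)) hgood] at hg
          linarith
        refine ⟨⟨i - 1, by omega⟩, if_pos (Or.inl ⟨hg.le, hlt _ ?_⟩)⟩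
        rw [Fin.lt_def]; simp only; omega
      · refine ⟨i, if_pos (Or.inr ⟨hg.1.le, ?_⟩)⟩
        rcases hlast with h | h
        · exact h
        · exfalso
          have h2 := hg.2
          rw [h, batchSize, Fin.val_last] at h2
          have := hp.le_size
          omega
  refine (ev_mono h1).trans ((le_of_eq (ev_sum _ _ _)).trans ?_)
  refine le_trans ?_ hp.fail_le
  have h2 : ∀ i : Fin (m + 1), ev (samples ε m l S A) (fun X => off i (X i)) ≤
      Real.exp (-(ε * l / 25)) := by
    intro i
    unfold samples
    rw [ev_indep_apply _ i (off i)]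
    simp only [off]
    have hge : goodProb f τ S A (batchSize ε A i) =
      ev (indicatorQueries S A (batchSize ε A i)) (isGood f τ) := rfl
    by_cases h3 : goodProb f τ S A (batchSize ε A i) ≤ 1 - 2 * ε
    · refine le_trans (ev_mono fun v => ?_) (ev_rate_gt_le _ isGood_eq hε hp.l_pos (hge ▸ h3))
      have : ¬ 1 - ε ≤ goodProb f τ S A (batchSize ε A i) := by linarith
      simp [h3, this]
    · by_cases h4 : 1 - ε ≤ goodProb f τ S A (batchSize ε A i)
      · refine le_trans (ev_mono fun v => ?_) (ev_rate_le_le _ isGood_eq hε hp.l_pos (hge ▸ h4))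
        simp [h3, h4]
      · simp only [h3, h4, false_and, or_false, if_false, ev_const]
        positivity
  refine (Finset.sum_le_sum fun i _ => h2 i).trans ?_
  simp

lemma ev_batchLaw (hA : k ≤ A.card) (h : Finset N → ℝ) :
    ev (batchLaw f k τ ε m l S A) h = ev (samples ε m l S A) fun X =>
      avg A (min (batchSize ε A (pickIndex f τ ε X)) (k - S.card)) h := by
  rw [batchLaw, ev_bind, ev_map]
  congr 1; ext X
  rw [ev_unifSize]
  exact (min_le_right _ _).trans ((Nat.sub_le _ _).trans hA)

/-- Every element enters the batch with probability at most the expected size of the batch divided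
by `3 k`. -/
lemma ev_batchLaw_mem_le (hk : 1 ≤ k) (hA : 3 * k ≤ A.card) (x : N) :
    ev (batchLaw f k τ ε m l S A) (fun T => if x ∈ T then 1 else 0) ≤
      ev (batchLaw f k τ ε m l S A) (fun T => (T.card : ℝ)) / (3 * k) := by
  rw [ev_batchLaw (by omega), ev_batchLaw (by omega), div_eq_mul_inv, ← ev_mul_const]
  refine ev_mono fun X => ?_
  set t := min (batchSize ε A (pickIndex f τ ε X)) (k - S.card)
  have ht : t ≤ A.card := (min_le_right _ _).trans ((Nat.sub_le _ _).trans (by omega))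
  refine (avg_mem_le x ht).trans ?_
  rw [avg_congr (h' := fun _ => (t : ℝ)) (fun T _ hT => by rw [hT]), avg_const ht, div_eq_mul_inv]
  have : (3 * k : ℝ) ≤ A.card := by exact_mod_cast hA
  have hk' : (0 : ℝ) < k := by exact_mod_cast hk
  gcongr

/-- The weight of the value of a partial solution of size `s`. It increases from `2 / 3` to
`1`, which accounts for the loss that the elements still to come may cause. -/
noncomputable def weight (k s : ℕ) : ℝ := (2 * k + s) / (3 * k)

lemma weight_le_one {s : ℕ} (hk : 1 ≤ k) (hs : s ≤ k) : weight k s ≤ 1 := by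
  unfold weight
  have hk' : (0 : ℝ) < k := by exact_mod_cast hk
  have hs' : (s : ℝ) ≤ k := by exact_mod_cast hs
  rw [div_le_one (by positivity)]; linarith

lemma two_thirds_le_weight (s : ℕ) (hk : 1 ≤ k) : 2 / 3 ≤ weight k s := by
  unfold weight
  have hk' : (0 : ℝ) < k := by exact_mod_cast hk
  rw [le_div_iff₀ (by positivity)]
  have : (0 : ℝ) ≤ s := by positivity
  linarith

/-- The increase of the weight makes up for the loss of the fraction `t / a` of the value. -/
lemma weight_le_mul {s t a : ℕ} (hk : 1 ≤ k) (hst : s + t ≤ k) (ha : 3 * k ≤ a) :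
    weight k s ≤ weight k (s + t) * (1 - t / a) := by
  have hk' : (0 : ℝ) < k := by exact_mod_cast hk
  have hst' : (s : ℝ) + t ≤ k := by exact_mod_cast hst
  have ha' : (3 : ℝ) * k ≤ a := by exact_mod_cast ha
  have ht : (0 : ℝ) ≤ t := by positivity
  have h1 : (1 - t / (3 * k) : ℝ) ≤ 1 - t / a := by gcongr
  refine le_trans ?_ (mul_le_mul_of_nonneg_left h1 ?_)
  · unfold weight
    have h3 : (2 * k + ((s + t : ℕ) : ℝ)) / (3 * k) * (1 - t / (3 * k)) =
        ((2 * k + s + t) * (3 * k - t) / (3 * k)) / (3 * k) := by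
      push_cast; field_simp; ring
    rw [h3]
    gcongr
    rw [le_div_iff₀ (by positivity)]
    nlinarith
  · unfold weight; positivity

/-- The expected weighted value gained by one batch. The constant `4 / 15` is the product of the
minimal weight `2 / 3`, the fraction `4 / 5` of `IsSubmodular.avg_union_ge_of_le`, and the ratio
`1 / 2` of consecutive batch sizes. -/
lemma ev_batchLaw_value_ge (hp : LoopParams k ε ρ m l) (hf : IsSubmodular f) (h0 : ∀ S, 0 ≤ f S)
    (hτ : 0 ≤ τ) (hS : S.card < k) (hA : 3 * k ≤ A.card) (hSA : Disjoint S A)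
    (hgood : ∀ x ∈ A, τ ≤ f (insert x S) - f S) :
    weight k S.card * f S + 4 / 15 * (1 - 2 * ε) * τ *
        ev (batchLaw f k τ ε m l S A) (fun T => (T.card : ℝ)) - ρ * (4 / 15 * (1 - 2 * ε) * τ * k) ≤
      ev (batchLaw f k τ ε m l S A) fun T => weight k (S.card + T.card) * f (S ∪ T) := by
  classical
  have hk := hp.k_pos
  have hε := hp.eps_pos
  have hε' := hp.eps_le
  set c := 4 / 15 * (1 - 2 * ε) * τ with hc
  have hc0 : 0 ≤ c := mul_nonneg (by linarith) hτ
  have hfail := ev_not_goodIndex_le (f := f) (S := S) hp (by omega) hgood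
  have h1 : weight k S.card * f S + c * ev (batchLaw f k τ ε m l S A) (fun T => (T.card : ℝ)) -
      ev (samples ε m l S A)
        (fun X => if GoodIndex f k τ ε S A (pickIndex f τ ε X) then 0 else 1) * (c * k) ≤
      ev (batchLaw f k τ ε m l S A) fun T => weight k (S.card + T.card) * f (S ∪ T) := by
    rw [ev_batchLaw (by omega), ev_batchLaw (by omega), ← ev_const_mul, ← ev_mul_const,
      ← ev_const (samples ε m l S A) (weight k S.card * f S), ← ev_add, ← ev_sub]
    refine ev_mono fun X => ?_
    set i := pickIndex f τ ε X
    set t := min (batchSize ε A i) (k - S.card) with ht_def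
    have ht : t ≤ A.card := (min_le_right _ _).trans ((Nat.sub_le _ _).trans (by omega))
    have htk : t ≤ k := (min_le_right _ _).trans (Nat.sub_le _ _)
    have htk' : (t : ℝ) ≤ k := by exact_mod_cast htk
    have ht1 : 1 ≤ t := le_min (one_le_batchSize hε.le (by omega) _) (by omega)
    have hst : S.card + t ≤ k := by omega
    rw [avg_congr (h := fun T : Finset N => (T.card : ℝ)) (h' := fun _ => (t : ℝ))
      (fun T _ hT => by rw [hT]), avg_const ht]
    rw [avg_congr (h := fun T => weight k (S.card + T.card) * f (S ∪ T))
      (h' := fun T => weight k (S.card + t) * f (S ∪ T)) (fun T _ hT => by rw [hT]), avg_const_mul]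
    have hw := weight_le_mul (s := S.card) (t := t) hk hst hA
    have hw' := two_thirds_le_weight (S.card + t) hk
    have hloss : weight k S.card * f S ≤ weight k (S.card + t) * ((1 - t / A.card) * f S) := by
      rw [← mul_assoc]; exact mul_le_mul_of_nonneg_right hw (h0 S)
    split_ifs with hg
    -- at a good index, the batches one size below consist mostly of good elements
    · set s := min (batchSize ε A (i - 1)) (k - S.card) with hs_def
      have hs1 : 1 ≤ s := le_min (one_le_batchSize hε.le (by omega) _) (by omega)
      have hst' : s ≤ t := min_le_min_right _ (batchSize_mono hε.le (Nat.sub_le _ _))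
      have hts : t ≤ 2 * s := by
        have := batchSize_le_two_mul (A := A) hε.le hε' i
        omega
      have hμ : 1 - 2 * ε ≤ goodProb f τ S A s :=
        hg.1.trans (goodProb_anti hf hSA hs1 (min_le_left _ _) (min_le_right _ _))
      have hgain := hf.avg_union_ge_of_le h0 hSA hτ hs1 hst' hts htk hA
      have hts' : (t : ℝ) ≤ 2 * s := by exact_mod_cast hts
      have hs0 : (0 : ℝ) ≤ s := by positivity
      have h5 : c * t ≤ weight k (S.card + t) * (4 / 5 * τ * s * goodProb f τ S A s) := by
        calc c * t ≤ c * (2 * s) := by gcongr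
          _ = 2 / 3 * (4 / 5 * τ * s * (1 - 2 * ε)) := by rw [hc]; ring
          _ ≤ weight k (S.card + t) * (4 / 5 * τ * s * goodProb f τ S A s) := by
            gcongr
            exact mul_nonneg (by positivity) (by linarith)
      have h6 := mul_le_mul_of_nonneg_left hgain (by linarith : 0 ≤ weight k (S.card + t))
      rw [mul_add] at h6
      linarith
    · have hgain := hf.avg_union_ge_of_le h0 hSA hτ ht1 le_rfl (by omega) htk hA
      have h5 : 0 ≤ 4 / 5 * τ * t * goodProb f τ S A t :=
        mul_nonneg (by positivity) (goodProb_nonneg t)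
      have h6 := mul_le_mul_of_nonneg_left ((le_add_of_nonneg_right h5).trans hgain)
        (by linarith : 0 ≤ weight k (S.card + t))
      have h7 : c * t ≤ c * k := by gcongr
      linarith
  have hk0 : 0 ≤ c * k := by positivity
  have := mul_le_mul_of_nonneg_right hfail hk0
  linarith

/-- A quantity that is controlled by the number of candidates surviving the batch, and that
vanishes once the solution is complete. -/
lemma ev_batchLaw_survivors_le (hp : LoopParams k ε ρ m l) (hf : IsSubmodular f)
    (hτ : 0 < τ) (hS : S.card < k) (hA : 3 * k ≤ A.card) (hSA : Disjoint S A)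
    (hgood : ∀ x ∈ A, τ ≤ f (insert x S) - f S) {h : Finset N → ℝ} {a b M : ℝ} (ha : 0 ≤ a)
    (hb : 0 ≤ b) (hM : 0 ≤ M) (hhM : ∀ T, h T ≤ M)
    (hh : ∀ T, h T ≤ a * (candidates f τ (S ∪ T) A).card + b)
    (hh0 : ∀ T, (S ∪ T).card = k → h T ≤ 0) :
    ev (batchLaw f k τ ε m l S A) h ≤ a * ((1 - ε) * A.card) + b + ρ * M := by
  classical
  have hk := hp.k_pos
  have hε := hp.eps_pos
  have hε' := hp.eps_le
  have hfail := ev_not_goodIndex_le (f := f) (S := S) hp (by omega) hgood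
  refine le_trans ?_ (add_le_add_right (mul_le_mul_of_nonneg_right hfail hM) _)
  rw [ev_batchLaw (by omega), ← ev_mul_const,
    ← ev_const (samples ε m l S A) (a * ((1 - ε) * A.card) + b), ← ev_add]
  refine ev_mono fun X => ?_
  set i := pickIndex f τ ε X
  set t := min (batchSize ε A i) (k - S.card) with ht_def
  have htk : t ≤ k := (min_le_right _ _).trans (Nat.sub_le _ _)
  have ht : t ≤ A.card := by omega
  have hbase : 0 ≤ a * ((1 - ε) * A.card) + b :=
    add_nonneg (mul_nonneg ha (mul_nonneg (by linarith) (by positivity))) hb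
  split_ifs with hg
  · rw [zero_mul, add_zero]
    by_cases hlast : k - S.card ≤ batchSize ε A i
    · refine (avg_mono (h' := fun _ => 0) fun T hT hc => hh0 T ?_).trans ?_
      · rw [Finset.card_union_of_disjoint (Finset.disjoint_of_subset_right hT hSA)]; omega
      · rw [avg_const ht]; exact hbase
    · have ht' : t = batchSize ε A i := by omega
      have hμ : goodProb f τ S A t ≤ 1 - ε := by
        rcases hg.2 with hg | hg
        · rw [ht']; exact hg
        · omega
      have ht1 : 1 ≤ t := le_min (one_le_batchSize hε.le (by omega) _) (by omega)
      have h1 := avg_card_filter_le (τ := τ) hf hSA hτ ht1 (by omega)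
      refine (avg_mono fun T _ _ => hh T).trans ?_
      rw [avg_add, avg_const_mul, avg_const ht]
      unfold candidates
      gcongr
      exact h1.trans (by gcongr)
  · rw [one_mul]
    refine (avg_mono fun T _ _ => hhM T).trans ?_
    rw [avg_const ht]; linarith

end Iteration

/-! ### The threshold loop -/

section ThresholdLoop

variable {N : Type} [DecidableEq N] {f : Finset N → ℝ} {k m l : ℕ} {τ ε ρ : ℝ}

lemma ev_loop_zero (S A : Finset N) (X : Finset N × Finset N → ℝ) :
    ev ((thresholdLoop k τ ε m l 0 S A).law f) X = X (S, A) := by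
  rw [thresholdLoop, Alg.law_ret, ev_pure]

lemma ev_loop_succ_of_lt (r : ℕ) {S A : Finset N} (X : Finset N × Finset N → ℝ)
    (h : (candidates f τ S A).card < 3 * k) :
    ev ((thresholdLoop k τ ε m l (r + 1) S A).law f) X = X (S, candidates f τ S A) := by
  rw [law_thresholdLoop_succ, if_pos h, ev_pure]

lemma card_union_batch {S A T : Finset N} (hSA : Disjoint S A) (hTA : T ⊆ A) :
    (S ∪ T).card = S.card + T.card :=
  Finset.card_union_of_disjoint (Finset.disjoint_of_subset_right hTA hSA)

lemma mem_support_loop_succ {r : ℕ} {S A : Finset N} {z : (Finset N × Finset N) × List ℕ}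
    (hz : z ∈ ((thresholdLoop k τ ε m l (r + 1) S A).run f).support) :
    ((candidates f τ S A).card < 3 * k ∧ z = ((S, candidates f τ S A), [A.card + 1])) ∨
    (3 * k ≤ (candidates f τ S A).card ∧
      ∃ T ∈ (batchLaw f k τ ε m l S (candidates f τ S A)).support,
      ((S ∪ T).card = k ∧
        z = ((S ∪ T, candidates f τ S A), [A.card + 1, (m + 1) * l * 2])) ∨
      ((S ∪ T).card ≠ k ∧
        ∃ w ∈ ((thresholdLoop k τ ε m l r (S ∪ T) (candidates f τ S A)).run f).support,
        z = (w.1, (A.card + 1) :: ((m + 1) * l * 2) :: w.2))) := by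
  rw [run_thresholdLoop_succ] at hz
  split_ifs at hz with h
  · rw [PMF.mem_support_pure_iff] at hz
    exact Or.inl ⟨h, hz⟩
  · rw [PMF.mem_support_bind_iff] at hz
    obtain ⟨T, hT, hz⟩ := hz
    rw [PMF.mem_support_map_iff] at hz
    obtain ⟨w, hw, rfl⟩ := hz
    refine Or.inr ⟨not_lt.1 h, T, hT, ?_⟩
    split_ifs at hw with hk
    · rw [PMF.mem_support_pure_iff] at hw
      exact Or.inl ⟨hk, by rw [hw]⟩
    · exact Or.inr ⟨hk, w, hw, rfl⟩

/-- In every execution, the solution has at most `k` elements. -/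
lemma loop_card_le : ∀ (r : ℕ) (S A : Finset N), S.card ≤ k →
    ∀ z ∈ ((thresholdLoop k τ ε m l r S A).run f).support, z.1.1.card ≤ k := by
  intro r
  induction r with
  | zero =>
    intro S A hS z hz
    rw [thresholdLoop, Alg.run, PMF.mem_support_pure_iff] at hz
    rw [hz]; exact hS
  | succ r ih =>
    intro S A hS z hz
    rcases mem_support_loop_succ hz with ⟨_, rfl⟩ | ⟨hA, T, hT, ⟨h, rfl⟩ | ⟨h, w, hw, rfl⟩⟩
    · exact hS
    · exact h.le
    · obtain ⟨hTA, hTk, -⟩ := mem_support_batchLaw (by omega) hT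
      refine ih _ _ ?_ w hw
      have := Finset.card_union_le S T
      omega

/-- In every execution, the elements that are no longer candidates have marginal value below
`τ`. -/
lemma loop_marginal_lt (hf : IsSubmodular f) (hτ : 0 < τ) : ∀ (r : ℕ) (S A : Finset N),
    (∀ x ∉ A, f (insert x S) - f S < τ) →
    ∀ z ∈ ((thresholdLoop k τ ε m l r S A).run f).support,
      ∀ x ∉ z.1.2, f (insert x z.1.1) - f z.1.1 < τ := by
  have hmono : ∀ (S T : Finset N) (x : N), f (insert x S) - f S < τ →
      f (insert x (S ∪ T)) - f (S ∪ T) < τ := by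
    intro S T x hx
    by_cases hxT : x ∈ S ∪ T
    · rw [Finset.insert_eq_of_mem hxT]; linarith
    · exact (hf _ _ Finset.subset_union_left x hxT).trans_lt hx
  have hcand : ∀ S A : Finset N, (∀ x ∉ A, f (insert x S) - f S < τ) →
      ∀ x ∉ candidates f τ S A, f (insert x S) - f S < τ := by
    intro S A hA x hx
    by_cases hxA : x ∈ A
    · by_contra h
      exact hx (Finset.mem_filter.2 ⟨hxA, not_lt.1 h⟩)
    · exact hA x hxA
  intro r
  induction r with
  | zero =>
    intro S A hA z hz
    rw [thresholdLoop, Alg.run, PMF.mem_support_pure_iff] at hz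
    rw [hz]; exact hA
  | succ r ih =>
    intro S A hA z hz
    have hA' := hcand S A hA
    rcases mem_support_loop_succ hz with ⟨_, rfl⟩ | ⟨_, T, hT, ⟨h, rfl⟩ | ⟨h, w, hw, rfl⟩⟩
    · exact hA'
    · exact fun x hx => hmono _ _ _ (hA' x hx)
    · exact ih _ _ (fun x hx => hmono _ _ _ (hA' x hx)) w hw

variable [Fintype N]

lemma ev_loop_succ (r : ℕ) {S A : Finset N} (X : Finset N × Finset N → ℝ)
    (h : ¬ (candidates f τ S A).card < 3 * k) :
    ev ((thresholdLoop k τ ε m l (r + 1) S A).law f) X =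
      ev (batchLaw f k τ ε m l S (candidates f τ S A)) fun T =>
        if (S ∪ T).card = k then X (S ∪ T, candidates f τ S A)
        else ev ((thresholdLoop k τ ε m l r (S ∪ T) (candidates f τ S A)).law f) X := by
  rw [law_thresholdLoop_succ, if_neg h, ev_bind]
  congr 1; ext T
  split_ifs
  · rw [ev_pure]
  · rfl

/-- The solution found by the loop has value about `τ` per element, up to a constant factor. -/
lemma ev_loop_value_ge (hp : LoopParams k ε ρ m l) (hf : IsSubmodular f) (h0 : ∀ S, 0 ≤ f S)
    (hτ : 0 < τ) : ∀ (r : ℕ) (S A : Finset N), S.card < k →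
    weight k S.card * f S + 4 / 15 * (1 - 2 * ε) * τ *
        (ev ((thresholdLoop k τ ε m l r S A).law f) (fun z => (z.1.card : ℝ)) - S.card) -
        r * (ρ * (4 / 15 * (1 - 2 * ε) * τ * k)) ≤
      ev ((thresholdLoop k τ ε m l r S A).law f) fun z => f z.1 := by
  have hk := hp.k_pos
  have hε := hp.eps_pos
  have hε' := hp.eps_le
  have hρ := hp.rho_nonneg
  set c := 4 / 15 * (1 - 2 * ε) * τ with hc
  have hc0 : 0 ≤ c := mul_nonneg (by linarith) hτ.le
  have hbase : ∀ S : Finset N, S.card ≤ k → weight k S.card * f S ≤ f S := fun S hS =>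
    mul_le_of_le_one_left (h0 S) (weight_le_one hk hS)
  intro r
  induction r with
  | zero =>
    intro S A hS
    rw [ev_loop_zero, ev_loop_zero]
    have := hbase S hS.le
    simp; linarith
  | succ r ih =>
    intro S A hS
    have hloss : 0 ≤ ρ * (c * k) := by positivity
    by_cases hA : (candidates f τ S A).card < 3 * k
    · rw [ev_loop_succ_of_lt r _ hA, ev_loop_succ_of_lt r _ hA]
      have := hbase S hS.le
      have h1 : 0 ≤ ((r + 1 : ℕ) : ℝ) * (ρ * (c * k)) := by positivity
      simp only [sub_self, mul_zero, add_zero]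
      linarith
    · rw [ev_loop_succ r _ hA, ev_loop_succ r _ hA]
      set A' := candidates f τ S A
      have hSA : Disjoint S A' := disjoint_candidates hτ
      have hmain := ev_batchLaw_value_ge hp hf h0 hτ.le hS (not_lt.1 hA) hSA
        fun x hx => le_of_mem_candidates hx
      rw [← hc] at hmain
      have hstep : ev (batchLaw f k τ ε m l S A')
          (fun T => weight k (S.card + T.card) * f (S ∪ T) + (c *
            ((if (S ∪ T).card = k then ((S ∪ T).card : ℝ)
            else ev ((thresholdLoop k τ ε m l r (S ∪ T) A').law f) (fun z => (z.1.card : ℝ))) -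
              T.card) - (c * S.card + r * (ρ * (c * k))))) ≤
          ev (batchLaw f k τ ε m l S A') (fun T => if (S ∪ T).card = k then f (S ∪ T)
            else ev ((thresholdLoop k τ ε m l r (S ∪ T) A').law f) fun z => f z.1) := by
        refine ev_mono_support fun T hT => ?_
        obtain ⟨hTA, hTk, -⟩ := mem_support_batchLaw (by omega) hT
        have hcard := card_union_batch hSA hTA
        have hcard' : ((S ∪ T).card : ℝ) = S.card + T.card := by exact_mod_cast hcard
        rw [← hcard]
        split_ifs with hk'
        · have h1 := hbase (S ∪ T) hk'.le
          have h2 : 0 ≤ (r : ℝ) * (ρ * (c * k)) := by positivity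
          rw [hcard']
          linarith
        · have h1 := ih (S ∪ T) A' (by omega)
          rw [hcard'] at h1
          linarith
      rw [ev_add, ev_sub, ev_const, ev_const_mul, ev_sub] at hstep
      push_cast
      linarith

/-- Every element enters the solution with probability at most its expected size divided by
`3 k`. -/
lemma ev_loop_mem_le (hk : 1 ≤ k) (hτ : 0 < τ) (x : N) :
    ∀ (r : ℕ) (S A : Finset N), S.card < k →
    ev ((thresholdLoop k τ ε m l r S A).law f) (fun z => if x ∈ z.1 then 1 else 0) ≤
      (if x ∈ S then 1 else 0) +
        (ev ((thresholdLoop k τ ε m l r S A).law f) (fun z => (z.1.card : ℝ)) - S.card) /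
          (3 * k) := by
  intro r
  induction r with
  | zero => intro S A hS; rw [ev_loop_zero, ev_loop_zero]; simp
  | succ r ih =>
    intro S A hS
    by_cases hA : (candidates f τ S A).card < 3 * k
    · rw [ev_loop_succ_of_lt r _ hA, ev_loop_succ_of_lt r _ hA]; simp
    · rw [ev_loop_succ r _ hA, ev_loop_succ r _ hA]
      set A' := candidates f τ S A
      have hSA : Disjoint S A' := disjoint_candidates hτ
      have h1 := ev_batchLaw_mem_le (f := f) (τ := τ) (ε := ε) (m := m) (l := l) (S := S) hk
        (not_lt.1 hA) x
      have hstep : ev (batchLaw f k τ ε m l S A') (fun T => if (S ∪ T).card = k then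
            (if x ∈ S ∪ T then (1 : ℝ) else 0)
            else ev ((thresholdLoop k τ ε m l r (S ∪ T) A').law f)
              fun z => if x ∈ z.1 then (1 : ℝ) else 0) ≤
          ev (batchLaw f k τ ε m l S A') (fun T => (if x ∈ T then (1 : ℝ) else 0) +
            ((if x ∈ S then (1 : ℝ) else 0) + (((if (S ∪ T).card = k then ((S ∪ T).card : ℝ)
            else ev ((thresholdLoop k τ ε m l r (S ∪ T) A').law f) (fun z => (z.1.card : ℝ))) -
              (S.card + T.card)) * (3 * k : ℝ)⁻¹))) := by
        refine ev_mono_support fun T hT => ?_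
        obtain ⟨hTA, hTk, -⟩ := mem_support_batchLaw (by omega) hT
        have hcard := card_union_batch hSA hTA
        have hcard' : ((S ∪ T).card : ℝ) = S.card + T.card := by exact_mod_cast hcard
        have hu : (if x ∈ S ∪ T then (1 : ℝ) else 0) ≤
            (if x ∈ T then (1 : ℝ) else 0) + (if x ∈ S then (1 : ℝ) else 0) := by
          by_cases h1 : x ∈ S <;> by_cases h2 : x ∈ T <;> simp [h1, h2]
        rw [← hcard']
        by_cases hk' : (S ∪ T).card = k
        · rw [if_pos hk', if_pos hk', sub_self, zero_mul, add_zero]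
          exact hu
        · rw [if_neg hk', if_neg hk']
          have h1 := ih (S ∪ T) A' (by omega)
          rw [div_eq_mul_inv] at h1
          linarith
      rw [ev_add, ev_add, ev_const, ev_mul_const, ev_sub, ev_add, ev_const] at hstep
      refine hstep.trans ?_
      rw [div_eq_mul_inv] at h1 ⊢
      linarith

/-- The loop rarely ends with many candidates and an incomplete solution. -/
lemma ev_loop_fail_le (hp : LoopParams k ε ρ m l) (hf : IsSubmodular f)
    (hτ : 0 < τ) : ∀ (r : ℕ) (S A : Finset N), S.card < k →
    ev ((thresholdLoop k τ ε m l (r + 1) S A).law f)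
        (fun z => if 3 * k ≤ z.2.card ∧ z.1.card < k then 1 else 0) ≤
      (1 - ε) ^ r * (candidates f τ S A).card + (r + 1) * ρ := by
  have hk := hp.k_pos
  have hε := hp.eps_pos
  have hε' := hp.eps_le
  have hρ := hp.rho_nonneg
  have hpow : ∀ r : ℕ, 0 ≤ (1 - ε) ^ r := fun r => pow_nonneg (by linarith) r
  have hle1 : ∀ (P : PMF (Finset N × Finset N)),
      ev P (fun z => if 3 * k ≤ z.2.card ∧ z.1.card < k then (1 : ℝ) else 0) ≤ 1 := by
    intro P
    refine (ev_mono (Y := fun _ => 1) fun z => ?_).trans (ev_const P 1).le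
    split <;> norm_num
  intro r
  induction r with
  | zero =>
    intro S A hS
    by_cases hA : (candidates f τ S A).card < 3 * k
    · rw [ev_loop_succ_of_lt 0 _ hA, if_neg (by simp; omega)]; positivity
    · refine (hle1 _).trans ?_
      have : (1 : ℝ) ≤ (candidates f τ S A).card := by
        exact_mod_cast (by omega : 1 ≤ (candidates f τ S A).card)
      simp; linarith
  | succ r ih =>
    intro S A hS
    by_cases hA : (candidates f τ S A).card < 3 * k
    · rw [ev_loop_succ_of_lt (r + 1) _ hA, if_neg (by simp; omega)]
      have := hpow (r + 1)
      positivity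
    · rw [ev_loop_succ (r + 1) _ hA]
      set A' := candidates f τ S A
      have hSA : Disjoint S A' := disjoint_candidates hτ
      rw [ev_congr_support (Y := fun T => if k ≤ (S ∪ T).card then 0 else
        ev ((thresholdLoop k τ ε m l (r + 1) (S ∪ T) A').law f)
        (fun z => if 3 * k ≤ z.2.card ∧ z.1.card < k then (1 : ℝ) else 0))]
      · have h2 := ev_batchLaw_survivors_le (f := f) hp hf hτ hS (not_lt.1 hA) hSA
          (fun x hx => le_of_mem_candidates hx)
          (h := fun T => if k ≤ (S ∪ T).card then 0 else
            ev ((thresholdLoop k τ ε m l (r + 1) (S ∪ T) A').law f)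
              (fun z => if 3 * k ≤ z.2.card ∧ z.1.card < k then (1 : ℝ) else 0))
          (a := (1 - ε) ^ r) (b := (r + 1) * ρ) (M := 1) (hpow r) (by positivity) zero_le_one
          (fun T => by
            split_ifs
            · exact zero_le_one
            · exact hle1 _)
          (fun T => by
            split_ifs with h
            · have := hpow r
              positivity
            · exact ih _ _ (by omega))
          (fun T hT => by simp [hT])
        refine h2.trans (le_of_eq ?_)
        push_cast; ring
      · intro T hT
        obtain ⟨hTA, hTk, -⟩ := mem_support_batchLaw (by omega) hT
        have hcard := card_union_batch hSA hTA
        by_cases hk' : (S ∪ T).card = k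
        · simp [hk']
        · rw [if_neg hk', if_neg (by omega)]

/-- In every execution, no more than `min r k` iterations take place, since each of them adds an
element. -/
lemma loop_rounds_le (hp : LoopParams k ε ρ m l) (hτ : 0 < τ) : ∀ (r : ℕ) (S A : Finset N),
    S.card < k → ∀ z ∈ ((thresholdLoop k τ ε m l r S A).run f).support,
      z.2.length ≤ 2 * min r (k - S.card) ∧
        ∀ b ∈ z.2, b ≤ Fintype.card N + 1 + (m + 1) * l * 2 := by
  intro r
  induction r with
  | zero =>
    intro S A hS z hz
    rw [thresholdLoop, Alg.run, PMF.mem_support_pure_iff] at hz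
    rw [hz]; simp
  | succ r ih =>
    intro S A hS z hz
    have hAN := Finset.card_le_univ A
    rcases mem_support_loop_succ hz with ⟨_, rfl⟩ | ⟨hA, T, hT, ⟨h, rfl⟩ | ⟨h, w, hw, rfl⟩⟩
    · refine ⟨by simp; omega, fun b hb => ?_⟩
      simp only [List.mem_singleton] at hb; omega
    · refine ⟨by simp; omega, fun b hb => ?_⟩
      simp only [List.mem_cons, List.not_mem_nil, or_false] at hb; omega
    · have hk := hp.k_pos
      obtain ⟨hTA, hTk, hT1⟩ := mem_support_batchLaw (by omega) hT
      have hT1 := hT1 hp.eps_pos.le hk hS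
      have hcard := card_union_batch (disjoint_candidates hτ) hTA
      obtain ⟨h1, h2⟩ := ih _ _ (by omega) w hw
      refine ⟨by simp only [List.length_cons]; omega, fun b hb => ?_⟩
      rw [List.mem_cons, List.mem_cons] at hb
      rcases hb with rfl | rfl | hb
      · omega
      · omega
      · exact h2 b hb

/-- The expected number of queries of the loop. The number of candidates shrinks geometrically in
expectation, so that only the first filtering steps matter. -/
lemma expect_loop_queries_le (hp : LoopParams k ε ρ m l) (hf : IsSubmodular f) (hτ : 0 < τ)
    (hρ : ρ ≤ ε / 2) : ∀ (r : ℕ) (S A : Finset N), S.card < k →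
    expect ((thresholdLoop k τ ε m l r S A).run f) (fun z => (z.2.sum : ℝ≥0∞)) ≤
      ENNReal.ofReal (r * (1 + (m + 1) * l * 2) + A.card +
        2 / ε * (candidates f τ S A).card) := by
  have hk := hp.k_pos
  have hε := hp.eps_pos
  have hε' := hp.eps_le
  intro r
  induction r with
  | zero => intro S A hS; simp [thresholdLoop, Alg.run, expect_pure]
  | succ r ih =>
    intro S A hS
    rw [run_thresholdLoop_succ]
    split_ifs with hA
    · rw [expect_pure]
      have : (([A.card + 1].sum : ℕ) : ℝ≥0∞) = ENNReal.ofReal (A.card + 1) := by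
        rw [ENNReal.ofReal_add (by positivity) (by positivity)]; simp
      rw [this]
      refine ENNReal.ofReal_le_ofReal ?_
      have h1 : (0 : ℝ) ≤ r * (1 + (m + 1) * l * 2) := by positivity
      have h2 : (0 : ℝ) ≤ (m + 1) * l * 2 := by positivity
      have h3 : (0 : ℝ) ≤ 2 / ε * (candidates f τ S A).card := by positivity
      push_cast; linarith
    · set A' := candidates f τ S A with hA'
      have hSA : Disjoint S A' := disjoint_candidates hτ
      rw [expect_bind]
      simp only [expect_map]
      set B : ℝ := A.card + 1 + (m + 1) * l * 2 with hB
      have hB0 : 0 ≤ B := by positivity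
      have h1 : expect (batchLaw f k τ ε m l S A') (fun T => expect (if (S ∪ T).card = k then
            PMF.pure ((S ∪ T, A'), []) else (thresholdLoop k τ ε m l r (S ∪ T) A').run f)
            fun z => ((((A.card + 1) :: ((m + 1) * l * 2) :: z.2).sum : ℕ) : ℝ≥0∞)) ≤
          expect (batchLaw f k τ ε m l S A') fun T => ENNReal.ofReal
            (B + r * (1 + (m + 1) * l * 2) + A'.card +
              if (S ∪ T).card = k then 0 else 2 / ε * (candidates f τ (S ∪ T) A').card) := by
        refine expect_mono_support fun T hT => ?_
        obtain ⟨hTA, hTk, -⟩ := mem_support_batchLaw (by omega) hT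
        have hcard := card_union_batch hSA hTA
        have h2 : ∀ z : (Finset N × Finset N) × List ℕ,
            ((((A.card + 1) :: ((m + 1) * l * 2) :: z.2).sum : ℕ) : ℝ≥0∞) =
              ENNReal.ofReal B + (z.2.sum : ℝ≥0∞) := by
          intro z
          rw [hB, show ((A.card : ℝ) + 1 + (m + 1) * l * 2) =
            ((A.card + 1 + (m + 1) * l * 2 : ℕ) : ℝ) by push_cast; ring, ENNReal.ofReal_natCast]
          simp only [List.sum_cons]; push_cast; ring
        simp only [h2]
        rw [expect_add, expect_const]
        have h3 : (0 : ℝ) ≤ r * (1 + (m + 1) * l * 2) + A'.card := by positivity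
        split_ifs with hk'
        · rw [expect_pure]
          simp only [List.sum_nil, Nat.cast_zero, add_zero]
          exact ENNReal.ofReal_le_ofReal (by linarith)
        · refine (add_le_add_right (ih (S ∪ T) A' (by omega)) _).trans ?_
          rw [← ENNReal.ofReal_add hB0 (by positivity)]
          exact ENNReal.ofReal_le_ofReal (by linarith)
      refine h1.trans ?_
      rw [expect_ofReal _ fun T => by split_ifs <;> positivity]
      refine ENNReal.ofReal_le_ofReal ?_
      rw [ev_add, ev_const]
      have hG : 0 ≤ 2 / ε := by positivity
      have h2 := ev_batchLaw_survivors_le (f := f) hp hf hτ hS (not_lt.1 hA) hSA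
          (fun x hx => le_of_mem_candidates hx)
          (h := fun T => if (S ∪ T).card = k then 0 else
            2 / ε * ((candidates f τ (S ∪ T) A').card : ℝ))
          (a := 2 / ε) (b := 0) (M := 2 / ε * A'.card) hG le_rfl (by positivity)
          (fun T => by
            split_ifs
            · positivity
            · gcongr
              exact candidates_subset)
          (fun T => by
            split_ifs
            · positivity
            · simp)
          (fun T hT => by simp [hT])
      have h3 : 2 / ε * ((1 - ε) * A'.card) + 0 + ρ * (2 / ε * A'.card) + A'.card ≤
          2 / ε * A'.card := by
        have h4 : ρ * (2 / ε * A'.card) ≤ ε / 2 * (2 / ε * A'.card) := by gcongr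
        have h5 : ε / 2 * (2 / ε * A'.card) = A'.card := by field_simp
        have h6 : 2 / ε * ((1 - ε) * A'.card) = 2 / ε * A'.card - 2 * A'.card := by field_simp
        linarith
      push_cast
      linarith

/-- If all singletons have value zero, then `f` vanishes, and the loop with threshold zero ends
after one iteration, since every batch size looks good. This case is separate because the
candidates may then include elements of the solution. -/
lemma loop_of_singletons_zero (hp : LoopParams k ε ρ m l) (hf : IsSubmodular f)
    (h0 : ∀ S, 0 ≤ f S) (h1 : ∀ x, f {x} = 0) (r : ℕ) :
    ∀ z ∈ ((thresholdLoop k 0 ε m l (r + 1) ∅ (Finset.univ : Finset N)).run f).support,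
      z.2.length ≤ 2 ∧ (∀ b ∈ z.2, b ≤ Fintype.card N + 1 + (m + 1) * l * 2) ∧
        z.2.sum ≤ Fintype.card N + 1 + (m + 1) * l * 2 := by
  intro z hz
  rcases mem_support_loop_succ hz with ⟨_, rfl⟩ | ⟨hA, T, hT, h⟩
  · simp
  · have hk := hp.k_pos
    have hcard : (∅ ∪ T : Finset N).card = k := by
      have hne : (candidates f 0 ∅ (Finset.univ : Finset N)).Nonempty := by
        rw [← Finset.card_pos]; omega
      obtain ⟨x, hx⟩ := hne
      have hx' := le_of_mem_candidates hx
      rw [insert_empty_eq, h1] at hx'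
      have hempty : f ∅ = 0 := le_antisymm (by linarith) (h0 ∅)
      have hzero : ∀ S, f S = 0 := by
        intro S
        have := hf.union_sub_le_sum ∅ S
        simp only [insert_empty_eq, h1, hempty, Finset.empty_union, sub_zero,
          Finset.sum_const_zero] at this
        exact le_antisymm this (h0 S)
      rw [batchLaw, PMF.mem_support_bind_iff] at hT
      obtain ⟨i, hi, hT⟩ := hT
      rw [PMF.mem_support_map_iff] at hi
      obtain ⟨X, _, rfl⟩ := hi
      have hl : (l : ℝ) ≠ 0 := by exact_mod_cast hp.l_pos.ne'
      have hlast : pickIndex f 0 ε X = Fin.last m := by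
        rcases (pickIndex_spec f 0 ε X).2 with h | h
        · exfalso
          simp only [isGood, hzero, sub_zero, le_refl, if_true, Finset.sum_const, Finset.card_univ,
            Fintype.card_fin, nsmul_eq_mul, mul_one, div_self hl] at h
          have := hp.eps_pos
          linarith
        · exact h
      have hsize : k ≤ batchSize ε (candidates f 0 ∅ (Finset.univ : Finset N)) m :=
        le_min hp.le_size (by omega)
      rw [hlast, Fin.val_last, Finset.card_empty, Nat.sub_zero, min_eq_right hsize,
        mem_support_unifSize (by omega)] at hT
      rw [Finset.empty_union]; exact hT.2
    rcases h with ⟨_, rfl⟩ | ⟨h, _⟩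
    · simp
    · exact absurd hcard h

/-- For `k = 1` the loop ends after one iteration, either with few candidates or with an element
that passed the filter. -/
lemma loop_one (hp : LoopParams 1 ε ρ m l) (h0 : ∀ S, 0 ≤ f S) (r : ℕ) :
    ∀ z ∈ ((thresholdLoop 1 τ ε m l (r + 1) ∅ (Finset.univ : Finset N)).run f).support,
      (z.1.1 = ∅ ∧ z.1.2.card < 3) ∨ τ ≤ f z.1.1 := by
  intro z hz
  rcases mem_support_loop_succ hz with ⟨h, rfl⟩ | ⟨hA, T, hT, h⟩
  · exact Or.inl ⟨rfl, by simpa using h⟩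
  · obtain ⟨hTA, hTk, hT1⟩ := mem_support_batchLaw (by omega) hT
    have hT1 := hT1 hp.eps_pos.le le_rfl (by simp)
    have hcard : T.card = 1 := by simp at hTk; omega
    rcases h with ⟨_, rfl⟩ | ⟨h, _⟩
    · right
      obtain ⟨x, rfl⟩ := Finset.card_eq_one.1 hcard
      have := le_of_mem_candidates (hTA (Finset.mem_singleton_self x))
      rw [insert_empty_eq] at this
      simp only [Finset.empty_union]
      linarith [h0 ∅]
    · rw [Finset.empty_union] at h
      exact absurd hcard h

end ThresholdLoop

/-! ### One threshold of the main algorithm -/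

section Argmax

variable {N : Type}

lemma argmax_foldl (l : List (Finset N × ℝ)) (p : Finset N × ℝ) :
    let q := l.foldl (fun best z => if best.2 < z.2 then z else best) p
    (q = p ∨ q ∈ l) ∧ p.2 ≤ q.2 ∧ ∀ z ∈ l, z.2 ≤ q.2 := by
  induction l generalizing p with
  | nil => simp
  | cons a l ih =>
    have h := ih (if p.2 < a.2 then a else p)
    simp only [List.foldl_cons] at h ⊢
    obtain ⟨h1, h2, h3⟩ := h
    have h4 : p.2 ≤ (if p.2 < a.2 then a else p).2 ∧ a.2 ≤ (if p.2 < a.2 then a else p).2 := by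
      split_ifs with h5
      · exact ⟨h5.le, le_rfl⟩
      · exact ⟨le_rfl, not_lt.1 h5⟩
    refine ⟨?_, h4.1.trans h2, fun z hz => ?_⟩
    · rcases h1 with h1 | h1
      · rw [h1]
        split_ifs
        · exact Or.inr (by simp)
        · exact Or.inl rfl
      · exact Or.inr (by simp [h1])
    · rcases List.mem_cons.1 hz with rfl | hz
      · exact h4.2.trans h2
      · exact h3 z hz

lemma argmax_mem {l : List (Finset N × ℝ)} (hl : l ≠ []) : argmax l ∈ l := by
  rcases l with _ | ⟨p, l⟩
  · exact absurd rfl hl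
  · rcases (argmax_foldl l p).1 with h | h
    · rw [argmax, h]; simp
    · exact List.mem_cons_of_mem _ h

lemma le_argmax {l : List (Finset N × ℝ)} {p : Finset N × ℝ} (hp : p ∈ l) :
    p.2 ≤ (argmax l).2 := by
  rcases l with _ | ⟨q, l⟩
  · simp at hp
  · have h := argmax_foldl l q
    rcases List.mem_cons.1 hp with rfl | hp
    · exact h.2.1
    · exact h.2.2 p hp

end Argmax

section Branch

variable {N : Type} {f : Finset N → ℝ} {k : ℕ} {τ ε δ : ℝ}

/-- The number of samples of Unconstrained-Max. -/
noncomputable def numSubsets (ε δ : ℝ) : ℕ := ⌈Real.log (1 / δ) / Real.log (1 + 4 / 3 * ε)⌉₊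

/-- The best of the random subsets `R i`. -/
noncomputable def bestSubset (f : Finset N → ℝ) {t : ℕ} (R : Fin t → Finset N) : Finset N :=
  (argmax ((List.finRange t).map fun i => (R i, f (R i)))).1

lemma numSubsets_pos (hε : 0 < ε) (hδ : 0 < δ) (hδ1 : δ < 1) : 0 < numSubsets ε δ := by
  refine Nat.ceil_pos.2 (div_pos (Real.log_pos ?_) (Real.log_pos (by linarith)))
  rw [lt_div_iff₀ hδ]; linarith

lemma bestSubset_spec (f : Finset N → ℝ) {t : ℕ} (R : Fin t → Finset N) (i : Fin t) :
    (∃ j, bestSubset f R = R j) ∧ f (R i) ≤ f (bestSubset f R) := by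
  have hmem := argmax_mem (l := (List.finRange t).map fun i => (R i, f (R i))) (by
    intro h
    have h1 := congrArg List.length h
    have h2 := i.2
    simp only [List.length_map, List.length_finRange, List.length_nil] at h1
    omega)
  have hle := le_argmax (l := (List.finRange t).map fun i => (R i, f (R i)))
    (p := (R i, f (R i))) (List.mem_map.2 ⟨_, List.mem_finRange _, rfl⟩)
  rw [List.mem_map] at hmem
  obtain ⟨j, _, hj⟩ := hmem
  unfold bestSubset
  rw [← hj] at hle ⊢
  exact ⟨⟨j, rfl⟩, hle⟩

/-- Reduction of a set to at most `k` elements. -/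
noncomputable def subsample (k : ℕ) (U : Finset N) : Alg N (Finset N) :=
  if k < U.card then Alg.sample (unifSize U k) Alg.ret else Alg.ret U

lemma mem_support_subsample {U : Finset N} {z : Finset N × List ℕ}
    (hz : z ∈ ((subsample k U).run f).support) : z.1.card ≤ k ∧ z.2 = [] := by
  unfold subsample at hz
  split_ifs at hz with h
  · rw [Alg.run, PMF.mem_support_bind_iff] at hz
    obtain ⟨T, hT, hz⟩ := hz
    rw [Alg.run, PMF.mem_support_pure_iff] at hz
    rw [mem_support_unifSize h.le] at hT
    rw [hz]; exact ⟨hT.2.le, rfl⟩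
  · rw [Alg.run, PMF.mem_support_pure_iff] at hz
    rw [hz]; exact ⟨not_lt.1 h, rfl⟩

lemma mem_support_unconstrainedMax {A : Finset N} {z : Finset N × List ℕ}
    (hz : z ∈ ((unconstrainedMax A ε δ).run f).support) : z.2 = [numSubsets ε δ] := by
  rw [unconstrainedMax, Alg.run, PMF.mem_support_bind_iff] at hz
  obtain ⟨R, _, hz⟩ := hz
  simp only [Alg.run, PMF.pure_map, PMF.mem_support_pure_iff, Fintype.card_fin] at hz
  rw [hz]; rfl

lemma law_unconstrainedMax (A : Finset N) : (unconstrainedMax A ε δ).law f =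
    (indep fun _ : Fin (numSubsets ε δ) => unifSubset A).map (bestSubset f) := by
  rw [unconstrainedMax, Alg.law_sample]
  simp only [Alg.law_query, Alg.law_ret]
  rw [← PMF.bind_pure_comp]
  rfl

variable [DecidableEq N]

lemma orderPrefix_subset {U : Finset N} (σ : Fin U.card ≃ {x // x ∈ U}) (j : ℕ) :
    orderPrefix σ j ⊆ U := by
  intro x hx
  simp only [orderPrefix, Finset.mem_image] at hx
  obtain ⟨i, _, rfl⟩ := hx
  exact (σ i).2

lemma orderPrefix_card {U : Finset N} (σ : Fin U.card ≃ {x // x ∈ U}) :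
    orderPrefix σ U.card = U := by
  refine (orderPrefix_subset σ _).antisymm fun x hx => ?_
  simp only [orderPrefix, Finset.mem_image, Finset.mem_filter]
  exact ⟨σ.symm ⟨x, hx⟩, by simp, by simp⟩

/-- The two candidates that one threshold contributes, for the ordering `σ` of `U'`. -/
noncomputable def branchOutput (f : Finset N → ℝ) (S : Finset N) {U' : Finset N}
    (σ : Fin U'.card ≃ {x // x ∈ U'}) : List (Finset N × ℝ) :=
  [(S, f S),
    argmax ((List.finRange (U'.card + 1)).map fun j => (orderPrefix σ j.1, f (orderPrefix σ j.1)))]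

/-- The last step for one threshold. -/
noncomputable def prefixStep (S U' : Finset N) : Alg N (List (Finset N × ℝ)) :=
  .sample (unifOrder U') fun σ =>
  .query (ι := Option (Fin (U'.card + 1))) inferInstance
    (fun o => o.elim S fun j => orderPrefix σ j.1) fun val =>
  .ret [(S, val none),
    argmax ((List.finRange (U'.card + 1)).map fun j => (orderPrefix σ j.1, val (some j)))]

lemma mem_support_prefixStep {S U' : Finset N} {z : List (Finset N × ℝ) × List ℕ}
    (hz : z ∈ ((prefixStep S U').run f).support) :
    ∃ σ : Fin U'.card ≃ {x // x ∈ U'}, z = (branchOutput f S σ, [U'.card + 2]) := by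
  rw [prefixStep, Alg.run, PMF.mem_support_bind_iff] at hz
  obtain ⟨σ, _, hz⟩ := hz
  refine ⟨σ, ?_⟩
  simp only [Alg.run, PMF.pure_map, PMF.mem_support_pure_iff, Option.elim_none, Option.elim_some,
    Fintype.card_option, Fintype.card_fin] at hz
  exact hz

lemma branchOutput_spec (S : Finset N) {U' : Finset N} (σ : Fin U'.card ≃ {x // x ∈ U'})
    (hS : S.card ≤ k) (hU' : U'.card ≤ k) :
    (∀ p ∈ branchOutput f S σ, p.2 = f p.1 ∧ p.1.card ≤ k) ∧
      f S ≤ (argmax (branchOutput f S σ)).2 ∧ f U' ≤ (argmax (branchOutput f S σ)).2 := by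
  refine ⟨fun p hp => ?_, le_argmax (p := (S, f S)) (by simp [branchOutput]), ?_⟩
  · rw [branchOutput, List.mem_cons, List.mem_singleton] at hp
    rcases hp with rfl | rfl
    · exact ⟨rfl, hS⟩
    · have h := argmax_mem (l := (List.finRange (U'.card + 1)).map fun j =>
        (orderPrefix σ j.1, f (orderPrefix σ j.1))) (by simp [List.finRange_succ])
      rw [List.mem_map] at h
      obtain ⟨j, _, hj⟩ := h
      rw [← hj]
      exact ⟨rfl, (Finset.card_le_card (orderPrefix_subset σ _)).trans hU'⟩
  · refine le_trans ?_ (le_argmax (l := branchOutput f S σ) (List.mem_cons_of_mem _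
      (List.mem_singleton_self _)))
    have h := le_argmax (l := (List.finRange (U'.card + 1)).map fun j =>
      (orderPrefix σ j.1, f (orderPrefix σ j.1))) (p := (U', f U')) (by
        rw [List.mem_map]
        exact ⟨Fin.last _, List.mem_finRange _, by simp [orderPrefix_card]⟩)
    exact h

/-- The part of a branch that follows Threshold-Sampling. -/
noncomputable def afterSampling (k : ℕ) (ε δ : ℝ) (SA : Finset N × Finset N) :
    Alg N (List (Finset N × ℝ)) :=
  (if SA.2.card < 3 * k then unconstrainedMax SA.2 ε δ else Alg.ret ∅).bind fun U =>
    (subsample k U).bind fun U' => prefixStep SA.1 U'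

lemma mem_support_afterSampling {SA : Finset N × Finset N} (hS : SA.1.card ≤ k)
    {z : List (Finset N × ℝ) × List ℕ} (hz : z ∈ ((afterSampling k ε δ SA).run f).support) :
    (∀ p ∈ z.1, p.2 = f p.1 ∧ p.1.card ≤ k) ∧ f SA.1 ≤ (argmax z.1).2 ∧ z.2.length ≤ 2 ∧
      z.2.sum ≤ numSubsets ε δ + k + 2 := by
  rw [afterSampling, Alg.run_bind, PMF.mem_support_bind_iff] at hz
  obtain ⟨u, hu, hz⟩ := hz
  rw [PMF.mem_support_map_iff] at hz
  obtain ⟨v, hv, rfl⟩ := hz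
  rw [Alg.run_bind, PMF.mem_support_bind_iff] at hv
  obtain ⟨w, hw, hv⟩ := hv
  rw [PMF.mem_support_map_iff] at hv
  obtain ⟨y, hy, rfl⟩ := hv
  obtain ⟨hw1, hw2⟩ := mem_support_subsample hw
  obtain ⟨σ, rfl⟩ := mem_support_prefixStep hy
  obtain ⟨h1, h2, _⟩ := branchOutput_spec (f := f) SA.1 σ hS hw1
  have hu2 : u.2 = [numSubsets ε δ] ∨ u.2 = [] := by
    split_ifs at hu with h
    · exact Or.inl (mem_support_unconstrainedMax hu)
    · rw [Alg.run, PMF.mem_support_pure_iff] at hu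
      exact Or.inr (by rw [hu])
  refine ⟨h1, h2, ?_, ?_⟩
  · rcases hu2 with h | h <;> simp [h, hw2]
  · rcases hu2 with h | h <;> simp [h, hw2] <;> omega

/-- The value found by the second phase is at least the value of the solution of the first
phase. -/
lemma expect_afterSampling_ge_self {SA : Finset N × Finset N} (hS : SA.1.card ≤ k) :
    ENNReal.ofReal (f SA.1) ≤
      expect ((afterSampling k ε δ SA).law f) fun L => ENNReal.ofReal (argmax L).2 := by
  rw [← expect_const ((afterSampling k ε δ SA).law f) (ENNReal.ofReal (f SA.1))]
  refine expect_mono_support fun L hL => ENNReal.ofReal_le_ofReal ?_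
  obtain ⟨l, hl⟩ := (Alg.mem_support_law f).1 hL
  exact (mem_support_afterSampling hS hl).2.1

variable [Fintype N]

lemma thresholdBranch_eq : (thresholdBranch k ε δ τ : Alg N _) =
    (thresholdSampling k τ ε δ).bind fun SA => afterSampling k ε δ SA := rfl

/-- After subsampling, a set with fewer than `3 k` elements keeps a third of its value. -/
lemma expect_subsample_ge (hf : IsSubmodular f) (h0 : ∀ S, 0 ≤ f S) {U : Finset N}
    (hU : U.card < 3 * k) :
    ENNReal.ofReal (1 / 3 * f U) ≤
      expect ((subsample k U).law f) fun U' => ENNReal.ofReal (f U') := by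
  unfold subsample
  split_ifs with h
  · rw [Alg.law_sample, expect_bind]
    simp only [Alg.law_ret, expect_pure]
    rw [expect_ofReal _ h0]
    refine ENNReal.ofReal_le_ofReal (le_trans ?_ (hf.ev_unifSize_ge h0 h.le (by omega)))
    refine mul_le_mul_of_nonneg_right ?_ (h0 U)
    have h1 : (0 : ℝ) < U.card := by exact_mod_cast (by omega : 0 < U.card)
    have h2 : (U.card : ℝ) ≤ 3 * k := by exact_mod_cast hU.le
    rw [le_div_iff₀ h1]; linarith
  · rw [Alg.law_ret, expect_pure]
    refine ENNReal.ofReal_le_ofReal ?_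
    linarith [h0 U]

/-- If few candidates are left, the second phase finds a twelfth of the value of any set of
candidates. Together with the solution of the first phase this gives the stated average. -/
lemma expect_afterSampling_ge (hf : IsSubmodular f) (h0 : ∀ S, 0 ≤ f S)
    (hε : 0 < ε) (hδ : 0 < δ) (hδ1 : δ < 1) {SA : Finset N × Finset N} (hS : SA.1.card ≤ k)
    (hA : SA.2.card < 3 * k) {W : Finset N} (hW : W ⊆ SA.2) :
    ENNReal.ofReal ((f SA.1 + f W) / 13) ≤
      expect ((afterSampling k ε δ SA).law f) fun L => ENNReal.ofReal (argmax L).2 := by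
  have hlast : ∀ U', U'.card ≤ k → ENNReal.ofReal (f SA.1 / 13) +
      ENNReal.ofReal (12 / 13) * ENNReal.ofReal (f U') ≤
      expect ((prefixStep SA.1 U').law f) fun L => ENNReal.ofReal (argmax L).2 := by
    intro U' hU'
    rw [← expect_const ((prefixStep SA.1 U').law f) (ENNReal.ofReal (f SA.1 / 13) +
      ENNReal.ofReal (12 / 13) * ENNReal.ofReal (f U'))]
    refine expect_mono_support fun L hL => ?_
    obtain ⟨l, hl⟩ := (Alg.mem_support_law f).1 hL
    obtain ⟨σ, hσ⟩ := mem_support_prefixStep hl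
    rw [Prod.mk.injEq] at hσ
    obtain ⟨_, h2, h3⟩ := branchOutput_spec (f := f) SA.1 σ hS hU'
    rw [hσ.1, ← ENNReal.ofReal_mul (by norm_num), ← ENNReal.ofReal_add
      (by linarith [h0 SA.1]) (by linarith [h0 U'])]
    exact ENNReal.ofReal_le_ofReal (by linarith)
  have hmid : ∀ U, U.card < 3 * k → ENNReal.ofReal (f SA.1 / 13) +
      ENNReal.ofReal (4 / 13) * ENNReal.ofReal (f U) ≤
      expect (((subsample k U).bind fun U' => prefixStep SA.1 U').law f)
        fun L => ENNReal.ofReal (argmax L).2 := by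
    intro U hU
    rw [Alg.law_bind, expect_bind]
    refine le_trans ?_ (expect_mono_support (X := fun U' => ENNReal.ofReal (f SA.1 / 13) +
      ENNReal.ofReal (12 / 13) * ENNReal.ofReal (f U')) fun U' hU' => ?_)
    · rw [expect_add, expect_const, expect_const_mul]
      refine add_le_add_right ?_ _
      refine le_trans (le_of_eq ?_) (mul_le_mul_right (expect_subsample_ge hf h0 hU) _)
      rw [← ENNReal.ofReal_mul (by norm_num), ← ENNReal.ofReal_mul (by norm_num)]
      congr 1; ring
    · obtain ⟨l, hl⟩ := (Alg.mem_support_law f).1 hU'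
      exact hlast U' (mem_support_subsample hl).1
  rw [afterSampling, if_pos hA, Alg.law_bind, expect_bind, law_unconstrainedMax, expect_map]
  set t := numSubsets ε δ with ht
  have ht0 : 0 < t := numSubsets_pos hε hδ hδ1
  refine le_trans ?_ (expect_mono_support (X := fun R : Fin t → Finset N =>
    ENNReal.ofReal (f SA.1 / 13) + ENNReal.ofReal (4 / 13) * ENNReal.ofReal (f (R ⟨0, ht0⟩)))
      fun R hR => ?_)
  · rw [expect_add, expect_const, expect_const_mul,
      expect_indep_apply _ _ (fun R => ENNReal.ofReal (f R)), expect_ofReal _ h0,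
      ← ENNReal.ofReal_mul (by norm_num), ← ENNReal.ofReal_add (by linarith [h0 SA.1])
        (mul_nonneg (by norm_num) (ev_nonneg h0))]
    refine ENNReal.ofReal_le_ofReal ?_
    have := hf.ev_unifSubset_ge h0 hW
    linarith
  · obtain ⟨⟨j, hj⟩, hle⟩ := bestSubset_spec f R ⟨0, ht0⟩
    refine le_trans ?_ (hmid _ ?_)
    · exact add_le_add_right (mul_le_mul_right (ENNReal.ofReal_le_ofReal hle) _) _
    · rw [hj]
      refine lt_of_le_of_lt (Finset.card_le_card ?_) hA
      exact Finset.mem_powerset.1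
        ((PMF.mem_support_uniformOfFinset_iff (Finset.powerset_nonempty _) _).1
          (mem_support_indep _ R hR j))

end Branch

/-! ### The parameters of Threshold-Sampling -/

section Parameters

/-- The number of iterations of Threshold-Sampling on a ground set of size `n`. -/
noncomputable def numIterations (n : ℕ) (ε δ : ℝ) : ℕ := ⌈Real.logb (1 - ε / 3)⁻¹ (2 * n / δ)⌉₊

/-- The index of the largest batch size of Threshold-Sampling. -/
noncomputable def lastSize (k : ℕ) (ε : ℝ) : ℕ := ⌈Real.logb 2 k / (ε / 3)⌉₊

/-- The number of samples per batch size in one iteration of Threshold-Sampling. -/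
noncomputable def numSamples (n k : ℕ) (ε δ : ℝ) : ℕ :=
  16 * ⌈Real.logb 2 (2 / (δ / (2 * numIterations n ε δ * (lastSize k ε + 1)))) / (ε / 3) ^ 2⌉₊

lemma thresholdSampling_eq {N : Type} [Fintype N] [DecidableEq N] (k : ℕ) (τ ε δ : ℝ) :
    (thresholdSampling k τ ε δ : Alg N _) =
      thresholdLoop k τ (ε / 3) (lastSize k ε) (numSamples (Fintype.card N) k ε δ)
        (numIterations (Fintype.card N) ε δ) ∅ Finset.univ := rfl

variable {n k : ℕ} {ε δ : ℝ}

lemma one_sub_pow_le (hε : 0 < ε) (hε' : ε ≤ 1 / 6) (hδ : 0 < δ) (hn : 1 ≤ n) :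
    (1 - ε / 3) ^ numIterations n ε δ ≤ δ / (2 * n) := by
  have hn' : (0 : ℝ) < n := by exact_mod_cast hn
  have hb : 1 < (1 - ε / 3)⁻¹ := (one_lt_inv₀ (by linarith)).2 (by linarith)
  have h1 : Real.logb (1 - ε / 3)⁻¹ (2 * n / δ) ≤ numIterations n ε δ := Nat.le_ceil _
  rw [Real.logb_le_iff_le_rpow hb (by positivity), Real.rpow_natCast, inv_pow] at h1
  have h2 : 0 < (1 - ε / 3) ^ numIterations n ε δ := pow_pos (by linarith) _
  rw [le_inv_comm₀ (by positivity) h2] at h1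
  refine h1.trans (le_of_eq ?_)
  rw [inv_div]

lemma inv_le_numIterations (hε : 0 < ε) (hε' : ε ≤ 1 / 6) (hδ : 0 < δ) (hδ' : δ ≤ 1 / 2)
    (hn : 1 ≤ n) : 1.5 ≤ numIterations n ε δ * ε := by
  have hn' : (1 : ℝ) ≤ n := by exact_mod_cast hn
  have h1 : Real.logb (1 - ε / 3)⁻¹ (2 * n / δ) ≤ numIterations n ε δ := Nat.le_ceil _
  have h2 : Real.log (1 - ε / 3)⁻¹ ≤ 0.36 * ε := by
    rw [Real.log_inv]
    have := Real.one_sub_inv_le_log_of_pos (x := 1 - ε / 3) (by linarith)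
    have h3 : (1 - ε / 3)⁻¹ ≤ 1 + 0.36 * ε := by
      rw [inv_le_iff_one_le_mul₀ (by linarith)]; nlinarith
    linarith
  have h3 : 0 < Real.log (1 - ε / 3)⁻¹ :=
    Real.log_pos ((one_lt_inv₀ (by linarith)).2 (by linarith))
  have h4 : 0.69 ≤ Real.log (2 * n / δ) := by
    have h5 : (2 : ℝ) ≤ 2 * n / δ := by rw [le_div_iff₀ hδ]; nlinarith
    have := Real.log_le_log (by norm_num) h5
    linarith [Real.log_two_gt_d9]
  rw [Real.logb, div_le_iff₀ h3] at h1
  have h5 : (numIterations n ε δ : ℝ) * Real.log (1 - ε / 3)⁻¹ ≤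
      numIterations n ε δ * (0.36 * ε) := by gcongr
  linarith

lemma numIterations_pos (hε : 0 < ε) (hε' : ε ≤ 1 / 6) (hδ : 0 < δ) (hδ' : δ ≤ 1 / 2)
    (hn : 1 ≤ n) : 0 < numIterations n ε δ := by
  have := inv_le_numIterations hε hε' hδ hδ' hn
  by_contra h
  rw [Nat.eq_zero_of_not_pos h] at this
  norm_num at this

/-- `2 ^ x ≤ (1 + ε) ^ (x / ε)` for small `ε`. -/
lemma le_one_add_pow {ε : ℝ} (hε : 0 < ε) (hε' : ε ≤ 1 / 6) {c : ℝ} {m : ℕ} (hk : 1 ≤ k)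
    (hm : c * Real.logb 2 k / ε ≤ m) : (k : ℝ) ^ c ≤ (1 + ε) ^ m := by
  have hk' : (1 : ℝ) ≤ k := by exact_mod_cast hk
  have hl2 : 0 < Real.log 2 := Real.log_pos (by norm_num)
  have h1 : Real.log 2 * ε ≤ Real.log (1 + ε) := by
    have := Real.one_sub_inv_le_log_of_pos (x := 1 + ε) (by linarith)
    refine le_trans ?_ this
    have h2 : (1 + ε)⁻¹ ≤ 1 - 0.7 * ε := by
      rw [inv_le_iff_one_le_mul₀ (by linarith)]; nlinarith
    nlinarith [Real.log_two_lt_d9]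
  rw [← Real.log_le_log_iff (by positivity) (by positivity), Real.log_rpow (by linarith),
    Real.log_pow]
  rw [div_le_iff₀ hε, Real.logb, mul_div_assoc', div_le_iff₀ hl2] at hm
  calc c * Real.log k ≤ m * ε * Real.log 2 := hm
    _ = m * (Real.log 2 * ε) := by ring
    _ ≤ _ := by gcongr

lemma loopParams (hε : 0 < ε) (hε' : ε ≤ 1 / 6) (hδ : 0 < δ) (hδ' : δ ≤ 1 / 2)
    (hk : 1 ≤ k) (hn : 1 ≤ n) :
    LoopParams k (ε / 3) (δ / (2 * numIterations n ε δ)) (lastSize k ε) (numSamples n k ε δ) := by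
  have hr : (0 : ℝ) < numIterations n ε δ := by
    exact_mod_cast numIterations_pos hε hε' hδ hδ' hn
  have hr1 : (1 : ℝ) ≤ numIterations n ε δ := by
    exact_mod_cast numIterations_pos hε hε' hδ hδ' hn
  set δ' := δ / (2 * numIterations n ε δ * (lastSize k ε + 1)) with hδ'_def
  have hm : (0 : ℝ) ≤ lastSize k ε := by positivity
  have hδ'0 : 0 < δ' := by positivity
  have hδ'1 : δ' ≤ 1 := by
    rw [hδ'_def, div_le_one (by positivity)]; nlinarith
  have hlog : 0 < Real.log (2 / δ') := Real.log_pos (by rw [lt_div_iff₀ hδ'0]; linarith)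
  have hlogb : Real.log (2 / δ') ≤ Real.logb 2 (2 / δ') := by
    rw [Real.logb, le_div_iff₀ (Real.log_pos (by norm_num))]
    nlinarith [Real.log_two_lt_d9]
  have hl : 16 * (Real.log (2 / δ') / (ε / 3) ^ 2) ≤ numSamples n k ε δ := by
    unfold numSamples
    push_cast
    gcongr
    refine le_trans ?_ (Nat.le_ceil _)
    gcongr
  refine ⟨hk, by linarith, by linarith, ?_, ?_, ?_⟩
  · have : (0 : ℝ) < numSamples n k ε δ := lt_of_lt_of_le (by positivity) hl
    exact_mod_cast this
  · refine Nat.le_floor ?_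
    have := le_one_add_pow (k := k) (ε := ε / 3) (by linarith) (by linarith) (c := 1)
      (m := lastSize k ε) hk (by rw [one_mul]; exact Nat.le_ceil _)
    simpa using this
  · have h1 : Real.exp (-(ε / 3 * numSamples n k ε δ / 25)) ≤ δ' := by
      rw [← Real.le_log_iff_exp_le hδ'0]
      have h2 : Real.log δ' = Real.log 2 - Real.log (2 / δ') := by
        rw [Real.log_div (by norm_num) hδ'0.ne']; ring
      have h3 : Real.log (2 / δ') ≤ ε / 3 * numSamples n k ε δ / 25 := by
        have h4 : ε / 3 * (16 * (Real.log (2 / δ') / (ε / 3) ^ 2)) ≤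
            ε / 3 * numSamples n k ε δ := by
          gcongr
        have h5 : ε / 3 * (16 * (Real.log (2 / δ') / (ε / 3) ^ 2)) =
            Real.log (2 / δ') * (48 / ε) := by field_simp; norm_num
        have h6 : 25 ≤ 48 / ε := by rw [le_div_iff₀ hε]; linarith
        have h7 : Real.log (2 / δ') * 25 ≤ Real.log (2 / δ') * (48 / ε) := by gcongr
        linarith
      have := Real.log_pos (by norm_num : (1 : ℝ) < 2)
      linarith
    calc _ ≤ ((lastSize k ε : ℝ) + 1) * δ' := by gcongr
      _ = _ := by rw [hδ'_def]; field_simp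

end Parameters

/-! ### The value found by one branch -/

section BranchValue

variable {N : Type} [DecidableEq N] {f : Finset N → ℝ} {k : ℕ} {τ ε δ : ℝ}

/-- If no element outside of `A` has a marginal value above `τ`, then the value of the optimal set
`O` can be recovered from the solution `S` and the part of `O` inside `A`. -/
lemma union_opt_le (hf : IsSubmodular f) (h0 : ∀ S, 0 ≤ f S) (hτ : 0 ≤ τ) {S A O : Finset N}
    (hA : ∀ x ∉ A, f (insert x S) - f S < τ) (hO : O.card ≤ k) :
    f (S ∪ O) ≤ k * τ + f S + f (O ∩ A) := by
  have h1 := hf.union_add_inter_le S (O ∩ A)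
  have h2 := hf.sub_le_sub (W := S) (X := S ∪ (O ∩ A)) (Z := O \ (S ∪ A))
    Finset.subset_union_left (by
      rw [Finset.disjoint_left]
      intro x hx
      simp only [Finset.mem_sdiff, Finset.mem_union, Finset.mem_inter] at hx ⊢
      tauto)
  have h3 : S ∪ O ∩ A ∪ O \ (S ∪ A) = S ∪ O := by
    ext x
    simp only [Finset.mem_sdiff, Finset.mem_union, Finset.mem_inter]
    tauto
  have h4 := hf.union_sub_le_sum S (O \ (S ∪ A))
  have h5 : ∑ x ∈ O \ (S ∪ A), (f (insert x S) - f S) ≤ (O \ (S ∪ A)).card • τ := by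
    refine Finset.sum_le_card_nsmul _ _ _ fun x hx => (hA x ?_).le
    simp only [Finset.mem_sdiff, Finset.mem_union] at hx
    tauto
  have h6 : ((O \ (S ∪ A)).card : ℝ) ≤ k := by
    exact_mod_cast (Finset.card_le_card Finset.sdiff_subset).trans hO
  rw [nsmul_eq_mul] at h5
  have h7 : ((O \ (S ∪ A)).card : ℝ) * τ ≤ k * τ := by gcongr
  rw [h3] at h2
  linarith [h0 (S ∩ (O ∩ A))]

lemma ofReal_ev_le_expect {Ω : Type} [Finite Ω] (P : PMF Ω) (Y : Ω → ℝ) :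
    ENNReal.ofReal (ev P Y) ≤ expect P fun ω => ENNReal.ofReal (Y ω) := by
  have h : ∀ ω, ENNReal.ofReal (Y ω) = ENNReal.ofReal (max (Y ω) 0) := fun ω => by
    rcases le_total (Y ω) 0 with h | h
    · rw [max_eq_right h, ENNReal.ofReal_of_nonpos h, ENNReal.ofReal_zero]
    · rw [max_eq_left h]
  simp only [h]
  rw [expect_ofReal _ fun ω => le_max_right _ _]
  exact ENNReal.ofReal_le_ofReal (ev_mono fun ω => le_max_left _ _)

variable [Fintype N]

/-- The outcome of the first phase bounds the value found by the branch from below by a linear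
combination of `f S`, of `f (S ∪ O)`, and of the indicator of many remaining candidates. The
weights are chosen so that `0.5229 + 13 * 0.0367 = 1`. -/
lemma expect_afterSampling_ge_linear (hf : IsSubmodular f) (h0 : ∀ S, 0 ≤ f S)
    (hε : 0 < ε) (hδ : 0 < δ) (hδ1 : δ < 1) (hτ : 0 ≤ τ) {O : Finset N} (hO : O.card ≤ k)
    {SA : Finset N × Finset N} (hS : SA.1.card ≤ k)
    (hA : ∀ x ∉ SA.2, f (insert x SA.1) - f SA.1 < τ) :
    ENNReal.ofReal (0.5229 * f SA.1 + 0.0367 * f (SA.1 ∪ O) - 0.0367 * (k * τ) -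
      0.0367 * (f O - k * τ) * if 3 * k ≤ SA.2.card then 1 else 0) ≤
      expect ((afterSampling k ε δ SA).law f) fun L => ENNReal.ofReal (argmax L).2 := by
  split_ifs with h
  · refine le_trans (ENNReal.ofReal_le_ofReal ?_) (expect_afterSampling_ge_self hS)
    have := hf.union_add_inter_le SA.1 O
    linarith [h0 SA.1, h0 (SA.1 ∩ O)]
  · have h1 := union_opt_le hf h0 hτ hA hO
    have h2 := expect_afterSampling_ge_self (f := f) (ε := ε) (δ := δ) hS
    have h3 := expect_afterSampling_ge hf h0 hε hδ hδ1 hS (not_le.1 h) (W := O ∩ SA.2)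
      Finset.inter_subset_right
    refine le_trans (ENNReal.ofReal_le_ofReal ?_) ((ENNReal.ofReal_max _ _).le.trans (max_le h2 h3))
    have h4 := le_max_left (f SA.1) ((f SA.1 + f (O ∩ SA.2)) / 13)
    have h5 := le_max_right (f SA.1) ((f SA.1 + f (O ∩ SA.2)) / 13)
    linarith

/-- The numerical estimate behind `expect_thresholdBranch_ge`: `V` is the optimal value, `q` the
value of `k` elements at the threshold, and `X` the expected proportion of the solution that gets
filled. The coefficient of `X` is nonnegative, so that `X = 0` is the worst case. -/
lemma branch_arith {V q X c δ E₁ E₂ E₃ : ℝ} (hV : 0 < V) (hX : 0 ≤ X) (hδ : 0 ≤ δ)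
    (hδ' : δ ≤ 0.0011) (hq1 : 0.2844 * V ≤ q) (hq2 : q ≤ 2 / 7 * V) (hc1 : 0.2658 ≤ c)
    (hc2 : c ≤ 0.27) (h₁ : c * (X * q) - c * (q * (δ / 2)) ≤ E₁) (h₂ : (1 - X / 3) * V ≤ E₂)
    (h₃ : E₃ ≤ X + 1.1 * δ) :
    0.026 * V ≤ 0.5229 * E₁ + 0.0367 * E₂ - 0.0367 * q - 0.0367 * (V - q) * E₃ := by
  have hq : 0 ≤ q := by linarith
  have hXV : 0 ≤ X * V := by positivity
  have hXq : 0.2844 * (X * V) ≤ X * q := by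
    calc 0.2844 * (X * V) = X * (0.2844 * V) := by ring
      _ ≤ X * q := by gcongr
  have hqδ : q * (δ / 2) ≤ 2 / 7 * V * (0.0011 / 2) := by gcongr
  have h4 : c * (q * (δ / 2)) ≤ 0.27 * (2 / 7 * V * (0.0011 / 2)) := by gcongr
  have h5 : 0.2658 * (X * q) ≤ c * (X * q) := by gcongr
  have h6 : (V - q) * E₃ ≤ (V - q) * (X + 0.0013) :=
    mul_le_mul_of_nonneg_left (by linarith) (by linarith)
  have h7 : (V - q) * (X + 0.0013) = X * V - X * q + 0.0013 * (V - q) := by ring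
  have h8 : (1 - X / 3) * V = V - X * V / 3 := by ring
  linarith

/-- The value found by a branch whose threshold is about `2 / 7` of the optimal value divided by
`k`. -/
lemma expect_thresholdBranch_ge (hf : IsSubmodular f) (h0 : ∀ S, 0 ≤ f S) (hk : 1 ≤ k)
    (hε : 0 < ε) (hε' : ε ≤ 0.0044) (hδ : 0 < δ) (hδ' : δ ≤ 0.0011) {O : Finset N}
    (hO : O.card ≤ k) (hn : k ≤ Fintype.card N) (hpos : 0 < f O)
    (hτ1 : 0.2844 * f O ≤ k * τ) (hτ2 : k * τ ≤ 2 / 7 * f O) :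
    ENNReal.ofReal (0.026 * f O) ≤
      expect ((thresholdBranch k ε δ τ : Alg N _).law f) fun L => ENNReal.ofReal (argmax L).2 := by
  have hk' : (0 : ℝ) < k := by exact_mod_cast hk
  have hτ : 0 < τ := by
    by_contra h
    have : (k : ℝ) * τ ≤ 0 := mul_nonpos_of_nonneg_of_nonpos hk'.le (not_lt.1 h)
    linarith
  have hp := loopParams (n := Fintype.card N) hε (by linarith) hδ (by linarith) hk (hk.trans hn)
  set r := numIterations (Fintype.card N) ε δ with hr_def
  have hr : 0 < r := numIterations_pos hε (by linarith) hδ (by linarith) (hk.trans hn)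
  have hr' : (0 : ℝ) < r := by exact_mod_cast hr
  rw [thresholdBranch_eq, Alg.law_bind, expect_bind, thresholdSampling_eq]
  rw [← hr_def]
  set m := lastSize k ε
  set l := numSamples (Fintype.card N) k ε δ
  set L := thresholdLoop k τ (ε / 3) m l r ∅ (Finset.univ : Finset N) with hL
  refine le_trans ?_ (expect_mono_support (X := fun SA => ENNReal.ofReal (0.5229 * f SA.1 +
    0.0367 * f (SA.1 ∪ O) - 0.0367 * (k * τ) -
      0.0367 * (f O - k * τ) * if 3 * k ≤ SA.2.card then 1 else 0)) fun SA hSA => ?_)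
  swap
  · obtain ⟨w, hw⟩ := (Alg.mem_support_law f).1 hSA
    have h1 := loop_card_le r ∅ Finset.univ (by simp) _ hw
    have h2 := loop_marginal_lt hf hτ r ∅ Finset.univ (by simp) _ hw
    exact expect_afterSampling_ge_linear hf h0 hε hδ (by linarith) hτ.le hO h1 h2
  refine le_trans (ENNReal.ofReal_le_ofReal ?_) (ofReal_ev_le_expect _ _)
  rw [ev_sub, ev_sub, ev_add, ev_const_mul, ev_const_mul, ev_const, ev_const_mul]
  -- `x` is the expected size of the solution
  set x := ev (L.law f) (fun z => (z.1.card : ℝ)) with hx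
  have hx0 : 0 ≤ x := ev_nonneg fun z => by positivity
  have hvalue : 4 / 15 * (1 - 2 * (ε / 3)) * τ * x - 4 / 15 * (1 - 2 * (ε / 3)) * τ * k * (δ / 2) ≤
      ev (L.law f) fun z => f z.1 := by
    have h1 := ev_loop_value_ge hp hf h0 hτ r ∅ Finset.univ (by simp; omega)
    have h2 : 0 ≤ weight k (∅ : Finset N).card * f ∅ :=
      mul_nonneg (by linarith [two_thirds_le_weight (∅ : Finset N).card hk]) (h0 ∅)
    rw [← hL, ← hx] at h1
    have h3 : (r : ℝ) * (δ / (2 * r) * (4 / 15 * (1 - 2 * (ε / 3)) * τ * k)) =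
        4 / 15 * (1 - 2 * (ε / 3)) * τ * k * (δ / 2) := by field_simp
    simp only [Finset.card_empty, Nat.cast_zero, sub_zero] at h1 h2
    linarith
  have hunion : (1 - x / (3 * k)) * f O ≤ ev (L.law f) fun z => f (z.1 ∪ O) := by
    have h1 := (hf.comp_union O).ev_ge (fun _ => h0 _) (L.law f) (fun z => z.1)
      (p := x / (3 * k)) (by positivity) fun y => by
        have := ev_loop_mem_le (f := f) (ε := ε / 3) (m := m) (l := l) hk hτ y r ∅ Finset.univ
          (by simp; omega)
        simpa using this
    simp only [Finset.union_comm O, Finset.empty_union] at h1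
    exact h1
  have hmany : ev (L.law f) (fun z => if 3 * k ≤ z.2.card then 1 else 0) ≤
      x / k + 1.1 * δ := by
    have h1 : ev (L.law f) (fun z => if 3 * k ≤ z.2.card then (1 : ℝ) else 0) ≤
        ev (L.law f) (fun z => (z.1.card : ℝ) * (k : ℝ)⁻¹ +
          if 3 * k ≤ z.2.card ∧ z.1.card < k then 1 else 0) := by
      refine ev_mono fun z => ?_
      by_cases h2 : 3 * k ≤ z.2.card
      · by_cases h3 : z.1.card < k
        · have : 0 ≤ (z.1.card : ℝ) * (k : ℝ)⁻¹ := by positivity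
          simp only [h2, h3, and_self, if_true]; linarith
        · have h4 : (k : ℝ) ≤ z.1.card := by exact_mod_cast not_lt.1 h3
          simp only [h2, h3, and_false, if_true, if_false, add_zero]
          rw [← div_eq_mul_inv, le_div_iff₀ hk']; linarith
      · simp only [h2, false_and, if_false, add_zero]; positivity
    rw [ev_add, ev_mul_const, ← hx] at h1
    obtain ⟨r', hr'_eq⟩ : ∃ r', r = r' + 1 := ⟨r - 1, by omega⟩
    have h2 := ev_loop_fail_le hp hf hτ r' ∅ (Finset.univ : Finset N) (by simp; omega)
    rw [← hr'_eq, ← hL] at h2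
    have h3 : ((candidates f τ ∅ (Finset.univ : Finset N)).card : ℝ) ≤ Fintype.card N := by
      exact_mod_cast Finset.card_le_univ _
    have h4 := one_sub_pow_le (n := Fintype.card N) (ε := ε) (δ := δ) hε (by linarith) hδ
      (hk.trans hn)
    rw [← hr_def, hr'_eq, pow_succ] at h4
    have hn0 : (0 : ℝ) < Fintype.card N := by exact_mod_cast hk.trans hn
    rw [le_div_iff₀ (by positivity)] at h4
    have h5 : 0 ≤ (1 - ε / 3) ^ r' := pow_nonneg (by linarith) _
    have h6 : (1 - ε / 3) ^ r' * (candidates f τ ∅ (Finset.univ : Finset N)).card ≤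
        (1 - ε / 3) ^ r' * Fintype.card N := by gcongr
    have h7 : ((r' : ℝ) + 1) * (δ / (2 * r)) = δ / 2 := by
      rw [hr'_eq]; push_cast; field_simp
    rw [h7] at h2
    have h8 : 0 ≤ (1 - ε / 3) ^ r' * (Fintype.card N : ℝ) := by positivity
    have h9 : 0.99 * ((1 - ε / 3) ^ r' * (Fintype.card N : ℝ)) ≤
        (1 - ε / 3) * ((1 - ε / 3) ^ r' * Fintype.card N) :=
      mul_le_mul_of_nonneg_right (by linarith) h8
    rw [div_eq_mul_inv]
    linarith
  have hx' : x = x / k * k := by field_simp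
  set X := x / k with hX
  have hX0 : 0 ≤ X := by positivity
  set V := f O
  -- `q` is the sum of the values at the threshold of `k` elements
  set q := (k : ℝ) * τ with hq
  have h1 : 4 / 15 * (1 - 2 * (ε / 3)) * τ * x = 4 / 15 * (1 - 2 * (ε / 3)) * (X * q) := by
    rw [hx', hq]; ring
  have h2 : 4 / 15 * (1 - 2 * (ε / 3)) * τ * k * (δ / 2) =
      4 / 15 * (1 - 2 * (ε / 3)) * (q * (δ / 2)) := by rw [hq]; ring
  have h3 : x / (3 * k) = X / 3 := by rw [hX]; field_simp
  rw [h1, h2] at hvalue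
  rw [h3] at hunion
  exact branch_arith hpos hX0 hδ.le hδ' hτ1 hτ2 (by linarith) (by linarith) hvalue hunion hmany

/-- For `k = 1` every outcome of the first phase is good. -/
lemma expect_thresholdBranch_one_ge (hf : IsSubmodular f) (h0 : ∀ S, 0 ≤ f S)
    (hε : 0 < ε) (hε' : ε ≤ 1 / 6) (hδ : 0 < δ) (hδ' : δ ≤ 1 / 2) {O : Finset N}
    (hO : O.card ≤ 1) (hn : 1 ≤ Fintype.card N) (hτ : 0 < τ) (hτO : τ = 1 / 7 * f O) :
    ENNReal.ofReal (0.026 * f O) ≤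
      expect ((thresholdBranch 1 ε δ τ : Alg N _).law f) fun L => ENNReal.ofReal (argmax L).2 := by
  have hp := loopParams (n := Fintype.card N) (k := 1) hε hε' hδ hδ' le_rfl hn
  rw [thresholdBranch_eq, Alg.law_bind, expect_bind, thresholdSampling_eq]
  obtain ⟨r, hr⟩ : ∃ r, numIterations (Fintype.card N) ε δ = r + 1 :=
    ⟨_, (Nat.succ_pred_eq_of_pos (numIterations_pos hε hε' hδ hδ' hn)).symm⟩
  rw [← expect_const (Alg.law f (thresholdLoop 1 τ (ε / 3) (lastSize 1 ε)
    (numSamples (Fintype.card N) 1 ε δ) (numIterations (Fintype.card N) ε δ) ∅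
      (Finset.univ : Finset N))) (ENNReal.ofReal (0.026 * f O))]
  refine expect_mono_support fun SA hSA => ?_
  obtain ⟨w, hw⟩ := (Alg.mem_support_law f).1 hSA
  have h1 := loop_card_le _ ∅ Finset.univ (by simp) _ hw
  have h2 := loop_marginal_lt hf hτ _ ∅ Finset.univ (by simp) _ hw
  have hO0 := h0 O
  rw [hr] at hw
  rcases loop_one hp h0 r _ hw with ⟨h3, h4⟩ | h3
  · refine le_trans (ENNReal.ofReal_le_ofReal ?_) (expect_afterSampling_ge hf h0 hε hδ
      (by linarith) h1 h4 (W := O ∩ SA.2) Finset.inter_subset_right)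
    have h5 := union_opt_le hf h0 hτ.le h2 hO
    rw [h3, Finset.empty_union] at h5
    simp only at h3
    rw [h3]
    push_cast at h5
    linarith
  · refine le_trans (ENNReal.ofReal_le_ofReal ?_) (expect_afterSampling_ge_self h1)
    simp only at h3
    linarith

end BranchValue

/-! ### Bounds on the parameters of the main algorithm -/

section Bounds

/-- The index of the largest threshold of the main algorithm. -/
noncomputable def lastThreshold (k : ℕ) (ε : ℝ) : ℕ := ⌈2 * Real.logb 2 k / (ε / 6)⌉₊

/-- The failure probability of each branch. -/
noncomputable def branchDelta (k : ℕ) (ε δ : ℝ) : ℝ := δ / (2 * (lastThreshold k ε + 1))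

variable {n k : ℕ} {ε δ : ℝ}

lemma logb_two_le (k : ℕ) : Real.logb 2 k ≤ 1.5 * Real.log k := by
  have h1 : 0 ≤ Real.log k := Real.log_natCast_nonneg k
  rw [Real.logb, div_le_iff₀ (Real.log_pos (by norm_num))]
  nlinarith [Real.log_two_gt_d9]

lemma logb_two_nonneg (hk : 1 ≤ k) : 0 ≤ Real.logb 2 k :=
  Real.logb_nonneg (by norm_num) (by exact_mod_cast hk)

lemma lastThreshold_le (hk : 1 ≤ k) (hε : 0 < ε) :
    (lastThreshold k ε : ℝ) + 1 ≤ 18 * Real.log k / ε + 2 := by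
  have h0 := logb_two_nonneg hk
  have h1 := Nat.ceil_lt_add_one (a := 2 * Real.logb 2 k / (ε / 6)) (by positivity)
  have h2 : 2 * Real.logb 2 k / (ε / 6) ≤ 18 * Real.log k / ε := by
    have : 2 * Real.logb 2 k / (ε / 6) = 12 * Real.logb 2 k / ε := by field_simp; ring
    rw [this, div_le_div_iff_of_pos_right hε]
    linarith [logb_two_le k]
  unfold lastThreshold
  linarith

lemma branchDelta_pos (hδ : 0 < δ) : 0 < branchDelta k ε δ := by
  unfold branchDelta; positivity

lemma branchDelta_le (hδ1 : δ < 1) : branchDelta k ε δ ≤ 1 / 2 := by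
  unfold branchDelta
  have : (0 : ℝ) ≤ lastThreshold k ε := by positivity
  rw [div_le_iff₀ (by positivity)]
  linarith

lemma log_inv_branchDelta (hδ : 0 < δ) :
    Real.log (1 / branchDelta k ε δ) =
      Real.log (2 * (lastThreshold k ε + 1)) + Real.log (1 / δ) := by
  have : (0 : ℝ) < 2 * (lastThreshold k ε + 1) := by positivity
  rw [← Real.log_mul this.ne' (by positivity)]
  congr 1
  unfold branchDelta
  field_simp

lemma numIterations_le {ε δ : ℝ} (hε : 0 < ε) (hε' : ε ≤ 1 / 6) (hδ : 0 < δ) (hδ1 : δ ≤ 1 / 2)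
    (hn : 1 ≤ n) :
    (numIterations n ε δ : ℝ) ≤ 3 / ε * Real.log (2 * n / δ) + 1 := by
  have hn' : (1 : ℝ) ≤ n := by exact_mod_cast hn
  have h1 : (1 : ℝ) ≤ 2 * n / δ := by rw [le_div_iff₀ hδ]; linarith
  have h0 := Real.log_nonneg h1
  have h2 : ε / 3 ≤ Real.log (1 - ε / 3)⁻¹ := by
    rw [Real.log_inv]
    have := Real.log_le_sub_one_of_pos (x := 1 - ε / 3) (by linarith)
    linarith
  have h3 : Real.logb (1 - ε / 3)⁻¹ (2 * n / δ) ≤ 3 / ε * Real.log (2 * n / δ) := by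
    rw [Real.logb]
    calc _ ≤ Real.log (2 * n / δ) / (ε / 3) := by gcongr
      _ = _ := by field_simp
  have h4 : 0 ≤ Real.logb (1 - ε / 3)⁻¹ (2 * n / δ) :=
    div_nonneg h0 (by linarith)
  have := Nat.ceil_lt_add_one h4
  unfold numIterations
  linarith

/-- A quantity that bounds all the parameters of the algorithm up to constants and powers. -/
noncomputable def scale (n : ℕ) (ε δ : ℝ) : ℝ :=
  (1 + Real.log n) * ((1 + Real.log (1 / δ)) / ε)

/-- The number of iterations of a branch of the main algorithm. -/
noncomputable def branchIterations (n k : ℕ) (ε δ : ℝ) : ℕ :=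
  numIterations n (ε / 6) (branchDelta k ε δ)

/-- The number of samples per iteration of a branch of the main algorithm. -/
noncomputable def branchSamples (n k : ℕ) (ε δ : ℝ) : ℕ :=
  (lastSize k (ε / 6) + 1) * numSamples n k (ε / 6) (branchDelta k ε δ) * 2

lemma log_inv_nonneg (hδ : 0 < δ) (hδ1 : δ < 1) : 0 ≤ Real.log (1 / δ) :=
  Real.log_nonneg (by rw [le_div_iff₀ hδ]; linarith)

lemma one_le_scale (hε : 0 < ε) (hε1 : ε < 1) (hδ : 0 < δ) (hδ1 : δ < 1) :
    1 / ε ≤ scale n ε δ ∧ 1 + Real.log n ≤ scale n ε δ ∧ 1 + Real.log (1 / δ) ≤ scale n ε δ ∧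
      (1 + Real.log n) / ε ≤ scale n ε δ := by
  have h1 := Real.log_natCast_nonneg n
  have h2 := log_inv_nonneg hδ hδ1
  have h3 : 1 ≤ 1 / ε := by rw [le_div_iff₀ hε]; linarith
  have h4 : scale n ε δ = (1 + Real.log n) * (1 + Real.log (1 / δ)) * (1 / ε) := by
    unfold scale; ring
  have h5 : 1 ≤ (1 + Real.log n) * (1 + Real.log (1 / δ)) :=
    one_le_mul_of_one_le_of_one_le (by linarith) (by linarith)
  rw [h4]
  refine ⟨?_, ?_, ?_, ?_⟩
  · exact le_mul_of_one_le_left (by positivity) h5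
  · rw [mul_assoc]
    exact le_mul_of_one_le_right (by linarith)
      (one_le_mul_of_one_le_of_one_le (by linarith) h3)
  · rw [mul_comm (1 + Real.log n), mul_assoc]
    exact le_mul_of_one_le_right (by linarith)
      (one_le_mul_of_one_le_of_one_le (by linarith) h3)
  · rw [div_eq_mul_one_div]
    gcongr
    exact le_mul_of_one_le_right (by linarith) (by linarith)

/-- The number of estimation queries and of random subsets is polynomial in `scale`. -/
lemma overhead_le (hk : 1 ≤ k) (hkn : k ≤ n) (hε : 0 < ε) (hε1 : ε < 1) (hδ : 0 < δ)
    (hδ1 : δ < 1) :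
    (lastThreshold k ε + 1 : ℝ) ≤ 20 * scale n ε δ ∧
    (lastThreshold k ε + 1 : ℝ) * (branchIterations n k ε δ * (1 + branchSamples n k ε δ) +
      numSubsets (ε / 6) (branchDelta k ε δ)) ≤ 10 ^ 14 * scale n ε δ ^ 8 := by
  obtain ⟨hD1, hD2, hD3, hD4⟩ := one_le_scale (n := n) hε hε1 hδ hδ1
  set D := scale n ε δ with hD
  have hn : 1 ≤ n := hk.trans hkn
  have hk' : (0 : ℝ) < k := by exact_mod_cast hk
  have hkn' : (k : ℝ) ≤ n := by exact_mod_cast hkn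
  have hn' : (1 : ℝ) ≤ n := by exact_mod_cast hn
  have hlogkn : Real.log k ≤ Real.log n := Real.log_le_log hk' hkn'
  have hlogn := Real.log_natCast_nonneg n
  have hL := log_inv_nonneg hδ hδ1
  have hD0 : 1 ≤ D := by linarith
  have hpow : ∀ {a b : ℕ}, a ≤ b → D ^ a ≤ D ^ b := fun h => pow_le_pow_right₀ hD0 h
  have hlogk : Real.log k / ε ≤ D - 1 / ε := by
    have : Real.log k / ε ≤ Real.log n / ε := by gcongr
    rw [add_div] at hD4
    linarith
  have hε_inv : 1 ≤ 1 / ε := by rw [le_div_iff₀ hε]; linarith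
  -- the number of branches
  have hR : (lastThreshold k ε + 1 : ℝ) ≤ 20 * D := by
    have := lastThreshold_le hk hε
    rw [mul_div_assoc] at this
    linarith
  refine ⟨hR, ?_⟩
  set δ₁ := branchDelta k ε δ
  have hδ₁ : 0 < δ₁ := branchDelta_pos hδ
  have hδ₁' : δ₁ ≤ 1 / 2 := branchDelta_le hδ1
  have hlogδ₁ : Real.log (1 / δ₁) ≤ 41 * D := by
    rw [log_inv_branchDelta hδ]
    have := Real.log_le_self (x := 2 * (lastThreshold k ε + 1)) (by positivity)
    linarith
  have hlogδ₁0 : 0 ≤ Real.log (1 / δ₁) := log_inv_nonneg hδ₁ (by linarith)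
  have hl2 := Real.log_two_lt_d9
  have hl2' := Real.log_two_gt_d9
  -- the number of iterations
  have hr : (branchIterations n k ε δ : ℝ) ≤ 757 * D ^ 2 := by
    have h1 := numIterations_le (n := n) (ε := ε / 6) (by linarith) (by linarith) hδ₁ hδ₁' hn
    have h2 : Real.log (2 * n / δ₁) ≤ 42 * D := by
      rw [show 2 * (n : ℝ) / δ₁ = 2 * (n * (1 / δ₁)) by ring, Real.log_mul (by norm_num)
        (by positivity), Real.log_mul (by positivity) (by positivity)]
      linarith
    have h3 : 3 / (ε / 6) * Real.log (2 * n / δ₁) ≤ 18 * D * (42 * D) := by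
      have : 0 ≤ Real.log (2 * n / δ₁) :=
        Real.log_nonneg (by rw [le_div_iff₀ hδ₁]; linarith)
      rw [show 3 / (ε / 6) = 18 * (1 / ε) by field_simp; norm_num]
      gcongr
    have h4 : 1 ≤ D ^ 2 := one_le_pow₀ hD0
    unfold branchIterations
    linarith
  have hr1 : (1 : ℝ) ≤ numIterations n (ε / 6) δ₁ := by
    exact_mod_cast numIterations_pos (by linarith) (by linarith) hδ₁ hδ₁' hn
  -- the number of batch sizes
  have hm : (lastSize k (ε / 6) : ℝ) + 1 ≤ 29 * D := by
    have h0 := logb_two_nonneg hk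
    have h1 := Nat.ceil_lt_add_one (a := Real.logb 2 k / (ε / 6 / 3)) (by positivity)
    have h2 : Real.logb 2 k / (ε / 6 / 3) ≤ 27 * (Real.log k / ε) := by
      rw [show Real.logb 2 k / (ε / 6 / 3) = 18 * Real.logb 2 k / ε by field_simp; ring,
        mul_div_assoc', div_le_div_iff_of_pos_right hε]
      linarith [logb_two_le k]
    unfold lastSize
    linarith
  -- the number of samples per batch size
  have hl : (numSamples n k (ε / 6) δ₁ : ℝ) ≤ 25000000 * D ^ 4 := by
    have hm0 : (0 : ℝ) < lastSize k (ε / 6) + 1 := by positivity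
    have h1 : 2 / (δ₁ / (2 * numIterations n (ε / 6) δ₁ * (lastSize k (ε / 6) + 1))) =
        (4 * numIterations n (ε / 6) δ₁) * (lastSize k (ε / 6) + 1) * (1 / δ₁) := by
      field_simp; ring
    set x := 2 / (δ₁ / (2 * numIterations n (ε / 6) δ₁ * (lastSize k (ε / 6) + 1))) with hx
    have h2 : Real.log x ≤ 3100 * D ^ 2 := by
      rw [h1, Real.log_mul (by positivity) (by positivity),
        Real.log_mul (by positivity) (by positivity)]
      have h3 := Real.log_le_self (x := 4 * numIterations n (ε / 6) δ₁) (by positivity)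
      have h4 := Real.log_le_self hm0.le
      have h5 : (numIterations n (ε / 6) δ₁ : ℝ) ≤ 757 * D ^ 2 := hr
      have h6 : D ≤ D ^ 2 := by simpa using hpow (by norm_num : 1 ≤ 2)
      linarith
    have hx1 : 1 ≤ x := by
      rw [h1]
      refine one_le_mul_of_one_le_of_one_le (one_le_mul_of_one_le_of_one_le (by linarith) ?_) ?_
      · have : (0 : ℝ) ≤ lastSize k (ε / 6) := by positivity
        linarith
      · rw [le_div_iff₀ hδ₁]; linarith
    have h3 : Real.logb 2 x ≤ 4650 * D ^ 2 := by
      rw [Real.logb, div_le_iff₀ (by linarith)]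
      have : 0 ≤ D ^ 2 := by positivity
      nlinarith
    have h4 : 0 ≤ Real.logb 2 x := Real.logb_nonneg (by norm_num) hx1
    have h5 : Real.logb 2 x / (ε / 6 / 3) ^ 2 ≤ 4650 * 324 * D ^ 4 := by
      calc _ = Real.logb 2 x * (324 * (1 / ε) ^ 2) := by field_simp; ring
        _ ≤ 4650 * D ^ 2 * (324 * D ^ 2) := by gcongr
        _ = _ := by ring
    have h6 := Nat.ceil_lt_add_one (a := Real.logb 2 x / (ε / 6 / 3) ^ 2) (by positivity)
    have h7 : 1 ≤ D ^ 4 := one_le_pow₀ hD0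
    unfold numSamples
    rw [← hx]
    push_cast
    linarith
  -- the number of random subsets
  have ht : (numSubsets (ε / 6) δ₁ : ℝ) ≤ 229 * D ^ 2 := by
    have h1 : 0.18 * ε ≤ Real.log (1 + 4 / 3 * (ε / 6)) := by
      have := Real.one_sub_inv_le_log_of_pos (x := 1 + 4 / 3 * (ε / 6)) (by linarith)
      refine le_trans ?_ this
      have h2 : (1 + 4 / 3 * (ε / 6))⁻¹ ≤ 1 - 0.18 * ε := by
        rw [inv_le_iff_one_le_mul₀ (by linarith)]; nlinarith
      linarith
    have h2 : Real.log (1 / δ₁) / Real.log (1 + 4 / 3 * (ε / 6)) ≤ 41 / 0.18 * D ^ 2 := by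
      calc _ ≤ Real.log (1 / δ₁) / (0.18 * ε) := by gcongr
        _ = Real.log (1 / δ₁) * ((1 / ε) / 0.18) := by field_simp
        _ ≤ 41 * D * (D / 0.18) := by gcongr
        _ = _ := by ring
    have h3 := Nat.ceil_lt_add_one (a := Real.log (1 / δ₁) / Real.log (1 + 4 / 3 * (ε / 6)))
      (div_nonneg hlogδ₁0 (by linarith))
    have h4 : 1 ≤ D ^ 2 := one_le_pow₀ hD0
    unfold numSubsets
    linarith
  have hs : (branchSamples n k ε δ : ℝ) ≤ 29 * D * (25000000 * D ^ 4) * 2 := by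
    unfold branchSamples
    push_cast
    gcongr
  calc _ ≤ 20 * D * (757 * D ^ 2 * (1 + 29 * D * (25000000 * D ^ 4) * 2) + 229 * D ^ 2) := by
        gcongr
    _ = 21953000000000 * D ^ 8 + 19720 * D ^ 3 := by ring
    _ ≤ 10 ^ 14 * D ^ 8 := by
        have h1 := hpow (by norm_num : 3 ≤ 8)
        have h2 : 0 ≤ D ^ 8 := by positivity
        linarith

/-- The bound on the number of rounds. If `1 / ε ≥ n` it comes from the fact that there are at most
`k` iterations. -/
lemma rounds_le (hk : 1 ≤ k) (hkn : k ≤ n) (hε : 0 < ε) (hε1 : ε < 1) (hδ : 0 < δ)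
    (hδ1 : δ < 1) :
    ((2 * min (branchIterations n k ε δ) k + 3 : ℕ) : ℝ) ≤
      1000 * Real.log ((n + 1) / δ) / ε := by
  have hn : 1 ≤ n := hk.trans hkn
  have hk' : (1 : ℝ) ≤ k := by exact_mod_cast hk
  have hkn' : (k : ℝ) ≤ n := by exact_mod_cast hkn
  have hn' : (1 : ℝ) ≤ n := by exact_mod_cast hn
  have hl2 := Real.log_two_gt_d9
  set Z := Real.log ((n + 1) / δ) with hZ
  have hZ2 : Real.log 2 ≤ Z := by
    refine Real.log_le_log (by norm_num) ?_
    rw [le_div_iff₀ hδ]; linarith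
  rw [le_div_iff₀ hε]
  have hmin1 : (min (branchIterations n k ε δ) k : ℕ) ≤ k := min_le_right _ _
  have hmin2 : (min (branchIterations n k ε δ) k : ℕ) ≤ branchIterations n k ε δ := min_le_left _ _
  rcases le_or_gt (n * ε) 1 with h | h
  · have h1 : ((2 * min (branchIterations n k ε δ) k + 3 : ℕ) : ℝ) ≤ 5 * n := by
      exact_mod_cast (by omega : 2 * min (branchIterations n k ε δ) k + 3 ≤ 5 * n)
    calc _ ≤ 5 * n * ε := by gcongr
      _ ≤ _ := by linarith
  · have hε_inv : 1 / ε ≤ n := by rw [div_le_iff₀ hε]; linarith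
    have hδ₁ := branchDelta_pos (k := k) (ε := ε) hδ
    have h1 := numIterations_le (n := n) (ε := ε / 6) (by linarith) (by linarith) hδ₁
      (branchDelta_le hδ1) hn
    have hlogk : Real.log k ≤ n := by
      have := Real.log_le_self (x := k) (by linarith)
      linarith
    have hR : (lastThreshold k ε + 1 : ℝ) ≤ 20 * (n * n) := by
      have h2 := lastThreshold_le hk hε
      have h3 : 18 * Real.log k / ε ≤ 18 * n * n := by
        rw [div_eq_mul_one_div]
        gcongr
      nlinarith
    have h2 : Real.log (2 * n / branchDelta k ε δ) ≤ 10 * Z := by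
      have h3 : 2 * n / branchDelta k ε δ ≤ 2 ^ 7 * (((n + 1) / δ) ^ 3) := by
        have h4 : 2 * n / branchDelta k ε δ = 4 * n * (lastThreshold k ε + 1) * (1 / δ) := by
          unfold branchDelta; field_simp; norm_num
        have h5 : (1 : ℝ) ≤ 1 / δ := by rw [le_div_iff₀ hδ]; linarith
        rw [h4]
        calc _ ≤ 4 * n * (20 * (n * n)) * (1 / δ) := by gcongr
          _ = 80 * (n : ℝ) ^ 3 * (1 / δ) := by ring
          _ ≤ 2 ^ 7 * (n + 1 : ℝ) ^ 3 * (1 / δ) ^ 3 := by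
            gcongr
            · norm_num
            · linarith
            · exact le_self_pow₀ h5 (by norm_num)
          _ = _ := by ring
      have h6 := Real.log_le_log (by positivity) h3
      rw [Real.log_mul (by norm_num) (by positivity), Real.log_pow, Real.log_pow, ← hZ] at h6
      push_cast at h6
      linarith
    have h3 : 3 / (ε / 6) * Real.log (2 * n / branchDelta k ε δ) * ε ≤ 180 * Z := by
      rw [show 3 / (ε / 6) * Real.log (2 * n / branchDelta k ε δ) * ε =
        18 * Real.log (2 * n / branchDelta k ε δ) by field_simp; ring]
      linarith
    have h4 : ((2 * min (branchIterations n k ε δ) k + 3 : ℕ) : ℝ) ≤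
        2 * branchIterations n k ε δ + 3 := by
      exact_mod_cast (by omega : 2 * min (branchIterations n k ε δ) k + 3 ≤
        2 * branchIterations n k ε δ + 3)
    calc _ ≤ (2 * (branchIterations n k ε δ : ℝ) + 3) * ε := by gcongr
      _ ≤ (2 * (3 / (ε / 6) * Real.log (2 * n / branchDelta k ε δ) + 1) + 3) * ε := by
        gcongr
        exact h1
      _ = 2 * (3 / (ε / 6) * Real.log (2 * n / branchDelta k ε δ) * ε) + 5 * ε := by ring
      _ ≤ _ := by linarith

/-- The bound on the size of a round. -/
lemma batch_le (hk : 1 ≤ k) (hkn : k ≤ n) (hε : 0 < ε) (hε1 : ε < 1) (hδ : 0 < δ)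
    (hδ1 : δ < 1) {b : ℕ} (hb : b ≤ n + 1 ∨ b ≤ (lastThreshold k ε + 1) *
      (n + 1 + branchSamples n k ε δ + (numSubsets (ε / 6) (branchDelta k ε δ) + k + 2))) :
    (b : ℝ) ≤ (1000 * n * (1 + Real.log (1 / δ)) / ε) ^ 1000 := by
  have hn : 1 ≤ n := hk.trans hkn
  have hn' : (1 : ℝ) ≤ n := by exact_mod_cast hn
  have hkn' : (k : ℝ) ≤ n := by exact_mod_cast hkn
  have hL := log_inv_nonneg hδ hδ1
  obtain ⟨hR, hT⟩ := overhead_le hk hkn hε hε1 hδ hδ1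
  set D := scale n ε δ with hD
  have hD0 : 1 ≤ D := by
    have := (one_le_scale (n := n) hε hε1 hδ hδ1).1
    have h2 : 1 ≤ 1 / ε := by rw [le_div_iff₀ hε]; linarith
    linarith
  have hw : 1 ≤ (1 + Real.log (1 / δ)) / ε := by rw [le_div_iff₀ hε]; linarith
  set B := n * ((1 + Real.log (1 / δ)) / ε) with hB
  have hnB : (n : ℝ) ≤ B := le_mul_of_one_le_right (by linarith) hw
  have hDB : D ≤ B := by
    rw [hD, hB, scale]
    gcongr
    have := Real.log_le_sub_one_of_pos (x := n) (by linarith)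
    linarith
  have hB1 : 1 ≤ B := by linarith
  have hr : (1 : ℝ) ≤ branchIterations n k ε δ := by
    exact_mod_cast numIterations_pos (by linarith) (by linarith) (branchDelta_pos hδ)
      (branchDelta_le hδ1) hn
  have hbB : (b : ℝ) ≤ 10 ^ 15 * B ^ 8 := by
    have hB8 : B ^ 2 ≤ B ^ 8 := pow_le_pow_right₀ hB1 (by norm_num)
    have hB1' : B ≤ B ^ 2 := by nlinarith
    rcases hb with hb | hb
    · have : (b : ℝ) ≤ n + 1 := by exact_mod_cast hb
      linarith
    · have h1 : (b : ℝ) ≤ (lastThreshold k ε + 1) * (n + 1 + branchSamples n k ε δ +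
          (numSubsets (ε / 6) (branchDelta k ε δ) + k + 2)) := by exact_mod_cast hb
      have h2 : (branchSamples n k ε δ : ℝ) ≤
          branchIterations n k ε δ * (1 + branchSamples n k ε δ) := by
        have : (0 : ℝ) ≤ branchSamples n k ε δ := by positivity
        nlinarith
      calc (b : ℝ) ≤ _ := h1
        _ ≤ (lastThreshold k ε + 1) * ((branchIterations n k ε δ * (1 + branchSamples n k ε δ) +
            numSubsets (ε / 6) (branchDelta k ε δ)) + 5 * n) := by
          refine mul_le_mul_of_nonneg_left ?_ (by positivity)
          linarith
        _ = (lastThreshold k ε + 1) * (branchIterations n k ε δ * (1 + branchSamples n k ε δ) +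
            numSubsets (ε / 6) (branchDelta k ε δ)) + (lastThreshold k ε + 1) * (5 * n) := by ring
        _ ≤ 10 ^ 14 * D ^ 8 + 20 * D * (5 * n) := by gcongr
        _ ≤ 10 ^ 14 * B ^ 8 + 20 * B * (5 * B) := by gcongr
        _ ≤ _ := by nlinarith
  calc (b : ℝ) ≤ 10 ^ 15 * B ^ 8 := hbB
    _ ≤ 1000 ^ 8 * B ^ 8 := by gcongr; norm_num
    _ = (1000 * B) ^ 8 := by ring
    _ ≤ (1000 * B) ^ 1000 := pow_le_pow_right₀ (by linarith) (by norm_num)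
    _ = _ := by rw [hB]; congr 1; ring

/-- For large `n` the polylogarithmic overhead is at most `n`. -/
lemma scale_pow_le (hn : 1 ≤ n) (hε : 0 < ε) (hε1 : ε < 1) (hδ : 0 < δ) (hδ1 : δ < 1)
    (h : (1000 * (1 + Real.log (1 / δ)) / ε) ^ 1000 ≤ (n : ℝ)) :
    10 ^ 14 * scale n ε δ ^ 8 ≤ n := by
  have hn' : (1 : ℝ) ≤ n := by exact_mod_cast hn
  have hL := log_inv_nonneg hδ hδ1
  have hw : 1 ≤ (1 + Real.log (1 / δ)) / ε := by rw [le_div_iff₀ hε]; linarith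
  rw [mul_div_assoc] at h
  set w := (1 + Real.log (1 / δ)) / ε with hw_def
  have h1 : (1000 * w) ^ 16 ≤ (n : ℝ) :=
    (pow_le_pow_right₀ (by linarith) (by norm_num)).trans h
  -- the sixteenth root of `n`
  set y := (n : ℝ) ^ (1 / 16 : ℝ) with hy
  have hy0 : 0 < y := by positivity
  have hy16 : y ^ 16 = n := by
    rw [hy, ← Real.rpow_natCast, ← Real.rpow_mul (by linarith)]; norm_num
  have h2 : 1 + Real.log n ≤ 16 * y := by
    have h3 := Real.log_le_sub_one_of_pos hy0
    have h4 : Real.log n = 16 * Real.log y := by rw [← hy16, Real.log_pow]; norm_num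
    linarith
  have h3 : 1000 * w ≤ y := by
    rw [← hy16] at h1
    exact le_of_pow_le_pow_left₀ (by norm_num) hy0.le h1
  have hlogn := Real.log_natCast_nonneg n
  calc 10 ^ 14 * scale n ε δ ^ 8 = 10 ^ 14 * ((1 + Real.log n) ^ 8 * w ^ 8) := by
        rw [scale, mul_pow]
    _ ≤ 10 ^ 14 * ((16 * y) ^ 8 * (y / 1000) ^ 8) := by
        have : w ≤ y / 1000 := by linarith
        gcongr
    _ = 10 ^ 14 * 16 ^ 8 / 1000 ^ 8 * y ^ 16 := by ring
    _ ≤ 1 * y ^ 16 := by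
        gcongr
        norm_num
    _ = n := by rw [one_mul, hy16]

/-- The bound on the expected number of queries. -/
lemma queries_le (hk : 1 ≤ k) (hkn : k ≤ n) (hε : 0 < ε) (hε1 : ε < 1) (hδ : 0 < δ)
    (hδ1 : δ < 1) (h : (1000 * (1 + Real.log (1 / δ)) / ε) ^ 1000 ≤ (n : ℝ)) :
    (n + 1 : ℝ) + (lastThreshold k ε + 1) *
      (branchIterations n k ε δ * (1 + branchSamples n k ε δ) + n + 2 / (ε / 6 / 3) * n +
        (numSubsets (ε / 6) (branchDelta k ε δ) + k + 2)) ≤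
      1000 * n * Real.log (k + 1) / ε ^ 2 := by
  have hn : 1 ≤ n := hk.trans hkn
  have hn' : (1 : ℝ) ≤ n := by exact_mod_cast hn
  have hk' : (1 : ℝ) ≤ k := by exact_mod_cast hk
  have hkn' : (k : ℝ) ≤ n := by exact_mod_cast hkn
  obtain ⟨_, hT⟩ := overhead_le hk hkn hε hε1 hδ hδ1
  have hS := scale_pow_le hn hε hε1 hδ hδ1 h
  have hl2 := Real.log_two_gt_d9
  have hl : Real.log 2 ≤ Real.log (k + 1) := Real.log_le_log (by norm_num) (by linarith)
  have hlk : Real.log k ≤ Real.log (k + 1) := Real.log_le_log (by linarith) (by linarith)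
  set M := Real.log (k + 1)
  have hε_inv : 1 ≤ 1 / ε := by rw [le_div_iff₀ hε]; linarith
  have hR : (lastThreshold k ε + 1 : ℝ) ≤ 21 * M * (1 / ε) := by
    have h1 := lastThreshold_le hk hε
    have h2 : 18 * Real.log k / ε ≤ 18 * M * (1 / ε) := by
      rw [div_eq_mul_one_div]
      gcongr
    have h3 : M ≤ M * (1 / ε) := le_mul_of_one_le_right (by linarith) hε_inv
    linarith
  have h1 : (n : ℝ) + 2 / (ε / 6 / 3) * n + (k + 2) ≤ 40 * n * (1 / ε) := by
    rw [show 2 / (ε / 6 / 3) = 36 * (1 / ε) by field_simp; norm_num]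
    have : (n : ℝ) ≤ n * (1 / ε) := le_mul_of_one_le_right (by linarith) hε_inv
    linarith
  have h2 : (n : ℝ) ≤ 2 * n * M * (1 / ε) ^ 2 := by
    have h3 : (1 : ℝ) ≤ (1 / ε) ^ 2 := one_le_pow₀ hε_inv
    have h4 : (n : ℝ) ≤ 2 * n * M := by nlinarith
    exact h4.trans (le_mul_of_one_le_right (by nlinarith) h3)
  calc _ = (n + 1 : ℝ) + (lastThreshold k ε + 1) * (branchIterations n k ε δ *
        (1 + branchSamples n k ε δ) + numSubsets (ε / 6) (branchDelta k ε δ)) +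
        (lastThreshold k ε + 1) * (n + 2 / (ε / 6 / 3) * n + (k + 2)) := by ring
    _ ≤ (n + n : ℝ) + n + (21 * M * (1 / ε)) * (40 * n * (1 / ε)) := by
        have : 0 ≤ 21 * M * (1 / ε) := by
          have : 0 ≤ M := by linarith
          positivity
        gcongr
        exact hT.trans hS
    _ = 3 * n + 840 * (n * M * (1 / ε) ^ 2) := by ring
    _ ≤ 1000 * (n * M * (1 / ε) ^ 2) := by
        have : 0 ≤ (n : ℝ) * M * (1 / ε) ^ 2 := by
          have : 0 ≤ M := by linarith
          positivity
        linarith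
    _ = _ := by field_simp

end Bounds

/-! ### The cost of one threshold -/

section BranchCost

variable {N : Type} [Fintype N] [DecidableEq N] {f : Finset N → ℝ} {k : ℕ} {τ ε δ : ℝ}

lemma thresholdBranch_support (hf : IsSubmodular f) (h0 : ∀ S, 0 ≤ f S) (hk : 1 ≤ k)
    (hn : 1 ≤ Fintype.card N) (hε : 0 < ε) (hε' : ε ≤ 1 / 6) (hδ : 0 < δ) (hδ' : δ ≤ 1 / 2)
    (hτ : 0 < τ ∨ τ = 0 ∧ ∀ x, f {x} = 0) {z : List (Finset N × ℝ) × List ℕ}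
    (hz : z ∈ ((thresholdBranch k ε δ τ : Alg N _).run f).support) :
    (∀ p ∈ z.1, p.2 = f p.1 ∧ p.1.card ≤ k) ∧
      z.2.length ≤ 2 * min (numIterations (Fintype.card N) ε δ) k + 2 ∧
      ∀ b ∈ z.2, b ≤ Fintype.card N + 1 +
        (lastSize k ε + 1) * numSamples (Fintype.card N) k ε δ * 2 +
          (numSubsets ε δ + k + 2) := by
  have hp := loopParams (n := Fintype.card N) hε hε' hδ hδ' hk hn
  have hr := numIterations_pos hε hε' hδ hδ' hn
  rw [thresholdBranch_eq, Alg.run_bind, PMF.mem_support_bind_iff] at hz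
  obtain ⟨u, hu, hz⟩ := hz
  rw [PMF.mem_support_map_iff] at hz
  obtain ⟨w, hw, rfl⟩ := hz
  rw [thresholdSampling_eq] at hu
  obtain ⟨h1, -, h2, h3⟩ := mem_support_afterSampling (loop_card_le _ _ _ (by simp) u hu) hw
  have hloop : u.2.length ≤ 2 * min (numIterations (Fintype.card N) ε δ) k ∧
      ∀ b ∈ u.2, b ≤ Fintype.card N + 1 +
        (lastSize k ε + 1) * numSamples (Fintype.card N) k ε δ * 2 := by
    rcases hτ with hτ | ⟨rfl, hf1⟩
    · simpa using loop_rounds_le hp hτ _ ∅ Finset.univ (by rw [Finset.card_empty]; omega) u hu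
    · obtain ⟨r, hr'⟩ : ∃ r, numIterations (Fintype.card N) ε δ = r + 1 :=
        ⟨_, (Nat.succ_pred_eq_of_pos hr).symm⟩
      rw [hr'] at hu
      obtain ⟨h4, h5, -⟩ := loop_of_singletons_zero hp hf h0 hf1 r u hu
      exact ⟨by omega, h5⟩
  refine ⟨h1, ?_, fun b hb => ?_⟩
  · rw [List.length_append]; omega
  · rcases List.mem_append.1 hb with hb | hb
    · exact (hloop.2 b hb).trans (Nat.le_add_right _ _)
    · exact ((List.le_sum_of_mem hb).trans h3).trans (Nat.le_add_left _ _)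

lemma expect_thresholdBranch_queries_le (hf : IsSubmodular f) (h0 : ∀ S, 0 ≤ f S) (hk : 1 ≤ k)
    (hn : 1 ≤ Fintype.card N) (hε : 0 < ε) (hε' : ε ≤ 1 / 6) (hδ : 0 < δ) (hδ' : δ ≤ 1 / 2)
    (hτ : 0 < τ ∨ τ = 0 ∧ ∀ x, f {x} = 0) :
    expect ((thresholdBranch k ε δ τ : Alg N _).run f) (fun z => (z.2.sum : ℝ≥0∞)) ≤
      ENNReal.ofReal (numIterations (Fintype.card N) ε δ *
        (1 + (lastSize k ε + 1) * numSamples (Fintype.card N) k ε δ * 2) + Fintype.card N +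
          2 / (ε / 3) * Fintype.card N + (numSubsets ε δ + k + 2)) := by
  have hp := loopParams (n := Fintype.card N) hε hε' hδ hδ' hk hn
  have hr := numIterations_pos hε hε' hδ hδ' hn
  set n := Fintype.card N with hn_def
  set r := numIterations n ε δ with hr_def
  set s : ℝ := (lastSize k ε + 1) * numSamples n k ε δ * 2 with hs
  have hs0 : 0 ≤ s := by positivity
  have hr1 : (1 : ℝ) ≤ r := by exact_mod_cast hr
  have hn' : (0 : ℝ) ≤ n := by positivity
  -- the first phase
  have hloop : expect ((thresholdLoop k τ (ε / 3) (lastSize k ε) (numSamples n k ε δ) r ∅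
      (Finset.univ : Finset N)).run f) (fun z => (z.2.sum : ℝ≥0∞)) ≤
        ENNReal.ofReal (r * (1 + s) + n + 2 / (ε / 3) * n) := by
    rcases hτ with hτ | ⟨rfl, hf1⟩
    · refine (expect_loop_queries_le hp hf hτ ?_ r ∅ Finset.univ
        (by rw [Finset.card_empty]; omega)).trans (ENNReal.ofReal_le_ofReal ?_)
      · have h1 := inv_le_numIterations hε hε' hδ hδ' hn
        rw [div_le_iff₀ (by positivity)]
        linarith
      · have h1 : ((candidates f τ ∅ (Finset.univ : Finset N)).card : ℝ) ≤ n := by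
          exact_mod_cast Finset.card_le_univ _
        rw [Finset.card_univ, ← hn_def, ← hs]
        gcongr
    · obtain ⟨r', hr'⟩ : ∃ r', r = r' + 1 := ⟨_, (Nat.succ_pred_eq_of_pos hr).symm⟩
      rw [← expect_const ((thresholdLoop k 0 (ε / 3) (lastSize k ε) (numSamples n k ε δ) r ∅
        (Finset.univ : Finset N)).run f) (ENNReal.ofReal _)]
      refine expect_mono_support fun z hz => ?_
      rw [hr'] at hz
      have h1 := (loop_of_singletons_zero hp hf h0 hf1 r' z hz).2.2
      have h2 : (z.2.sum : ℝ) ≤ n + 1 + s := by rw [hs]; exact_mod_cast h1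
      rw [← ENNReal.ofReal_natCast]
      refine ENNReal.ofReal_le_ofReal (h2.trans ?_)
      have h3 : 1 + s ≤ r * (1 + s) := le_mul_of_one_le_left (by linarith) hr1
      have h4 : 0 ≤ 2 / (ε / 3) * n := by positivity
      linarith
  -- the second phase
  rw [thresholdBranch_eq, Alg.run_bind, expect_bind, thresholdSampling_eq, ← hn_def, ← hr_def]
  simp only [expect_map]
  calc _ ≤ expect ((thresholdLoop k τ (ε / 3) (lastSize k ε) (numSamples n k ε δ) r ∅
        (Finset.univ : Finset N)).run f) (fun z => (z.2.sum : ℝ≥0∞) +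
          ((numSubsets ε δ + k + 2 : ℕ) : ℝ≥0∞)) := by
        refine expect_mono_support fun u hu => ?_
        refine (expect_mono_support fun w hw => ?_).trans (expect_const _ _).le
        have h1 := (mem_support_afterSampling (loop_card_le _ _ _ (by simp) u hu) hw).2.2.2
        rw [List.sum_append]
        exact_mod_cast Nat.add_le_add_left h1 _
    _ ≤ ENNReal.ofReal (r * (1 + s) + n + 2 / (ε / 3) * n) +
          ENNReal.ofReal (numSubsets ε δ + k + 2) := by
        rw [expect_add, expect_const]
        refine add_le_add hloop (le_of_eq ?_)
        rw [← ENNReal.ofReal_natCast]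
        push_cast
        rfl
    _ = _ := by
        rw [← ENNReal.ofReal_add (by positivity) (by positivity)]

end BranchCost

/-! ### The main algorithm -/

section Main

variable {N : Type} {f : Finset N → ℝ} {k : ℕ} {ε δ : ℝ}

/-- The output of the main algorithm, from the outputs of the branches. -/
noncomputable def bestCandidate (f : Finset N → ℝ) (L : List (List (Finset N × ℝ))) : Finset N :=
  (argmax ((∅, f ∅) :: L.flatten)).1

lemma bestCandidate_spec (h0 : ∀ S, 0 ≤ f S) {L : List (List (Finset N × ℝ))}
    (hL : ∀ l ∈ L, ∀ p ∈ l, p.2 = f p.1 ∧ p.1.card ≤ k) :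
    (bestCandidate f L).card ≤ k ∧ f ∅ ≤ f (bestCandidate f L) ∧
      ∀ l ∈ L, (argmax l).2 ≤ f (bestCandidate f L) := by
  have hall : ∀ p ∈ (∅, f ∅) :: L.flatten, p.2 = f p.1 ∧ p.1.card ≤ k := by
    intro p hp
    rcases List.mem_cons.1 hp with rfl | hp
    · simp
    · obtain ⟨l, hl, hpl⟩ := List.mem_flatten.1 hp
      exact hL l hl p hpl
  obtain ⟨h1, h2⟩ := hall _ (argmax_mem (List.cons_ne_nil _ _))
  refine ⟨h2, ?_, fun l hl => ?_⟩
  · rw [bestCandidate, ← h1]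
    exact le_argmax (p := (∅, f ∅)) (by simp)
  · rcases eq_or_ne l [] with rfl | hne
    · exact h0 _
    rw [bestCandidate, ← h1]
    exact le_argmax (List.mem_cons_of_mem _ (List.mem_flatten.2 ⟨l, hl, argmax_mem hne⟩))

/-- The thresholds of the main algorithm. -/
noncomputable def threshold (f : Finset N → ℝ) (k : ℕ) (ε : ℝ) (i : ℕ) : ℝ :=
  1 / 7 * (1 + ε / 6) ^ i * (⨆ x : N, f {x}) / k

lemma le_maxSingleton [Finite N] (f : Finset N → ℝ) (x : N) : f {x} ≤ ⨆ x : N, f {x} :=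
  le_ciSup (f := fun x : N => f {x}) (Set.finite_range _).bddAbove x

/-- If the thresholds are not positive, then all singletons have value zero. -/
lemma threshold_pos_or_zero [Finite N] (h0 : ∀ S, 0 ≤ f S) (hk : 1 ≤ k) (hε : 0 < ε) (i : ℕ) :
    0 < threshold f k ε i ∨ threshold f k ε i = 0 ∧ ∀ x, f {x} = 0 := by
  have hk' : (0 : ℝ) < k := by exact_mod_cast hk
  have hΔ : 0 ≤ ⨆ x : N, f {x} := Real.iSup_nonneg fun x => h0 {x}
  rcases hΔ.eq_or_lt with h | h
  · refine Or.inr ⟨by rw [threshold, ← h]; simp, fun x => ?_⟩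
    have := le_maxSingleton f x
    exact le_antisymm (by linarith) (h0 {x})
  · exact Or.inl (by unfold threshold; positivity)

/-- Some threshold is within a factor `1 + ε / 6` of `2 / 7` of the optimal value divided
by `k`. -/
lemma exists_threshold (hk : 2 ≤ k) (hε : 0 < ε) (hε1 : ε < 1) {V : ℝ}
    (hΔ : 0 < ⨆ x : N, f {x}) (hV : ⨆ x : N, f {x} ≤ V) (hV' : V ≤ k * ⨆ x : N, f {x}) :
    ∃ i ≤ lastThreshold k ε, 2 / 7 * V / (1 + ε / 6) ≤ k * threshold f k ε i ∧
      k * threshold f k ε i ≤ 2 / 7 * V := by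
  set Δ := ⨆ x : N, f {x} with hΔ_def
  have hk' : (2 : ℝ) ≤ k := by exact_mod_cast hk
  have hV0 : 0 < V := hΔ.trans_le hV
  obtain ⟨i, hi1, hi2⟩ := exists_nat_pow_near (x := 2 * V / Δ) (y := 1 + ε / 6)
    (by rw [le_div_iff₀ hΔ]; linarith) (by linarith)
  have hτ : k * threshold f k ε i = 1 / 7 * (1 + ε / 6) ^ i * Δ := by
    rw [threshold, ← hΔ_def]; field_simp
  rw [le_div_iff₀ hΔ] at hi1
  rw [div_lt_iff₀ hΔ, pow_succ] at hi2
  refine ⟨i, ?_, ?_, ?_⟩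
  · have h1 := le_one_add_pow (k := k) (ε := ε / 6) (by linarith) (by linarith) (c := 2)
      (m := lastThreshold k ε) (by omega) (Nat.le_ceil _)
    rw [Real.rpow_two] at h1
    refine (pow_le_pow_iff_right₀ (a := 1 + ε / 6) (by linarith)).1 (le_trans ?_ h1)
    refine le_of_mul_le_mul_right (hi1.trans ?_) hΔ
    nlinarith
  · rw [hτ, div_le_iff₀ (by linarith)]
    linarith
  · rw [hτ]
    linarith

/-- For `k ≥ 2` and small `ε` there are so many branches that each of them has a small failure
probability. -/
lemma branchDelta_le_of_two_le (hk : 2 ≤ k) (hε : 0 < ε) (hε' : ε ≤ 0.026)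
    (hδ1 : δ < 1) : branchDelta k ε δ ≤ 0.0011 := by
  have h1 : 1 ≤ Real.logb 2 k := by
    rw [Real.le_logb_iff_rpow_le (by norm_num) (by positivity), Real.rpow_one]
    exact_mod_cast hk
  have h2 : 2 * Real.logb 2 k / (ε / 6) ≤ lastThreshold k ε := Nat.le_ceil _
  rw [div_le_iff₀ (by linarith)] at h2
  have h3 : (461 : ℝ) ≤ lastThreshold k ε := by
    by_contra h
    have h4 : (lastThreshold k ε : ℝ) * (ε / 6) ≤ 461 * (0.026 / 6) := by gcongr; linarith
    linarith
  unfold branchDelta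
  rw [div_le_iff₀ (by linarith)]
  linarith

variable [Fintype N] [DecidableEq N]

/-- The branches that the main algorithm runs in parallel. -/
noncomputable def branches (f : Finset N → ℝ) (k : ℕ) (ε δ : ℝ) :
    List (Alg N (List (Finset N × ℝ))) :=
  (List.range (lastThreshold k ε + 1)).map fun i =>
    thresholdBranch k (ε / 6) (branchDelta k ε δ) (threshold f k ε i)

lemma run_adaptiveNonmonotoneMax : (adaptiveNonmonotoneMax k ε δ).run f =
    ((Alg.parAll (branches f k ε δ)).run f).map fun z =>
      (bestCandidate f z.1, (Fintype.card N + 1) :: z.2) := by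
  rw [adaptiveNonmonotoneMax, Alg.run, Alg.run_bind]
  simp only [Alg.run, PMF.pure_map, List.append_nil, Fintype.card_option]
  rw [← PMF.bind_pure_comp, PMF.bind_bind]
  simp only [PMF.pure_bind, Function.comp_def, ← PMF.bind_pure_comp]
  rfl

/-- The value of a nonempty set is at most the sum of the values of its elements. -/
lemma IsSubmodular.le_card_mul (hf : IsSubmodular f) (h0 : ∀ S, 0 ≤ f S) {O : Finset N}
    (hO : O.Nonempty) : f O ≤ O.card * ⨆ x : N, f {x} := by
  induction hO using Finset.Nonempty.cons_induction with
  | singleton x => simpa using le_maxSingleton f x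
  | cons x O hx _ ih =>
    have h1 := hf ∅ O (Finset.empty_subset _) x hx
    have h2 := h0 ∅
    have h3 := le_maxSingleton f x
    rw [insert_empty_eq] at h1
    rw [Finset.cons_eq_insert, Finset.card_insert_of_notMem hx]
    push_cast
    linarith

lemma branches_support (hf : IsSubmodular f) (h0 : ∀ S, 0 ≤ f S) (hk : 1 ≤ k)
    (hkn : k ≤ Fintype.card N) (hε : 0 < ε) (hε1 : ε < 1) (hδ : 0 < δ) (hδ1 : δ < 1) :
    ∀ A ∈ branches f k ε δ, ∀ z ∈ (A.run f).support,
      (∀ p ∈ z.1, p.2 = f p.1 ∧ p.1.card ≤ k) ∧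
      z.2.length ≤ 2 * min (branchIterations (Fintype.card N) k ε δ) k + 2 ∧
      ∀ b ∈ z.2, b ≤ Fintype.card N + 1 + branchSamples (Fintype.card N) k ε δ +
        (numSubsets (ε / 6) (branchDelta k ε δ) + k + 2) := by
  intro A hA z hz
  obtain ⟨i, -, rfl⟩ := List.mem_map.1 hA
  exact thresholdBranch_support hf h0 hk (hk.trans hkn) (by linarith) (by linarith)
    (branchDelta_pos hδ) (branchDelta_le hδ1) (threshold_pos_or_zero h0 hk hε i) hz

lemma parAll_branches_outputs (hf : IsSubmodular f) (h0 : ∀ S, 0 ≤ f S) (hk : 1 ≤ k)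
    (hkn : k ≤ Fintype.card N) (hε : 0 < ε) (hε1 : ε < 1) (hδ : 0 < δ) (hδ1 : δ < 1) :
    ∀ L ∈ ((Alg.parAll (branches f k ε δ)).law f).support,
      ∀ l ∈ L, ∀ p ∈ l, p.2 = f p.1 ∧ p.1.card ≤ k :=
  Alg.parAll_outputs f _ fun A hA a ha => by
    obtain ⟨w, hw⟩ := (Alg.mem_support_law f).1 ha
    exact (branches_support hf h0 hk hkn hε hε1 hδ hδ1 A hA _ hw).1

lemma length_branches : (branches f k ε δ).length = lastThreshold k ε + 1 := by
  simp [branches]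

lemma main_support (hf : IsSubmodular f) (h0 : ∀ S, 0 ≤ f S) (hk : 1 ≤ k)
    (hkn : k ≤ Fintype.card N) (hε : 0 < ε) (hε1 : ε < 1) (hδ : 0 < δ) (hδ1 : δ < 1)
    {z : Finset N × List ℕ} (hz : z ∈ ((adaptiveNonmonotoneMax k ε δ).run f).support) :
    z.1.card ≤ k ∧ f ∅ ≤ f z.1 ∧
      z.2.length ≤ 2 * min (branchIterations (Fintype.card N) k ε δ) k + 3 ∧
      ∀ b ∈ z.2, b ≤ Fintype.card N + 1 ∨ b ≤ (lastThreshold k ε + 1) *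
        (Fintype.card N + 1 + branchSamples (Fintype.card N) k ε δ +
          (numSubsets (ε / 6) (branchDelta k ε δ) + k + 2)) := by
  rw [run_adaptiveNonmonotoneMax, PMF.mem_support_map_iff] at hz
  obtain ⟨w, hw, rfl⟩ := hz
  have h1 := bestCandidate_spec h0 (parAll_branches_outputs hf h0 hk hkn hε hε1 hδ hδ1 w.1
    ((Alg.mem_support_law f).2 ⟨w.2, hw⟩))
  obtain ⟨h2, h3⟩ := Alg.parAll_support f _ (fun A hA z hz =>
    (branches_support hf h0 hk hkn hε hε1 hδ hδ1 A hA z hz).2) w hw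
  rw [length_branches] at h3
  refine ⟨h1.1, h1.2.1, by simp only [List.length_cons]; omega, fun b hb => ?_⟩
  rcases List.mem_cons.1 hb with rfl | hb
  · exact Or.inl le_rfl
  · exact Or.inr (h3 b hb)

lemma expect_main_queries_le (hf : IsSubmodular f) (h0 : ∀ S, 0 ≤ f S) (hk : 1 ≤ k)
    (hkn : k ≤ Fintype.card N) (hε : 0 < ε) (hε1 : ε < 1) (hδ : 0 < δ) (hδ1 : δ < 1) :
    expect ((adaptiveNonmonotoneMax k ε δ).run f) (fun z => (z.2.sum : ℝ≥0∞)) ≤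
      ENNReal.ofReal ((Fintype.card N + 1 : ℝ) + (lastThreshold k ε + 1) *
        (branchIterations (Fintype.card N) k ε δ * (1 + branchSamples (Fintype.card N) k ε δ) +
          Fintype.card N + 2 / (ε / 6 / 3) * Fintype.card N +
          (numSubsets (ε / 6) (branchDelta k ε δ) + k + 2))) := by
  rw [run_adaptiveNonmonotoneMax, expect_map]
  simp only [List.sum_cons, Nat.cast_add]
  rw [expect_add, expect_const, ENNReal.ofReal_add (by positivity) (by positivity),
    ENNReal.ofReal_mul (by positivity)]
  refine add_le_add (le_of_eq ?_) ((Alg.expect_parAll_sum_le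
    (Q := ENNReal.ofReal (branchIterations (Fintype.card N) k ε δ *
      (1 + branchSamples (Fintype.card N) k ε δ) + Fintype.card N +
        2 / (ε / 6 / 3) * Fintype.card N + (numSubsets (ε / 6) (branchDelta k ε δ) + k + 2)))
    f _ fun A hA => ?_).trans (le_of_eq ?_))
  · rw [← Nat.cast_add, ← ENNReal.ofReal_natCast]
    push_cast
    rfl
  · obtain ⟨i, -, rfl⟩ := List.mem_map.1 hA
    refine (expect_thresholdBranch_queries_le hf h0 hk (hk.trans hkn) (by linarith)
      (by linarith) (branchDelta_pos hδ) (branchDelta_le hδ1)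
      (threshold_pos_or_zero h0 hk hε i)).trans (le_of_eq ?_)
    simp only [branchIterations, branchSamples]
    push_cast
    rfl
  · rw [length_branches, ← ENNReal.ofReal_natCast]
    push_cast
    rfl

/-- The main algorithm is at least as good as each of its branches. -/
lemma expect_branch_le_expect_main (hf : IsSubmodular f) (h0 : ∀ S, 0 ≤ f S) (hk : 1 ≤ k)
    (hkn : k ≤ Fintype.card N) (hε : 0 < ε) (hε1 : ε < 1) (hδ : 0 < δ) (hδ1 : δ < 1) {i : ℕ}
    (hi : i ≤ lastThreshold k ε) :
    expect ((thresholdBranch k (ε / 6) (branchDelta k ε δ) (threshold f k ε i)).law f)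
        (fun L => ENNReal.ofReal (argmax L).2) ≤
      expect ((adaptiveNonmonotoneMax k ε δ).run f) fun z => ENNReal.ofReal (f z.1) := by
  rw [run_adaptiveNonmonotoneMax, expect_map]
  refine (Alg.expect_parAll_ge f (branches f k ε δ)
    (fun L => ENNReal.ofReal (f (bestCandidate f L)))
    (List.mem_map.2 ⟨i, List.mem_range.2 (by omega), rfl⟩) fun L hL l hl =>
      ENNReal.ofReal_le_ofReal ?_).trans (le_of_eq ?_)
  · exact (bestCandidate_spec h0
      (parAll_branches_outputs hf h0 hk hkn hε hε1 hδ hδ1 L hL)).2.2 l hl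
  · rw [Alg.law, expect_map]

lemma expect_main_value_ge (hf : IsSubmodular f) (h0 : ∀ S, 0 ≤ f S) (hk : 1 ≤ k)
    (hkn : k ≤ Fintype.card N) (hε : 0 < ε) (hε1 : ε < 1) (hδ : 0 < δ) (hδ1 : δ < 1) :
    ENNReal.ofReal ((0.026 - ε) * opt f k) ≤
      expect ((adaptiveNonmonotoneMax k ε δ).run f) fun z => ENNReal.ofReal (f z.1) := by
  obtain ⟨O, hO, hopt⟩ := Finset.exists_mem_eq_sup'
    (s := (Finset.univ : Finset (Finset N)).filter fun S => S.card ≤ k) ⟨∅, by simp⟩ f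
  change opt f k = f O at hopt
  replace hO : O.card ≤ k := by simpa using hO
  have hmax : ∀ S : Finset N, S.card ≤ k → f S ≤ f O := fun S hS => by
    rw [← hopt]
    exact Finset.le_sup' f (by simpa using hS)
  rw [hopt]
  have hO0 := h0 O
  -- for large `ε` the claimed lower bound is not positive
  rcases le_or_gt 0.026 ε with hε' | hε'
  · rw [ENNReal.ofReal_of_nonpos (by nlinarith)]
    exact zero_le
  refine (ENNReal.ofReal_le_ofReal (q := 0.026 * f O) (by nlinarith)).trans ?_
  -- the value of the empty set is reached in every execution
  rcases le_or_gt (f O) (f ∅) with hle | hlt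
  · rw [← expect_const ((adaptiveNonmonotoneMax k ε δ).run f) (ENNReal.ofReal (0.026 * f O))]
    refine expect_mono_support fun z hz => ENNReal.ofReal_le_ofReal ?_
    have := (main_support hf h0 hk hkn hε hε1 hδ hδ1 hz).2.1
    linarith
  have hne : O.Nonempty := by
    rw [Finset.nonempty_iff_ne_empty]
    rintro rfl
    exact lt_irrefl _ hlt
  have hpos : 0 < f O := (h0 ∅).trans_lt hlt
  have hV' : f O ≤ O.card * ⨆ x : N, f {x} := hf.le_card_mul h0 hne
  have hΔ0 : 0 ≤ ⨆ x : N, f {x} := Real.iSup_nonneg fun x => h0 {x}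
  have hV'' : f O ≤ k * ⨆ x : N, f {x} := hV'.trans (by gcongr)
  have hΔ : 0 < ⨆ x : N, f {x} := by
    refine lt_of_le_of_ne hΔ0 fun h => ?_
    rw [← h, mul_zero] at hV'
    linarith
  have hV : ⨆ x : N, f {x} ≤ f O :=
    have : Nonempty N := hne.to_type
    ciSup_le fun x => hmax {x} (by simpa using hk)
  rcases hk.eq_or_lt with rfl | hk2
  · refine le_trans ?_ (expect_branch_le_expect_main hf h0 hk hkn hε hε1 hδ hδ1 (Nat.zero_le _))
    have hτ : threshold f 1 ε 0 = 1 / 7 * f O := by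
      rw [Nat.cast_one, one_mul] at hV''
      rw [le_antisymm hV'' hV]
      simp [threshold]
    exact expect_thresholdBranch_one_ge hf h0 (by linarith) (by linarith) (branchDelta_pos hδ)
      (branchDelta_le hδ1) hO hkn (by rw [hτ]; linarith) hτ
  · obtain ⟨i, hi, h1, h2⟩ := exists_threshold hk2 hε hε1 hΔ hV hV''
    refine le_trans ?_ (expect_branch_le_expect_main hf h0 hk hkn hε hε1 hδ hδ1 hi)
    refine expect_thresholdBranch_ge hf h0 hk (by linarith) (by linarith) (branchDelta_pos hδ)
      (branchDelta_le_of_two_le hk2 hε hε'.le hδ1) hO hkn hpos (le_trans ?_ h1) h2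
    -- `2 / 7 / (1 + 0.026 / 6) ≥ 0.2844`
    rw [le_div_iff₀ (by linarith)]
    nlinarith

end Main

end LowAdaptivity

theorem mainTheorem1 :
    ∃ C : ℕ, ∀ (N : Type) [Fintype N] [DecidableEq N] (f : Finset N → ℝ) (k : ℕ) (ε δ : ℝ),
      (∀ S, 0 ≤ f S) → LowAdaptivity.IsSubmodular f →
      1 ≤ k → k ≤ Fintype.card N → 0 < ε → ε < 1 → 0 < δ → δ < 1 →
      let P : PMF (Finset N × List ℕ) :=
        (LowAdaptivity.adaptiveNonmonotoneMax k ε δ).run f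
      -- the output is feasible, and the number of rounds is small, in every execution
      (∀ z ∈ P.support,
        z.1.card ≤ k ∧
        (z.2.length : ℝ) ≤ C * Real.log ((Fintype.card N + 1) / δ) / ε ∧
        ∀ b ∈ z.2, (b : ℝ) ≤ (C * Fintype.card N * (1 + Real.log (1 / δ)) / ε) ^ C) ∧
      -- the expected number of oracle queries
      ((C * (1 + Real.log (1 / δ)) / ε) ^ C ≤ (Fintype.card N : ℝ) →
        LowAdaptivity.expect P (fun z => (z.2.sum : ENNReal)) ≤
          ENNReal.ofReal (C * Fintype.card N * Real.log (k + 1) / ε ^ 2)) ∧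
      -- the approximation guarantee
      ENNReal.ofReal ((0.026 - ε) * LowAdaptivity.opt f k) ≤
        LowAdaptivity.expect P (fun z => ENNReal.ofReal (f z.1)) := by
  -- every bound holds with a wide margin at this constant
  refine ⟨1000, fun N _ _ f k ε δ h0 hf hk hkn hε hε1 hδ hδ1 => ?_⟩
  refine ⟨fun z hz => ?_, fun hn => ?_, ?_⟩
  · obtain ⟨h1, -, h2, h3⟩ := LowAdaptivity.main_support hf h0 hk hkn hε hε1 hδ hδ1 hz
    refine ⟨h1, ?_, fun b hb => ?_⟩
    · exact le_trans (by exact_mod_cast h2)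
        (LowAdaptivity.rounds_le hk hkn hε hε1 hδ hδ1)
    · exact LowAdaptivity.batch_le hk hkn hε hε1 hδ hδ1 (h3 b hb)
  · exact (LowAdaptivity.expect_main_queries_le hf h0 hk hkn hε hε1 hδ hδ1).trans
      (ENNReal.ofReal_le_ofReal (LowAdaptivity.queries_le hk hkn hε hε1 hδ hδ1 hn))
  · exact LowAdaptivity.expect_main_value_ge hf h0 hk hkn hε hε1 hδ hδ1
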